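/- **Setting.** For $x,\xi\in\mathbb R^n$ let $T_xf(t)=f(t-x)$ and $M_\xi f(t)=e^{2\pi i\xi\cdot t}f(t)$ on $\mathcal S(\mathbb R^n)$ and on its strong dual $\mathcal S'(\mathbb R^n)$; pairings $\langle\cdot,\cdot\rangle$ are bilinear. A *TMIB* on $\mathbb R^n$ is a Banach space $E$ with dense continuous inclusions $\mathcal S(\mathbb R^n)\hookrightarrow E\hookrightarrow\mathcal S'(\mathbb R^n)$, with $T_x(E)\subseteq E$ and $M_\xi(E)\subseteq E$ for all $x,\xi\in\mathbb R^n$, and such that $\|T_x\|_{\mathcal L(E)}\le C_0(1+|x|)^{\tau_0}$ and $\|M_\xi\|_{\mathcal L(E)}\le C_1(1+|\xi|)^{\tau_1}$ for some $C_j,\tau_j>0$ and all $x,\xi$. A *DTMIB* is the strong dual of a TMIB $F$, regarded as a subspace of $\mathcal S'(\mathbb R^n)$ by restricting functionals on $F$ to $\mathcal S(\mathbb R^n)$. Let $E$ be a TMIB or a DTMIB on $\mathbb R^n$, and let $\Lambda_0,\Lambda_1$ be lattices (discrete subgroups spanning $\mathbb R^n$) in $\mathbb R^n$. * $\mathcal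 D'_E:=\{f\in\mathcal S'(\mathbb R^n): f*\varphi\in E \text{ for all }\varphi\in\mathcal S(\mathbb R^n)\}$, with the topology induced by $f\mapsto(\varphi\mapsto f*\varphi)$ from $\mathcal L_b(\mathcal S(\mathbb R^n),E)$, i.e. uniform convergence on the bounded subsets of $\mathcal S(\mathbb R^n)$. * Let $U$ be a bounded open neighbourhood of $0$ such that the sets $\lambda+U$, $\lambda\in\Lambda_0$, are pairwise disjoint, and let $\chi\in\mathcal D(U)\setminus\{0\}$. Then $E_d(\Lambda_0):=\{c\in\mathbb C^{\Lambda_0}: S_\chi(c):=\sum_{\lambda\in\Lambda_0}c_\lambda T_\lambda\chi\in E\}$, with norm $\|c\|_{E_d(\Lambda_0)}:=\|S_\chi(c)\|_E$. * For a normed space $X$, $s'(\Lambda_1;X):=\varinjlim_{N\in\mathbb N}\ell^\infty_{(1+|\cdot|)^{-N}}(\Lambda_1;X)$ is the locally convex inductive limit of the spaces of families $(x_\lambda)_{\lambda\in\Lambda_1}$ in $X$ with $\sup_\lambda\|x_\lambda\|_X(1+|\lambda|)^{-N}<\infty$. * For $\psi\in\mathcal S(\mathbb R^n)$ put $V_\psi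 f(x,\xi):=\langle f,M_{-\xi}T_x\overline\psi\rangle$ for $f\in\mathcal S'(\mathbb R^n)$, and $$C_\psi f:=\bigl(V_\psi f(\lambda_0,\lambda_1)\bigr)_{(\lambda_0,\lambda_1)\in\Lambda_0\times\Lambda_1},\qquad D_\psi c:=\sum_{(\lambda_0,\lambda_1)\in\Lambda_0\times\Lambda_1}c_{\lambda_0,\lambda_1}M_{\lambda_1}T_{\lambda_0}\psi .$$ **Proposition.** For every $\psi\in\mathcal S(\mathbb R^n)$ the linear mappings $$C_\psi:\mathcal D'_E\to s'(\Lambda_1;E_d(\Lambda_0))\qquad\text{and}\qquad D_\psi:s'(\Lambda_1;E_d(\Lambda_0))\to\mathcal D'_E$$ are well defined and continuous, where the (unordered) sum defining $D_\psi c$ converges in $\mathcal S'(\mathbb R^n)$. -/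

import Mathlib

open scoped SchwartzMap ContDiff Distributions Pointwise
open MeasureTheory Set

noncomputable section

namespace TMIB

/-- Euclidean space `ℝⁿ`, with the Euclidean norm. -/
abbrev Rn (n : ℕ) : Type := EuclideanSpace ℝ (Fin n)

/-- The space `𝓢'(ℝⁿ)` of tempered distributions as the *strong* dual of `𝓢(ℝⁿ)`, that is, with the
topology of uniform convergence on bounded subsets of `𝓢(ℝⁿ)`. The value `u φ` is the bilinear
pairing `⟨u, φ⟩`. -/
abbrev TempDist (n : ℕ) : Type := StrongDual ℂ 𝓢(Rn n, ℂ)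

variable {n : ℕ}

/-! ### Elementary operations on `𝓢` and `𝓢'` -/

/-- The character `t ↦ exp(2πi ξ·t)`. -/
def character (ξ : Rn n) (t : Rn n) : ℂ :=
  Complex.exp (2 * Real.pi * Complex.I * (inner ℝ ξ t : ℝ))

theorem character_hasTemperateGrowth (ξ : Rn n) : (character ξ).HasTemperateGrowth := by
  have h1 : Function.HasTemperateGrowth (fun r : ℝ => Complex.exp (Complex.I * r)) := by
    have hc : ∀ m : ℕ, iteratedDeriv m (fun r : ℝ => Complex.exp (Complex.I * r))
        = fun r : ℝ => Complex.I ^ m * Complex.exp (Complex.I * r) := by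
      intro m
      induction m with
      | zero => simp
      | succ m ih =>
        rw [iteratedDeriv_succ, ih]
        funext r
        have : HasDerivAt (fun r : ℝ => Complex.exp (Complex.I * r))
            (Complex.exp (Complex.I * r) * (Complex.I * 1)) r :=
          ((Complex.ofRealCLM.hasDerivAt (x := r)).const_mul Complex.I).cexp
        rw [(this.const_mul (Complex.I ^ m)).deriv]
        ring
    refine ⟨(contDiff_const.mul Complex.ofRealCLM.contDiff).cexp, fun m => ⟨0, 1, fun r => ?_⟩⟩
    rw [norm_iteratedFDeriv_eq_norm_iteratedDeriv, hc]
    simp [Complex.norm_exp]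
  have h2 : Function.HasTemperateGrowth (fun t : Rn n => 2 * Real.pi * inner ℝ ξ t) :=
    (Function.HasTemperateGrowth.const (2 * Real.pi)).mul
      (Function.hasTemperateGrowth_inner_right ξ)
  have h3 := h1.comp h2
  convert h3 using 1
  funext t
  simp only [character, Function.comp]
  congr 1
  push_cast
  ring

/-- Translation `T_x φ(t) = φ(t - x)` on `𝓢(ℝⁿ)`. -/
def translate (x : Rn n) : 𝓢(Rn n, ℂ) →L[ℂ] 𝓢(Rn n, ℂ) := SchwartzMap.compSubConstCLM ℂ x

theorem translate_apply (x : Rn n) (φ : 𝓢(Rn n, ℂ)) (t : Rn n) : translate x φ t = φ (t - x) := rfl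

/-- Modulation `M_ξ φ(t) = exp(2πi ξ·t) φ(t)` on `𝓢(ℝⁿ)`. -/
def modulate (ξ : Rn n) : 𝓢(Rn n, ℂ) →L[ℂ] 𝓢(Rn n, ℂ) := SchwartzMap.smulLeftCLM ℂ (character ξ)

theorem modulate_apply (ξ : Rn n) (φ : 𝓢(Rn n, ℂ)) (t : Rn n) :
    modulate ξ φ t = Complex.exp (2 * Real.pi * Complex.I * (inner ℝ ξ t : ℝ)) * φ t := by
  simp [modulate, character_hasTemperateGrowth, character]

/-- Reflection `φ̌(t) = φ(-t)` on `𝓢(ℝⁿ)`. -/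
def reflect : 𝓢(Rn n, ℂ) →L[ℂ] 𝓢(Rn n, ℂ) :=
  SchwartzMap.compCLMOfContinuousLinearEquiv ℂ (ContinuousLinearEquiv.neg ℝ)

theorem reflect_apply (φ : 𝓢(Rn n, ℂ)) (t : Rn n) : reflect φ t = φ (-t) := rfl

/-- Complex conjugation on `𝓢(ℝⁿ)`. -/
def conjugate (φ : 𝓢(Rn n, ℂ)) : 𝓢(Rn n, ℂ) :=
  SchwartzMap.postcompCLM (𝕜 := ℝ) (Complex.conjCLE : ℂ →L[ℝ] ℂ) φ

theorem conjugate_apply (φ : 𝓢(Rn n, ℂ)) (t : Rn n) :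
    conjugate φ t = starRingEnd ℂ (φ t) := rfl

/-- Translation `T_x` on `𝓢'(ℝⁿ)`, by duality: `⟨T_x u, φ⟩ = ⟨u, T_{-x} φ⟩`. -/
def translateDist (x : Rn n) (u : TempDist n) : TempDist n := u.comp (translate (-x))

/-- Modulation `M_ξ` on `𝓢'(ℝⁿ)`, by duality: `⟨M_ξ u, φ⟩ = ⟨u, M_ξ φ⟩`. -/
def modulateDist (ξ : Rn n) (u : TempDist n) : TempDist n := u.comp (modulate ξ)

/-- The inclusion `𝓢(ℝⁿ) → 𝓢'(ℝⁿ)`, `⟨ψ, φ⟩ = ∫ ψ(t) φ(t) dt`. -/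
def schwartzToDist (ψ : 𝓢(Rn n, ℂ)) : TempDist n :=
  (SchwartzMap.integralCLM ℂ (volume : Measure (Rn n))).comp (SchwartzMap.smulLeftCLM ℂ ψ)

theorem schwartzToDist_apply (ψ φ : 𝓢(Rn n, ℂ)) :
    schwartzToDist ψ φ = ∫ t, ψ t * φ t := by
  simp [schwartzToDist, SchwartzMap.smulLeftCLM_apply_apply ψ.hasTemperateGrowth]

/-- The tempered distribution `u` is (the regular distribution given by) the function `g`, as an
identity in `𝓓'(ℝⁿ)`: `g` is locally integrable and `⟨u, φ⟩ = ∫ g(t) φ(t) dt` for all smooth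
compactly supported `φ`. -/
def IsGivenBy (u : TempDist n) (g : Rn n → ℂ) : Prop :=
  LocallyIntegrable g ∧ ∀ φ : 𝓢(Rn n, ℂ), HasCompactSupport φ → u φ = ∫ t, g t * φ t

/-- The convolution `f * φ` of `f ∈ 𝓢'(ℝⁿ)` and `φ ∈ 𝓢(ℝⁿ)`, that is, the (smooth) function
`x ↦ ⟨f, φ(x - ·)⟩ = ⟨f, T_x φ̌⟩`. -/
def conv (f : TempDist n) (φ : 𝓢(Rn n, ℂ)) (x : Rn n) : ℂ := f (translate x (reflect φ))

/-- The time-frequency shift `π(x, ξ) = M_ξ T_x` on `𝓢(ℝⁿ)`. -/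
def timeFreqShift (x ξ : Rn n) (φ : 𝓢(Rn n, ℂ)) : 𝓢(Rn n, ℂ) := modulate ξ (translate x φ)

/-- The short-time Fourier transform `V_ψ f(x, ξ) = ⟨f, π(x, -ξ) ψ̄⟩` of `f ∈ 𝓢'(ℝⁿ)`. -/
def stft (ψ : 𝓢(Rn n, ℂ)) (f : TempDist n) (x ξ : Rn n) : ℂ :=
  f (timeFreqShift x (-ξ) (conjugate ψ))

/-! ### Compactly supported test functions determine a tempered distribution -/

theorem norm_iteratedFDeriv_comp_smul_le {f : Rn n → ℂ} (hf : ContDiff ℝ ∞ f) {s : ℝ}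
    (hs0 : 0 ≤ s) (hs1 : s ≤ 1) (i : ℕ) (x : Rn n) :
    ‖iteratedFDeriv ℝ i (fun y => f (s • y)) x‖ ≤ ‖iteratedFDeriv ℝ i f (s • x)‖ := by
  let L : Rn n →L[ℝ] Rn n := s • ContinuousLinearMap.id ℝ (Rn n)
  have hL : ‖L‖ ≤ 1 := by
    refine ContinuousLinearMap.opNorm_le_bound _ zero_le_one fun y => ?_
    simp only [L, _root_.smul_apply, ContinuousLinearMap.id_apply, norm_smul,
      Real.norm_of_nonneg hs0]
    gcongr
  have h := L.iteratedFDeriv_comp_right (i := i) hf x (mod_cast le_top)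
  have h' : (f ∘ L) = fun y => f (s • y) := rfl
  rw [h'] at h
  rw [h]
  refine (ContinuousMultilinearMap.norm_compContinuousLinearMap_le _ _).trans ?_
  refine mul_le_of_le_one_right (norm_nonneg _) ?_
  exact Finset.prod_le_one (fun _ _ => norm_nonneg _) fun _ _ => hL

theorem exists_cutoff_tendsto (φ : 𝓢(Rn n, ℂ)) :
    ∃ u : ℕ → 𝓢(Rn n, ℂ), (∀ k, HasCompactSupport (u k)) ∧
      Filter.Tendsto u Filter.atTop (nhds φ) := by
  let b : ContDiffBump (0 : Rn n) := ⟨1, 2, by norm_num, by norm_num⟩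
  let β : Rn n → ℂ := fun x => ((b x : ℝ) : ℂ)
  have hβsm : ContDiff ℝ ∞ β := Complex.ofRealCLM.contDiff.comp b.contDiff
  have hβc : HasCompactSupport β := b.hasCompactSupport.comp_left (g := Complex.ofReal) (by simp)
  have hβ1 : ∀ x : Rn n, ‖x‖ < 1 → β x = 1 := fun x hx => by
    simp only [β]
    rw [b.one_of_mem_closedBall (by simpa using hx.le), Complex.ofReal_one]
  let s : ℕ → ℝ := fun k => ((k : ℝ) + 1)⁻¹
  have hs0 : ∀ k, 0 < s k := fun k => by positivity
  have hs1 : ∀ k, s k ≤ 1 := fun k => inv_le_one_of_one_le₀ (by simp)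
  have hsm : ∀ k, ContDiff ℝ ∞ fun x => β (s k • x) * φ x := fun k =>
    (hβsm.comp (contDiff_const_smul (s k))).mul (φ.smooth ⊤)
  have hc : ∀ k, HasCompactSupport fun x => β (s k • x) * φ x := fun k =>
    HasCompactSupport.mul_right (hβc.comp_smul (hs0 k).ne')
  refine ⟨fun k => (hc k).toSchwartzMap (hsm k), hc, ?_⟩
  let f : Rn n → ℂ := fun x => β x - 1
  have hfsm : ContDiff ℝ ∞ f := hβsm.sub contDiff_const
  have hft : f.HasTemperateGrowth :=
    (hβc.hasTemperateGrowth hβsm).sub (Function.HasTemperateGrowth.const 1)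
  rw [(schwartz_withSeminorms ℝ (Rn n) ℂ).tendsto_nhds]
  rintro ⟨k, m⟩ ε hε
  obtain ⟨l, C, hC0, hC⟩ := hft.norm_iteratedFDeriv_le_uniform m
  let P : ℝ := (Finset.Iic (k + 1 + l, m)).sup (schwartzSeminormFamily ℝ (Rn n) ℂ) φ
  let M : ℝ := ∑ i ∈ Finset.range (m + 1), (m.choose i : ℝ) * C * (2 ^ (k + 1 + l) * P)
  have hP : 0 ≤ P := apply_nonneg _ _
  have hM : 0 ≤ M := Finset.sum_nonneg fun i _ => by positivity
  have key : ∀ N, SchwartzMap.seminorm ℝ k m ((hc N).toSchwartzMap (hsm N) - φ) ≤ s N * M := by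
    intro N
    refine SchwartzMap.seminorm_le_bound ℝ k m _ (mul_nonneg (hs0 N).le hM) fun x => ?_
    have hfun : (((hc N).toSchwartzMap (hsm N) - φ : 𝓢(Rn n, ℂ)) : Rn n → ℂ)
        = fun x => f (s N • x) * φ x := by
      funext y
      simp [f, sub_mul]
    rw [hfun]
    by_cases hx : s N * ‖x‖ < 1
    · have hz : (fun x => f (s N • x) * φ x) =ᶠ[nhds x] fun _ => 0 := by
        have hopen : IsOpen {y : Rn n | s N * ‖y‖ < 1} :=
          isOpen_lt (by fun_prop) continuous_const
        filter_upwards [hopen.mem_nhds hx] with y hy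
        have : β (s N • y) = 1 := hβ1 _ (by
          rw [norm_smul, Real.norm_of_nonneg (hs0 N).le]; exact hy)
        simp [f, this]
      rw [hz.iteratedFDeriv ℝ m |>.eq_of_nhds]
      have : iteratedFDeriv ℝ m (fun _ : Rn n => (0 : ℂ)) x = 0 := by simp
      rw [this, norm_zero, mul_zero]
      exact mul_nonneg (hs0 N).le hM
    · push Not at hx
      have hL := norm_iteratedFDeriv_mul_le (𝕜 := ℝ) (n := m)
        (hfsm.comp (contDiff_const_smul (s N))) (φ.smooth ⊤) x (mod_cast le_top)
      calc ‖x‖ ^ k * ‖iteratedFDeriv ℝ m (fun x => f (s N • x) * φ x) x‖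
          ≤ ‖x‖ ^ k * (s N * ‖x‖) * ∑ i ∈ Finset.range (m + 1), (m.choose i : ℝ) *
            ‖iteratedFDeriv ℝ i (fun x => f (s N • x)) x‖ *
            ‖iteratedFDeriv ℝ (m - i) φ x‖ := by
            refine mul_le_mul ?_ hL (norm_nonneg _) (by have := hs0 N; positivity)
            exact le_mul_of_one_le_right (by positivity) hx
        _ = s N * ∑ i ∈ Finset.range (m + 1), (m.choose i : ℝ) * (‖x‖ ^ (k + 1) *
            ‖iteratedFDeriv ℝ i (fun x => f (s N • x)) x‖ *
            ‖iteratedFDeriv ℝ (m - i) φ x‖) := by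
            rw [Finset.mul_sum, Finset.mul_sum]
            refine Finset.sum_congr rfl fun i _ => ?_
            ring
        _ ≤ s N * M := by
            refine mul_le_mul_of_nonneg_left ?_ (hs0 N).le
            refine Finset.sum_le_sum fun i hi => ?_
            rw [mul_assoc (m.choose i : ℝ) C]
            refine mul_le_mul_of_nonneg_left ?_ (Nat.cast_nonneg _)
            have him : i ≤ m := Nat.lt_succ_iff.1 (Finset.mem_range.1 hi)
            have hsx : ‖s N • x‖ ≤ ‖x‖ := by
              rw [norm_smul, Real.norm_of_nonneg (hs0 N).le]
              exact mul_le_of_le_one_left (norm_nonneg _) (hs1 N)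
            have e1 : ‖iteratedFDeriv ℝ i (fun x => f (s N • x)) x‖ ≤ C * (1 + ‖x‖) ^ l := by
              refine (norm_iteratedFDeriv_comp_smul_le hfsm (hs0 N).le (hs1 N) i x).trans ?_
              refine (hC i him _).trans ?_
              gcongr
            have e2 : (1 + ‖x‖) ^ (k + 1 + l) * ‖iteratedFDeriv ℝ (m - i) φ x‖
                ≤ 2 ^ (k + 1 + l) * P :=
              SchwartzMap.one_add_le_sup_seminorm_apply (m := (k + 1 + l, m)) le_rfl
                (Nat.sub_le _ _) φ x
            have e3 : ‖x‖ ^ (k + 1) ≤ (1 + ‖x‖) ^ (k + 1) := by gcongr; simp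
            calc ‖x‖ ^ (k + 1) * ‖iteratedFDeriv ℝ i (fun x => f (s N • x)) x‖ *
                  ‖iteratedFDeriv ℝ (m - i) φ x‖
                ≤ (1 + ‖x‖) ^ (k + 1) * (C * (1 + ‖x‖) ^ l) *
                  ‖iteratedFDeriv ℝ (m - i) φ x‖ := by gcongr
              _ = C * ((1 + ‖x‖) ^ (k + 1 + l) * ‖iteratedFDeriv ℝ (m - i) φ x‖) := by ring
              _ ≤ C * (2 ^ (k + 1 + l) * P) := by gcongr
  have hs : Filter.Tendsto (fun N => s N * M) Filter.atTop (nhds 0) := by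
    have : Filter.Tendsto s Filter.atTop (nhds 0) := by
      simpa [s] using tendsto_one_div_add_atTop_nhds_zero_nat (𝕜 := ℝ)
    have h := this.mul_const M
    rwa [zero_mul] at h
  filter_upwards [hs.eventually (gt_mem_nhds hε)] with N hN
  exact (key N).trans_lt hN

theorem dist_ext {u v : TempDist n}
    (h : ∀ φ : 𝓢(Rn n, ℂ), HasCompactSupport φ → u φ = v φ) : u = v := by
  ext φ
  obtain ⟨w, hw, hlim⟩ := exists_cutoff_tendsto φ
  have h1 := (u.continuous.tendsto φ).comp hlim
  have h2 := (v.continuous.tendsto φ).comp hlim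
  have h3 : u ∘ w = v ∘ w := funext fun k => h _ (hw k)
  rw [h3] at h1
  exact tendsto_nhds_unique h1 h2

theorem IsGivenBy.integrable {g : Rn n → ℂ} (hg : LocallyIntegrable g) {φ : 𝓢(Rn n, ℂ)}
    (hφ : HasCompactSupport φ) : Integrable (fun t => g t * φ t) := by
  simpa [mul_comm] using hg.integrable_smul_left_of_hasCompactSupport φ.continuous hφ

theorem IsGivenBy.add {u v : TempDist n} {g h : Rn n → ℂ} (hu : IsGivenBy u g)
    (hv : IsGivenBy v h) : IsGivenBy (u + v) (g + h) := by
  refine ⟨hu.1.add hv.1, fun φ hφ => ?_⟩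
  have := integral_add (IsGivenBy.integrable hu.1 hφ) (IsGivenBy.integrable hv.1 hφ)
  simp only [_root_.add_apply, Pi.add_apply, add_mul, hu.2 φ hφ, hv.2 φ hφ]
  exact this.symm

theorem IsGivenBy.smul {u : TempDist n} {g : Rn n → ℂ} (hu : IsGivenBy u g) (a : ℂ) :
    IsGivenBy (a • u) (a • g) := by
  refine ⟨hu.1.smul a, fun φ hφ => ?_⟩
  simp only [_root_.smul_apply, Pi.smul_apply, smul_eq_mul, hu.2 φ hφ, mul_assoc]
  exact (integral_const_mul a _).symm

theorem IsGivenBy.zero : IsGivenBy (0 : TempDist n) 0 :=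
  ⟨locallyIntegrable_zero, fun φ _ => by simp⟩

theorem IsGivenBy.unique {u v : TempDist n} {g : Rn n → ℂ} (hu : IsGivenBy u g)
    (hv : IsGivenBy v g) : u = v :=
  dist_ext fun φ hφ => (hu.2 φ hφ).trans (hv.2 φ hφ).symm

/-! ### TMIB and DTMIB -/

/-- A continuous (linear, injective) inclusion of a normed space `E` into `𝓢'(ℝⁿ)`. -/
structure DistInclusion (n : ℕ) (E : Type*) [NormedAddCommGroup E] [NormedSpace ℂ E] where
  toCLM : E →L[ℂ] TempDist n
  injective : Function.Injective toCLM

section Spaces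

variable {E : Type*} [NormedAddCommGroup E] [NormedSpace ℂ E]

/-- The Banach space `E`, included in `𝓢'(ℝⁿ)` via `J`, is a translation-modulation invariant Banach
space of distributions. (Since `J` is injective, `e'` with `J e' = T_x (J e)` is the element
`T_x e` of `E`, so the bounds below are bounds on the operator norms of `T_x` and `M_ξ` on `E`.) -/
structure IsTMIB [CompleteSpace E] (J : DistInclusion n E) : Prop where
  /-- dense continuous inclusion `𝓢(ℝⁿ) ↪ E` -/
  dense_inclusion : ∃ j : 𝓢(Rn n, ℂ) →L[ℂ] E, DenseRange j ∧ ∀ φ, J.toCLM (j φ) = schwartzToDist φ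
  translate_mem : ∀ (x : Rn n) (e : E), ∃ e' : E, J.toCLM e' = translateDist x (J.toCLM e)
  modulate_mem : ∀ (ξ : Rn n) (e : E), ∃ e' : E, J.toCLM e' = modulateDist ξ (J.toCLM e)
  translate_bound : ∃ τ₀ C₀ : ℝ, 0 < τ₀ ∧ 0 < C₀ ∧ ∀ (x : Rn n) (e e' : E),
    J.toCLM e' = translateDist x (J.toCLM e) → ‖e'‖ ≤ C₀ * (1 + ‖x‖) ^ τ₀ * ‖e‖
  modulate_bound : ∃ τ₁ C₁ : ℝ, 0 < τ₁ ∧ 0 < C₁ ∧ ∀ (ξ : Rn n) (e e' : E),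
    J.toCLM e' = modulateDist ξ (J.toCLM e) → ‖e'‖ ≤ C₁ * (1 + ‖ξ‖) ^ τ₁ * ‖e‖

/-- The Banach space `E`, included in `𝓢'(ℝⁿ)` via `J`, is the strong dual of a TMIB `F`: there is
an isomorphism `Φ` of `E` with the strong dual of `F` under which the distribution `J e` is the
restriction of the functional `Φ e` to `𝓢(ℝⁿ) ⊆ F`. -/
def IsDTMIB.{w} (J : DistInclusion n E) : Prop :=
  ∃ (F : Type w) (_ : NormedAddCommGroup F) (_ : NormedSpace ℂ F) (_ : CompleteSpace F)
    (K : DistInclusion n F) (Φ : E ≃L[ℂ] StrongDual ℂ F), IsTMIB K ∧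
    ∀ (e : E) (φ : 𝓢(Rn n, ℂ)) (f : F), K.toCLM f = schwartzToDist φ → J.toCLM e φ = Φ e f

/-! ### The distribution space `𝓓'_E` -/

theorem conv_add (f g : TempDist n) (φ : 𝓢(Rn n, ℂ)) : conv (f + g) φ = conv f φ + conv g φ := rfl

theorem conv_zero (φ : 𝓢(Rn n, ℂ)) : conv (0 : TempDist n) φ = 0 := rfl

theorem conv_smul (a : ℂ) (f : TempDist n) (φ : 𝓢(Rn n, ℂ)) : conv (a • f) φ = a • conv f φ := rfl

/-- The vector space `{f ∈ 𝓢'(ℝⁿ) | f * φ ∈ E for all φ ∈ 𝓢(ℝⁿ)}`. -/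
def distSubmodule (J : DistInclusion n E) : Submodule ℂ (TempDist n) where
  carrier := {f | ∀ φ : 𝓢(Rn n, ℂ), ∃ e : E, IsGivenBy (J.toCLM e) (conv f φ)}
  add_mem' {f g} hf hg φ := by
    obtain ⟨e, he⟩ := hf φ
    obtain ⟨e', he'⟩ := hg φ
    exact ⟨e + e', by simpa only [map_add, conv_add] using he.add he'⟩
  zero_mem' φ := ⟨0, by simpa only [map_zero, conv_zero] using IsGivenBy.zero⟩
  smul_mem' a f hf φ := by
    obtain ⟨e, he⟩ := hf φ
    exact ⟨a • e, by simpa only [map_smul, conv_smul] using he.smul a⟩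

/-- The space `𝓓'_E` of all `f ∈ 𝓢'(ℝⁿ)` such that `f * φ ∈ E` for all `φ ∈ 𝓢(ℝⁿ)`. -/
def DistSpace (J : DistInclusion n E) : Type := distSubmodule J

namespace DistSpace

variable (J : DistInclusion n E)

instance : AddCommGroup (DistSpace J) := inferInstanceAs (AddCommGroup (distSubmodule J))

instance : Module ℂ (DistSpace J) := inferInstanceAs (Module ℂ (distSubmodule J))

variable {J}

/-- The underlying tempered distribution. -/
def toDist (f : DistSpace J) : TempDist n := Subtype.val (p := (· ∈ distSubmodule J)) f

/-- The convolution `f * φ` as an element of `E`. -/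
def convE (f : DistSpace J) (φ : 𝓢(Rn n, ℂ)) : E :=
  (Subtype.property (p := (· ∈ distSubmodule J)) f φ).choose

theorem convE_spec (f : DistSpace J) (φ : 𝓢(Rn n, ℂ)) :
    IsGivenBy (J.toCLM (convE f φ)) (conv f.toDist φ) :=
  (Subtype.property (p := (· ∈ distSubmodule J)) f φ).choose_spec

/-- `f * φ` is the only element of `E` that is given by the function `x ↦ ⟨f, φ(x - ·)⟩`. -/
theorem eq_convE (f : DistSpace J) (φ : 𝓢(Rn n, ℂ)) {e : E}
    (he : IsGivenBy (J.toCLM e) (conv f.toDist φ)) : e = convE f φ :=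
  J.injective (he.unique (convE_spec f φ))

/-- The topology of `𝓓'_E`: the topology of uniform convergence of the maps `φ ↦ f * φ` from `𝓢(ℝⁿ)`
to `E` on the bounded subsets of `𝓢(ℝⁿ)`, that is, the topology induced from `L_b(𝓢(ℝⁿ), E)` by
`f ↦ (φ ↦ f * φ)`. (The topology of `L_b(𝓢(ℝⁿ), E)` is itself induced from the space `𝓢(ℝⁿ) → E` of
all functions with uniform convergence on bounded sets, which is used here.) -/
instance : TopologicalSpace (DistSpace J) :=
  TopologicalSpace.induced
    (fun f => UniformOnFun.ofFun {B : Set 𝓢(Rn n, ℂ) | Bornology.IsVonNBounded ℂ B} (convE f))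
    inferInstance

end DistSpace

/-! ### The discrete space `E_d(Λ)` -/

/-- A window for the definition of the discrete space on the lattice `Λ`: a bounded open
neighbourhood `U` of `0` such that the sets `λ + U`, `λ ∈ Λ`, are pairwise disjoint, and a function
`χ ∈ 𝓓(U) \ {0}`. -/
structure DiscreteWindow (Λ : Submodule ℤ (Rn n)) where
  U : TopologicalSpace.Opens (Rn n)
  zero_mem : (0 : Rn n) ∈ U
  bounded : Bornology.IsBounded (U : Set (Rn n))
  disjoint : Pairwise fun l m : Λ => Disjoint ((l : Rn n) +ᵥ (U : Set (Rn n))) ((m : Rn n) +ᵥ (U : Set (Rn n)))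
  χ : 𝓓(U, ℂ)
  ne_zero : χ ≠ 0

variable {Λ : Submodule ℤ (Rn n)}

/-- The function `S_χ(c) = ∑_{λ ∈ Λ} c_λ T_λ χ`, for arbitrary `c ∈ ℂ^Λ`; at every point at most one
term is nonzero. -/
def synthFun (W : DiscreteWindow Λ) (c : Λ → ℂ) (t : Rn n) : ℂ :=
  ∑ᶠ l : Λ, c l * W.χ (t - l)

theorem DiscreteWindow.mem_of_ne (W : DiscreteWindow Λ) {l : Λ} {t : Rn n}
    (h : W.χ (t - l) ≠ 0) : t ∈ (l : Rn n) +ᵥ (W.U : Set (Rn n)) := by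
  refine ⟨t - l, W.χ.tsupport_subset (subset_tsupport _ h), by simp⟩

theorem DiscreteWindow.subsingleton (W : DiscreteWindow Λ) (c : Λ → ℂ) (t : Rn n) :
    (Function.support fun l : Λ => c l * W.χ (t - l)).Subsingleton := by
  intro l hl m hm
  by_contra hne
  exact Set.disjoint_left.1 (W.disjoint hne) (W.mem_of_ne (right_ne_zero_of_mul hl))
    (W.mem_of_ne (right_ne_zero_of_mul hm))

theorem synthFun_add (W : DiscreteWindow Λ) (c d : Λ → ℂ) :
    synthFun W (c + d) = synthFun W c + synthFun W d := by
  funext t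
  simp only [synthFun, Pi.add_apply, add_mul]
  exact finsum_add_distrib (W.subsingleton c t).finite (W.subsingleton d t).finite

theorem synthFun_smul (W : DiscreteWindow Λ) (a : ℂ) (c : Λ → ℂ) :
    synthFun W (a • c) = a • synthFun W c := by
  funext t
  simp only [synthFun, Pi.smul_apply, smul_eq_mul, mul_assoc]
  exact (mul_finsum _ _).symm

theorem synthFun_eq (W : DiscreteWindow Λ) (c : Λ → ℂ) (l : Λ) {t : Rn n}
    (ht : t ∈ (l : Rn n) +ᵥ (W.U : Set (Rn n))) : synthFun W c t = c l * W.χ (t - l) := by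
  refine finsum_eq_single _ l fun m hm => ?_
  by_contra h
  exact Set.disjoint_left.1 (W.disjoint hm) (W.mem_of_ne (right_ne_zero_of_mul h)) ht

/-- The vector space `{c ∈ ℂ^Λ | S_χ(c) ∈ E}`. -/
def discreteSubmodule (J : DistInclusion n E) (W : DiscreteWindow Λ) : Submodule ℂ (Λ → ℂ) where
  carrier := {c | ∃ e : E, IsGivenBy (J.toCLM e) (synthFun W c)}
  add_mem' := by
    rintro c d ⟨e, he⟩ ⟨e', he'⟩
    exact ⟨e + e', by simpa only [map_add, synthFun_add] using he.add he'⟩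
  zero_mem' := ⟨0, by
    have : synthFun W 0 = 0 := by funext t; simp [synthFun]
    simpa only [map_zero, this] using IsGivenBy.zero⟩
  smul_mem' := by
    rintro a c ⟨e, he⟩
    exact ⟨a • e, by simpa only [map_smul, synthFun_smul] using he.smul a⟩

/-- The discrete space `E_d(Λ) = E_{d,χ}(Λ)` of all `c ∈ ℂ^Λ` such that `S_χ(c) ∈ E`. -/
def DiscreteSpace (J : DistInclusion n E) (W : DiscreteWindow Λ) : Type := discreteSubmodule J W

namespace DiscreteSpace

variable (J : DistInclusion n E) (W : DiscreteWindow Λ)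

instance : AddCommGroup (DiscreteSpace J W) :=
  inferInstanceAs (AddCommGroup (discreteSubmodule J W))

instance : Module ℂ (DiscreteSpace J W) := inferInstanceAs (Module ℂ (discreteSubmodule J W))

variable {J W}

/-- The underlying family of complex numbers. -/
def toFun (c : DiscreteSpace J W) : Λ → ℂ := Subtype.val (p := (· ∈ discreteSubmodule J W)) c

instance : CoeFun (DiscreteSpace J W) fun _ => Λ → ℂ := ⟨toFun⟩

theorem exists_isGivenBy (c : DiscreteSpace J W) :
    ∃ e : E, IsGivenBy (J.toCLM e) (synthFun W c) :=
  Subtype.property (p := (· ∈ discreteSubmodule J W)) c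

theorem eq_of_isGivenBy {g : Rn n → ℂ} {e e' : E} (he : IsGivenBy (J.toCLM e) g)
    (he' : IsGivenBy (J.toCLM e') g) : e = e' :=
  J.injective (he.unique he')

variable (J W)

/-- The linear map `S_χ : E_d(Λ) → E`. -/
def synth : DiscreteSpace J W →ₗ[ℂ] E where
  toFun c := c.exists_isGivenBy.choose
  map_add' c d := by
    refine eq_of_isGivenBy (c + d).exists_isGivenBy.choose_spec ?_
    have := c.exists_isGivenBy.choose_spec.add d.exists_isGivenBy.choose_spec
    rw [← synthFun_add, ← map_add] at this
    exact this
  map_smul' a c := by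
    refine eq_of_isGivenBy (a • c).exists_isGivenBy.choose_spec ?_
    have := c.exists_isGivenBy.choose_spec.smul a
    rw [← synthFun_smul, ← map_smul] at this
    exact this

variable {J W}

theorem synth_spec (c : DiscreteSpace J W) : IsGivenBy (J.toCLM (synth J W c)) (synthFun W c) :=
  c.exists_isGivenBy.choose_spec

theorem synth_injective : Function.Injective (synth J W) := by
  rw [injective_iff_map_eq_zero]
  intro c hc
  have h := synth_spec c
  rw [hc, map_zero] at h
  have hae : ∀ᵐ t, synthFun W c t = 0 := by
    refine ae_eq_zero_of_integral_contDiff_smul_eq_zero h.1 fun g hg hgc => ?_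
    have hgc' : HasCompactSupport fun t => ((g t : ℝ) : ℂ) :=
      hgc.comp_left (g := Complex.ofReal) (by simp)
    have hg' : ContDiff ℝ ∞ fun t => ((g t : ℝ) : ℂ) := Complex.ofRealCLM.contDiff.comp hg
    have := h.2 (hgc'.toSchwartzMap hg') hgc'
    simpa [mul_comm] using this.symm
  obtain ⟨t₀, ht₀⟩ : ∃ t, W.χ t ≠ 0 := by
    by_contra hne
    push Not at hne
    exact W.ne_zero (by ext t; simpa using hne t)
  refine Subtype.ext (p := (· ∈ discreteSubmodule J W)) (funext fun l => ?_)
  change c l = 0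
  by_contra hl
  let V : Set (Rn n) := {t | W.χ (t - l) ≠ 0}
  have hV : IsOpen V :=
    isOpen_ne.preimage (W.χ.contDiff.continuous.comp (continuous_id.sub continuous_const))
  have hne : V.Nonempty := ⟨t₀ + l, by simpa [V] using ht₀⟩
  have hpos := hV.measure_pos volume hne
  refine hpos.ne' (measure_mono_null (fun t ht => ?_) hae)
  have h0 : W.χ (t - l) ≠ 0 := ht
  change ¬ (synthFun W c t = 0)
  rw [synthFun_eq W c l (W.mem_of_ne h0)]
  exact mul_ne_zero hl h0

/-- The norm of `E_d(Λ)` is `‖c‖ = ‖S_χ(c)‖_E`. -/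
instance : NormedAddCommGroup (DiscreteSpace J W) :=
  NormedAddCommGroup.induced _ _ (synth J W) synth_injective

theorem norm_eq (c : DiscreteSpace J W) : ‖c‖ = ‖synth J W c‖ := rfl

instance : NormedSpace ℂ (DiscreteSpace J W) := NormedSpace.induced ℂ _ _ (synth J W)

end DiscreteSpace

end Spaces

/-! ### The space `s'(Λ; X)` -/

section Sequences

variable (Λ : Submodule ℤ (Rn n)) (X : Type*) [NormedAddCommGroup X] [NormedSpace ℂ X]

/-- The family `((1 + |λ|)^{-N} x_λ)_λ`. -/
def weighted (N : ℕ) : (Λ → X) →ₗ[ℂ] (Λ → X) where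
  toFun x l := (((1 + ‖(l : Rn n)‖) ^ N : ℝ) : ℂ)⁻¹ • x l
  map_add' x y := by funext l; simp
  map_smul' a x := by funext l; simp [smul_comm a]

theorem weighted_injective (N : ℕ) : Function.Injective (weighted Λ X N) := by
  intro x y h
  funext l
  have hl : (((1 + ‖(l : Rn n)‖) ^ N : ℝ) : ℂ)⁻¹ ≠ 0 := by
    rw [ne_eq, inv_eq_zero, Complex.ofReal_eq_zero]
    positivity
  exact smul_right_injective X hl (congrFun h l)

/-- The vector space of all `x ∈ X^Λ` such that `sup_λ ‖x_λ‖ (1 + |λ|)^{-N} < ∞`. -/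
def weightedSubmodule (N : ℕ) : Submodule ℂ (Λ → X) where
  carrier := {x | Memℓp (weighted Λ X N x) ⊤}
  add_mem' hx hy := by
    simp only [Set.mem_ofPred_eq, map_add] at *
    exact hx.add hy
  zero_mem' := by
    simp only [Set.mem_ofPred_eq, map_zero]
    exact zero_memℓp
  smul_mem' a x hx := by
    simp only [Set.mem_ofPred_eq, map_smul] at *
    exact hx.const_smul a

/-- The Banach space `ℓ^∞_{(1+|·|)^{-N}}(Λ; X)`. -/
def WeightedLinf (N : ℕ) : Type _ := weightedSubmodule Λ X N

namespace WeightedLinf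

instance (N : ℕ) : AddCommGroup (WeightedLinf Λ X N) :=
  inferInstanceAs (AddCommGroup (weightedSubmodule Λ X N))

instance (N : ℕ) : Module ℂ (WeightedLinf Λ X N) :=
  inferInstanceAs (Module ℂ (weightedSubmodule Λ X N))

/-- The map `x ↦ ((1 + |λ|)^{-N} x_λ)_λ` into the unweighted space `ℓ^∞(Λ; X)`. -/
def toLinf (N : ℕ) : WeightedLinf Λ X N →ₗ[ℂ] lp (fun _ : Λ => X) ⊤ where
  toFun x := ⟨weighted Λ X N (Subtype.val (p := (· ∈ weightedSubmodule Λ X N)) x),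
    Subtype.property (p := (· ∈ weightedSubmodule Λ X N)) x⟩
  map_add' _ _ := Subtype.ext ((weighted Λ X N).map_add _ _)
  map_smul' _ _ := Subtype.ext ((weighted Λ X N).map_smul _ _)

theorem toLinf_injective (N : ℕ) : Function.Injective (toLinf Λ X N) := fun _ _ h =>
  Subtype.ext (p := (· ∈ weightedSubmodule Λ X N)) (weighted_injective Λ X N (congrArg Subtype.val h))

/-- The norm `‖x‖ = sup_λ ‖x_λ‖ (1 + |λ|)^{-N}`. -/
instance (N : ℕ) : NormedAddCommGroup (WeightedLinf Λ X N) :=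
  NormedAddCommGroup.induced _ _ (toLinf Λ X N) (toLinf_injective Λ X N)

instance (N : ℕ) : NormedSpace ℂ (WeightedLinf Λ X N) :=
  NormedSpace.induced ℂ _ _ (toLinf Λ X N)

end WeightedLinf

theorem weightedSubmodule_mono : Monotone (weightedSubmodule Λ X) := by
  intro M N h x hx
  have hx' : Memℓp (weighted Λ X M x) ⊤ := hx
  rw [memℓp_infty_iff] at hx'
  obtain ⟨C, hC⟩ := hx'
  change Memℓp (weighted Λ X N x) ⊤
  rw [memℓp_infty_iff]
  refine ⟨C, ?_⟩
  rintro _ ⟨l, rfl⟩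
  refine le_trans ?_ (hC ⟨l, rfl⟩)
  have h1 : (1 : ℝ) ≤ 1 + ‖(l : Rn n)‖ := by simp
  simp only [weighted, LinearMap.coe_mk, AddHom.coe_mk, norm_smul, norm_inv, Complex.norm_real,
    norm_pow]
  rw [Real.norm_of_nonneg (by positivity)]
  gcongr

/-- The vector space `⋃_N ℓ^∞_{(1+|·|)^{-N}}(Λ; X)`. -/
def slowSubmodule : Submodule ℂ (Λ → X) where
  carrier := {x | ∃ N, x ∈ weightedSubmodule Λ X N}
  add_mem' := by
    rintro x y ⟨M, hx⟩ ⟨N, hy⟩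
    exact ⟨max M N, add_mem (weightedSubmodule_mono Λ X (le_max_left M N) hx)
      (weightedSubmodule_mono Λ X (le_max_right M N) hy)⟩
  zero_mem' := ⟨0, zero_mem _⟩
  smul_mem' := by
    rintro a x ⟨N, hx⟩
    exact ⟨N, Submodule.smul_mem _ a hx⟩

/-- The `(LB)`-space `s'(Λ; X)`, the inductive limit of the spaces `ℓ^∞_{(1+|·|)^{-N}}(Λ; X)`. -/
def SlowSeq : Type _ := slowSubmodule Λ X

namespace SlowSeq

instance : AddCommGroup (SlowSeq Λ X) := inferInstanceAs (AddCommGroup (slowSubmodule Λ X))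

instance : Module ℂ (SlowSeq Λ X) := inferInstanceAs (Module ℂ (slowSubmodule Λ X))

variable {Λ X} in
/-- The underlying family. -/
def toFun (x : SlowSeq Λ X) : Λ → X := Subtype.val (p := (· ∈ slowSubmodule Λ X)) x

instance : CoeFun (SlowSeq Λ X) fun _ => Λ → X := ⟨toFun⟩

/-- The inclusion of the `N`-th step `ℓ^∞_{(1+|·|)^{-N}}(Λ; X)`. -/
def ofStep (N : ℕ) (x : WeightedLinf Λ X N) : SlowSeq Λ X :=
  Subtype.mk (p := (· ∈ slowSubmodule Λ X)) (Subtype.val (p := (· ∈ weightedSubmodule Λ X N)) x)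
    ⟨N, Subtype.property (p := (· ∈ weightedSubmodule Λ X N)) x⟩

/-- The locally convex inductive limit topology: the finest locally convex vector space topology for
which all the inclusions of the steps are continuous. -/
instance : TopologicalSpace (SlowSeq Λ X) :=
  sInf {t : TopologicalSpace (SlowSeq Λ X) |
    (∀ N, @Continuous _ _ _ t (ofStep Λ X N)) ∧
    @IsTopologicalAddGroup (SlowSeq Λ X) t _ ∧
    @ContinuousSMul ℂ (SlowSeq Λ X) _ _ t ∧
    @LocallyConvexSpace ℝ (SlowSeq Λ X) _ _ _ _ t}

end SlowSeq

end Sequences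

end TMIB

end

/-!
The proof rests on one sampling principle, which comes from Poisson's summation formula. For
Schwartz functions `φ`, `η` and a lattice `Λ` with dual lattice `Λ*` and covolume `|Λ|`,

  `∑_{λ ∈ Λ} φ(λ) T_λ η = |Λ|⁻¹ ∑_{μ ∈ Λ*} (M_{-μ} φ) * η`,

with convergence in `𝓢(ℝⁿ)` (`TMIB.tsum_translate_basisMap`). By duality, for `f ∈ 𝓓'_E`,

  `∑_{λ ∈ Λ} (f * a)(λ) T_λ η = |Λ|⁻¹ ∑_{μ ∈ Λ*} M_{-μ} (f * (M_μ η * a))`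

(`TMIB.hasSum_sampling`). On the right-hand side only convolutions of `f` with Schwartz functions
and modulations occur. The first belong to `E` by the definition of `𝓓'_E`, the second act on `E`
with polynomially bounded norms, and `M_μ η * a` decays rapidly in `μ`, so that the series converges
absolutely in `E`.

Two facts about `E` enter. Modulations, translations and convolutions with Schwartz functions act
boundedly on a TMIB, and by transposition on a DTMIB (`TMIB.HasOperators`). For convolutions this
uses `⟨u, φ * η⟩ = ∫ φ(x) ⟨u, T_x η⟩ dx` for `u ∈ 𝓢'(ℝⁿ)` (`TMIB.dist_convS`), which is again
derived from the sampling formula, as the zeroth Fourier coefficient of a periodization. Moreover,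
`φ ↦ f * φ` is continuous from `𝓢(ℝⁿ)` to `E` for every `f ∈ 𝓓'_E`, by the closed graph theorem
(`TMIB.exists_norm_convE_le`).

*Analysis* (`TMIB.exists_analysis_operator`). For a fixed frequency `ξ` one has
`V_ψ f(λ, ξ) = (M_{-ξ} f * a)(λ)`, where `a` is the reflection of `ψ̄`, so the sampling principle
with `η = χ` shows that the coefficients belong to `E_d(Λ₀)`, with norms growing at most polynomially
in `ξ`. For continuity one needs that a continuous seminorm on `s'(Λ₁; X)` is dominated by a weighted
`ℓ¹`-norm with a rapidly decreasing weight (`TMIB.SlowSeq.exists_seminorm_le`); the seminorm of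
`C_ψ f` is then bounded by the supremum of `‖f * φ‖` for `φ` in one bounded subset of `𝓢(ℝⁿ)`.

*Synthesis* (`TMIB.exists_synthesis_operator`). With a test function `θ` dual to `χ` one has
`c_λ = (S_χ(c) * θ̌)(λ)` for `c ∈ E_d(Λ₀)`, so the sampling principle shows that `c ↦ ∑_λ c_λ T_λ η`
is bounded from `E_d(Λ₀)` to `E` (`TMIB.exists_synthesis`). Since
`(M_ξ T_λ ψ) * φ = M_ξ T_λ (ψ * M_{-ξ} φ)` and `ψ * M_{-ξ} φ` decays rapidly in `ξ`, the series for
`D_ψ c * φ` converges absolutely in `E` when it is summed over `λ` first and then over `ξ`. The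
bounds hold on each step of the inductive limit and uniformly for `φ` in bounded sets, which gives
continuity.
-/

noncomputable section

namespace TMIB

open Filter Topology FourierTransform

variable {n : ℕ}

/-! ### Seminorms on the Schwartz space -/

/-- The supremum of the Schwartz seminorms with at most `m` derivatives and weights of degree at
most `m`. These seminorms increase with `m` and define the topology of `𝓢(ℝⁿ)`. -/
def schwartzNorm (m : ℕ) : Seminorm ℂ 𝓢(Rn n, ℂ) :=
  (Finset.Iic (m, m)).sup (schwartzSeminormFamily ℂ (Rn n) ℂ)

theorem schwartzNorm_mono {m m' : ℕ} (h : m ≤ m') (φ : 𝓢(Rn n, ℂ)) :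
    schwartzNorm m φ ≤ schwartzNorm m' φ := by
  refine Seminorm.le_def.1 (Finset.sup_mono ?_) φ
  exact Finset.Iic_subset_Iic.2 ⟨h, h⟩

theorem seminorm_le_schwartzNorm {m k i : ℕ} (hk : k ≤ m) (hi : i ≤ m) (φ : 𝓢(Rn n, ℂ)) :
    SchwartzMap.seminorm ℂ k i φ ≤ schwartzNorm m φ :=
  Seminorm.le_def.1 (Finset.le_sup (f := schwartzSeminormFamily ℂ (Rn n) ℂ)
    (Finset.mem_Iic.2 (show (k, i) ≤ (m, m) from ⟨hk, hi⟩))) φ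

theorem one_add_pow_mul_le_schwartzNorm {m k i : ℕ} (hk : k ≤ m) (hi : i ≤ m) (φ : 𝓢(Rn n, ℂ))
    (x : Rn n) : (1 + ‖x‖) ^ k * ‖iteratedFDeriv ℝ i φ x‖ ≤ 2 ^ m * schwartzNorm m φ :=
  SchwartzMap.one_add_le_sup_seminorm_apply (m := (m, m)) hk hi φ x

theorem one_add_pow_mul_norm_le (k : ℕ) (φ : 𝓢(Rn n, ℂ)) (x : Rn n) :
    (1 + ‖x‖) ^ k * ‖φ x‖ ≤ 2 ^ k * schwartzNorm k φ := by
  simpa using one_add_pow_mul_le_schwartzNorm (le_refl k) (Nat.zero_le k) φ x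

theorem schwartzNorm_le {m : ℕ} {φ : 𝓢(Rn n, ℂ)} {M : ℝ} (hM : 0 ≤ M)
    (h : ∀ k ≤ m, ∀ i ≤ m, ∀ x, ‖x‖ ^ k * ‖iteratedFDeriv ℝ i φ x‖ ≤ M) :
    schwartzNorm m φ ≤ M := by
  refine Seminorm.finset_sup_apply_le hM fun ⟨k, i⟩ hki => ?_
  have := Finset.mem_Iic.1 hki
  exact SchwartzMap.seminorm_le_bound ℂ k i φ hM (h k this.1 i this.2)

theorem continuous_schwartzNorm (m : ℕ) : Continuous (schwartzNorm (n := n) m) := by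
  refine Seminorm.continuous_of_le (q := ∑ i ∈ Finset.Iic (m, m),
    schwartzSeminormFamily ℂ (Rn n) ℂ i) ?_ (Seminorm.finset_sup_le_sum _ _)
  have : ((∑ i ∈ Finset.Iic (m, m), schwartzSeminormFamily ℂ (Rn n) ℂ i :
      Seminorm ℂ 𝓢(Rn n, ℂ)) : 𝓢(Rn n, ℂ) → ℝ)
      = fun φ => ∑ i ∈ Finset.Iic (m, m), schwartzSeminormFamily ℂ (Rn n) ℂ i φ := by
    funext φ
    exact map_sum (⟨⟨fun p : Seminorm ℂ 𝓢(Rn n, ℂ) => p φ, rfl⟩, fun _ _ => rfl⟩ :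
      Seminorm ℂ 𝓢(Rn n, ℂ) →+ ℝ) _ _
  rw [this]
  exact continuous_finsetSum _ fun i _ =>
    (schwartz_withSeminorms ℂ (Rn n) ℂ).continuous_seminorm i

/-- Every continuous seminorm on `𝓢(ℝⁿ)` is dominated by one of the seminorms `schwartzNorm m`. -/
theorem exists_le_schwartzNorm (q : Seminorm ℂ 𝓢(Rn n, ℂ)) (hq : Continuous q) :
    ∃ (m : ℕ) (C : ℝ), 0 ≤ C ∧ ∀ φ, q φ ≤ C * schwartzNorm m φ := by
  obtain ⟨s, C, -, h⟩ := Seminorm.bound_of_continuous (schwartz_withSeminorms ℂ (Rn n) ℂ) q hq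
  let m := s.sup fun i => max i.1 i.2
  refine ⟨m, C, C.2, fun φ => (h φ).trans ?_⟩
  change (C : ℝ) * _ ≤ _
  refine mul_le_mul_of_nonneg_left (Seminorm.le_def.1 (Finset.sup_mono fun i hi => ?_) φ) C.2
  have := Finset.le_sup (f := fun i : ℕ × ℕ => max i.1 i.2) hi
  exact Finset.mem_Iic.2 ⟨(le_max_left _ _).trans this, (le_max_right _ _).trans this⟩

theorem exists_clm_le_schwartzNorm {F : Type*} [SeminormedAddCommGroup F] [NormedSpace ℂ F]
    (T : 𝓢(Rn n, ℂ) →L[ℂ] F) :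
    ∃ (m : ℕ) (C : ℝ), 0 ≤ C ∧ ∀ φ, ‖T φ‖ ≤ C * schwartzNorm m φ :=
  exists_le_schwartzNorm ((normSeminorm ℂ F).comp T.toLinearMap) (T.continuous.norm)

theorem exists_schwartzNorm_clm_le (T : 𝓢(Rn n, ℂ) →L[ℂ] 𝓢(Rn n, ℂ)) (m : ℕ) :
    ∃ (m' : ℕ) (C : ℝ), 0 ≤ C ∧ ∀ φ, schwartzNorm m (T φ) ≤ C * schwartzNorm m' φ :=
  exists_le_schwartzNorm ((schwartzNorm m).comp T.toLinearMap)
    ((continuous_schwartzNorm m).comp T.continuous)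

theorem tendsto_of_schwartzNorm {ι : Type*} {l : Filter ι} {u : ι → 𝓢(Rn n, ℂ)} {φ : 𝓢(Rn n, ℂ)}
    (h : ∀ m, Tendsto (fun i => schwartzNorm m (u i - φ)) l (𝓝 0)) : Tendsto u l (𝓝 φ) := by
  rw [(schwartz_withSeminorms ℂ (Rn n) ℂ).tendsto_nhds]
  rintro ⟨k, m⟩ ε hε
  filter_upwards [(h (max k m)).eventually (gt_mem_nhds hε)] with i hi
  exact (seminorm_le_schwartzNorm (le_max_left k m) (le_max_right k m) _).trans_lt hi

theorem isVonNBounded_iff_schwartzNorm {B : Set 𝓢(Rn n, ℂ)} :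
    Bornology.IsVonNBounded ℂ B ↔ ∀ m, ∃ C : ℝ, ∀ φ ∈ B, schwartzNorm m φ ≤ C := by
  rw [(schwartz_withSeminorms ℂ (Rn n) ℂ).isVonNBounded_iff_finset_seminorm_bounded]
  constructor
  · intro h m
    obtain ⟨r, -, hr⟩ := h (Finset.Iic (m, m))
    exact ⟨r, fun φ hφ => (hr φ hφ).le⟩
  · intro h I
    let m := I.sup fun i => max i.1 i.2
    obtain ⟨C, hC⟩ := h m
    refine ⟨max C 0 + 1, by positivity, fun φ hφ => ?_⟩
    have h1 : I.sup (schwartzSeminormFamily ℂ (Rn n) ℂ) φ ≤ schwartzNorm m φ := by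
      refine Seminorm.le_def.1 (Finset.sup_mono fun i hi => ?_) φ
      have := Finset.le_sup (f := fun i : ℕ × ℕ => max i.1 i.2) hi
      exact Finset.mem_Iic.2 ⟨(le_max_left _ _).trans this, (le_max_right _ _).trans this⟩
    exact (h1.trans ((hC φ hφ).trans (le_max_left C 0))).trans_lt (lt_add_one _)

/-! ### Series in the Schwartz space -/

/-- A series of Schwartz functions all of whose seminorms are summable converges: its sum is smooth
by termwise differentiation, and the tails of the seminorms bound the remainders. -/
theorem summable_schwartz {ι : Type*} {w : ι → 𝓢(Rn n, ℂ)}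
    (h : ∀ m, Summable fun i => schwartzNorm m (w i)) : Summable w := by
  have hv : ∀ k : ℕ, (k : ℕ∞) ≤ ⊤ → Summable fun i => schwartzNorm k (w i) := fun k _ => h k
  have hb : ∀ (k : ℕ) (i : ι) (x : Rn n), (k : ℕ∞) ≤ ⊤ →
      ‖iteratedFDeriv ℝ k (w i) x‖ ≤ schwartzNorm k (w i) := fun k i x _ =>
    (SchwartzMap.norm_iteratedFDeriv_le_seminorm ℂ (w i) k x).trans
      (seminorm_le_schwartzNorm (Nat.zero_le k) le_rfl _)
  have hd : ∀ (k i : ℕ) (s : Finset ι) (x : Rn n),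
      ‖x‖ ^ k * ‖∑' j : {j // j ∉ s}, iteratedFDeriv ℝ i (w j) x‖
        ≤ ∑' j : {j // j ∉ s}, schwartzNorm (max k i) (w j) := by
    intro k i s x
    have hs : Summable fun j : {j // j ∉ s} => schwartzNorm (max k i) (w j) :=
      (h _).subtype _
    have hle : ∀ j : {j // j ∉ s}, ‖x‖ ^ k * ‖iteratedFDeriv ℝ i (w j) x‖
        ≤ schwartzNorm (max k i) (w j) := fun j =>
      (SchwartzMap.le_seminorm ℂ k i (w j) x).trans
        (seminorm_le_schwartzNorm (le_max_left _ _) (le_max_right _ _) _)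
    have hn : Summable fun j : {j // j ∉ s} => ‖iteratedFDeriv ℝ i (w j) x‖ :=
      Summable.of_nonneg_of_le (fun _ => norm_nonneg _) (fun j => hb i j x le_top)
        ((h i).subtype _)
    calc _ ≤ ‖x‖ ^ k * ∑' j : {j // j ∉ s}, ‖iteratedFDeriv ℝ i (w j) x‖ := by
          gcongr
          exact norm_tsum_le_tsum_norm hn
      _ = ∑' j : {j // j ∉ s}, ‖x‖ ^ k * ‖iteratedFDeriv ℝ i (w j) x‖ := tsum_mul_left.symm
      _ ≤ _ := (hn.mul_left _).tsum_le_tsum hle hs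
  have hsm : ContDiff ℝ ∞ fun x => ∑' i, w i x :=
    contDiff_tsum (N := ⊤) (fun i => (w i).smooth ⊤) hv hb
  have hit : ∀ (k : ℕ) (x : Rn n), iteratedFDeriv ℝ k (fun y => ∑' i, w i y) x
      = ∑' i, iteratedFDeriv ℝ k (w i) x := fun k x =>
    iteratedFDeriv_tsum_apply (N := ⊤) (fun i => (w i).smooth ⊤) hv hb le_top x
  let S : 𝓢(Rn n, ℂ) := ⟨fun x => ∑' i, w i x, hsm, fun k i => by
    refine ⟨∑' j : {j // j ∉ (∅ : Finset ι)}, schwartzNorm (max k i) (w j), fun x => ?_⟩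
    rw [hit]
    convert! hd k i ∅ x using 3
    exact ((Equiv.subtypeUnivEquiv (p := fun j => j ∉ (∅ : Finset ι)) (by simp)).tsum_eq
      fun j => iteratedFDeriv ℝ i (w j) x).symm⟩
  refine ⟨S, tendsto_of_schwartzNorm fun m => ?_⟩
  have htail : ∀ s : Finset ι, schwartzNorm m (∑ i ∈ s, w i - S)
      ≤ ∑' j : {j // j ∉ s}, schwartzNorm m (w j) := by
    intro s
    rw [map_sub_rev]
    refine schwartzNorm_le (tsum_nonneg fun _ => apply_nonneg _ _) fun k hk i hi x => ?_
    have hsum : Summable fun j => iteratedFDeriv ℝ i (w j) x :=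
      Summable.of_norm_bounded (h i) fun j => hb i j x le_top
    have h1 : iteratedFDeriv ℝ i (S - ∑ j ∈ s, w j : 𝓢(Rn n, ℂ)) x
        = ∑' j : {j // j ∉ s}, iteratedFDeriv ℝ i (w j) x := by
      have e : ((S - ∑ j ∈ s, w j : 𝓢(Rn n, ℂ)) : Rn n → ℂ)
          = (fun y => ∑' j, w j y) - fun y => ∑ j ∈ s, w j y := by
        funext y
        simp [S]
        rfl
      rw [e, iteratedFDeriv_sub_apply (hsm.contDiffAt.of_le (mod_cast le_top))
        (ContDiff.contDiffAt (ContDiff.sum fun j _ => (w j).smooth i)), hit]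
      have e2 : (iteratedFDeriv ℝ i (fun y => ∑ j ∈ s, w j y) x)
          = ∑ j ∈ s, iteratedFDeriv ℝ i (w j) x := by
        have := iteratedFDeriv_sum (𝕜 := ℝ) (i := i) (u := s) (f := fun j => (w j : Rn n → ℂ))
          fun j _ => (w j).smooth i
        rw [this, Finset.sum_apply]
      rw [e2, ← hsum.sum_add_tsum_subtype_compl s]
      simp
    rw [h1]
    refine (hd k i s x).trans ?_
    exact ((h _).subtype _).tsum_le_tsum (fun j => schwartzNorm_mono (max_le hk hi) _)
      ((h m).subtype _)
  refine squeeze_zero (fun _ => apply_nonneg _ _) htail ?_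
  exact tendsto_tsum_compl_atTop_zero fun j => schwartzNorm m (w j)

theorem schwartzNorm_tsum_le {ι : Type*} {w : ι → 𝓢(Rn n, ℂ)}
    (h : ∀ m, Summable fun i => schwartzNorm m (w i)) (m : ℕ) :
    schwartzNorm m (∑' i, w i) ≤ ∑' i, schwartzNorm m (w i) := by
  have h1 : Tendsto (fun s : Finset ι => schwartzNorm m (∑ i ∈ s, w i)) atTop
      (𝓝 (schwartzNorm m (∑' i, w i))) :=
    ((continuous_schwartzNorm m).tendsto _).comp (summable_schwartz h).hasSum
  refine le_of_tendsto h1 (Eventually.of_forall fun s => ?_)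
  refine (Finset.le_sum_of_subadditive _ (map_zero _).le (map_add_le_add _) _ _).trans ?_
  exact (h m).sum_le_tsum s fun i _ => apply_nonneg _ _

/-! ### Products, convolutions and time-frequency shifts of Schwartz functions -/

/-- The pointwise product of Schwartz functions. -/
def mulS (a b : 𝓢(Rn n, ℂ)) : 𝓢(Rn n, ℂ) :=
  SchwartzMap.pairing (ContinuousLinearMap.mul ℂ ℂ) a b

/-- The convolution of Schwartz functions. -/
def convS (a b : 𝓢(Rn n, ℂ)) : 𝓢(Rn n, ℂ) :=
  SchwartzMap.convolution (ContinuousLinearMap.mul ℂ ℂ) a b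

theorem mulS_apply (a b : 𝓢(Rn n, ℂ)) (t : Rn n) : mulS a b t = a t * b t := rfl

theorem convS_apply (a b : 𝓢(Rn n, ℂ)) (t : Rn n) : convS a b t = ∫ s, a s * b (t - s) := by
  rw [convS, SchwartzMap.convolution_apply]
  rfl

theorem fourier_convS (a b : 𝓢(Rn n, ℂ)) : 𝓕 (convS a b) = mulS (𝓕 a) (𝓕 b) :=
  SchwartzMap.fourier_convolution _ _ _

theorem fourier_injective {a b : 𝓢(Rn n, ℂ)} (h : 𝓕 a = 𝓕 b) : a = b := by
  have := congrArg (fun c : 𝓢(Rn n, ℂ) => (𝓕⁻ c : 𝓢(Rn n, ℂ))) h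
  simpa using this

theorem convS_comm (a b : 𝓢(Rn n, ℂ)) : convS a b = convS b a := by
  apply fourier_injective
  rw [fourier_convS, fourier_convS]
  ext t
  simp only [mulS_apply, mul_comm]

theorem convS_assoc (a b c : 𝓢(Rn n, ℂ)) : convS (convS a b) c = convS a (convS b c) := by
  apply fourier_injective
  simp only [fourier_convS]
  ext t
  simp only [mulS_apply, mul_assoc]

/-- Convolution with a fixed Schwartz function as a continuous operator on `𝓢(ℝⁿ)`. -/
def convCLM (a : 𝓢(Rn n, ℂ)) : 𝓢(Rn n, ℂ) →L[ℂ] 𝓢(Rn n, ℂ) :=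
  SchwartzMap.convolution (ContinuousLinearMap.mul ℂ ℂ) a

theorem convCLM_apply (a b : 𝓢(Rn n, ℂ)) : convCLM a b = convS a b := rfl

theorem fourier_schwartz_apply (a : 𝓢(Rn n, ℂ)) (w : Rn n) :
    𝓕 a w = ∫ t, Complex.exp (2 * Real.pi * Complex.I * (inner ℝ (-w) t : ℝ)) * a t := by
  rw [SchwartzMap.fourier_coe, Real.fourier_eq']
  congr with t
  rw [smul_eq_mul, inner_neg_left, real_inner_comm]
  congr 2
  push_cast
  ring

theorem fourier_modulate (ξ : Rn n) (a : 𝓢(Rn n, ℂ)) :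
    𝓕 (modulate ξ a) = translate ξ (𝓕 a) := by
  ext w
  rw [translate_apply, fourier_schwartz_apply, fourier_schwartz_apply]
  congr with t
  rw [modulate_apply, ← mul_assoc, ← Complex.exp_add]
  congr 2
  rw [neg_sub, inner_sub_left, inner_neg_left]
  push_cast
  ring

theorem modulate_convS (ξ : Rn n) (a b : 𝓢(Rn n, ℂ)) :
    modulate ξ (convS a b) = convS (modulate ξ a) (modulate ξ b) := by
  apply fourier_injective
  simp only [fourier_convS, fourier_modulate]
  rfl

theorem modulate_neg_modulate (ξ : Rn n) (a : 𝓢(Rn n, ℂ)) : modulate (-ξ) (modulate ξ a) = a := by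
  ext t
  rw [modulate_apply, modulate_apply, ← mul_assoc, ← Complex.exp_add, inner_neg_left]
  simp

theorem modulate_modulate_neg (ξ : Rn n) (a : 𝓢(Rn n, ℂ)) : modulate ξ (modulate (-ξ) a) = a := by
  simpa using modulate_neg_modulate (-ξ) a

theorem translate_convS (x : Rn n) (a b : 𝓢(Rn n, ℂ)) :
    translate x (convS a b) = convS a (translate x b) := by
  ext t
  rw [translate_apply, convS_apply, convS_apply]
  congr with s
  rw [translate_apply, sub_right_comm]

theorem translate_translate (x y : Rn n) (a : 𝓢(Rn n, ℂ)) :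
    translate x (translate y a) = translate (x + y) a := by
  ext t
  simp only [translate_apply, sub_sub]

theorem reflect_reflect (a : 𝓢(Rn n, ℂ)) : reflect (reflect a) = a := by
  ext t
  simp [reflect_apply]

theorem reflect_convS (a b : 𝓢(Rn n, ℂ)) :
    reflect (convS a b) = convS (reflect a) (reflect b) := by
  ext t
  rw [reflect_apply, convS_apply, convS_apply,
    ← integral_neg_eq_self fun s => reflect a s * reflect b (t - s)]
  congr with s
  simp only [reflect_apply, neg_neg]
  congr 2
  abel

theorem reflect_modulate (ξ : Rn n) (a : 𝓢(Rn n, ℂ)) :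
    reflect (modulate ξ a) = modulate (-ξ) (reflect a) := by
  ext t
  simp only [reflect_apply, modulate_apply, inner_neg_left, inner_neg_right]

theorem modulate_translate (x ξ : Rn n) (a : 𝓢(Rn n, ℂ)) :
    modulate ξ (translate x a) = Complex.exp (2 * Real.pi * Complex.I * (inner ℝ ξ x : ℝ)) •
      translate x (modulate ξ a) := by
  ext t
  rw [_root_.smul_apply, smul_eq_mul, modulate_apply, translate_apply, translate_apply,
    modulate_apply, ← mul_assoc, ← Complex.exp_add, inner_sub_right]
  congr 2
  push_cast
  ring

theorem schwartzToDist_eq_convS (a h : 𝓢(Rn n, ℂ)) :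
    schwartzToDist a h = convS a (reflect h) 0 := by
  rw [schwartzToDist_apply, convS_apply]
  simp [reflect_apply]

/-- The transpose of convolution with `b` is convolution with the reflection of `b`. -/
theorem schwartzToDist_convS (a b h : 𝓢(Rn n, ℂ)) :
    schwartzToDist a (convS (reflect b) h) = schwartzToDist (convS a b) h := by
  rw [schwartzToDist_eq_convS, schwartzToDist_eq_convS, reflect_convS, reflect_reflect,
    ← convS_assoc]

theorem schwartzToDist_modulate (ξ : Rn n) (a h : 𝓢(Rn n, ℂ)) :
    schwartzToDist (modulate ξ a) h = schwartzToDist a (modulate ξ h) := by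
  simp only [schwartzToDist_apply, modulate_apply]
  congr with t
  ring

theorem modulateDist_schwartzToDist (ξ : Rn n) (a : 𝓢(Rn n, ℂ)) :
    modulateDist ξ (schwartzToDist a) = schwartzToDist (modulate ξ a) := by
  ext h
  exact (schwartzToDist_modulate ξ a h).symm

theorem translateDist_schwartzToDist (x : Rn n) (a : 𝓢(Rn n, ℂ)) :
    translateDist x (schwartzToDist a) = schwartzToDist (translate x a) := by
  ext h
  change schwartzToDist a (translate (-x) h) = _
  rw [schwartzToDist_apply, schwartzToDist_apply,
    ← integral_sub_right_eq_self (fun t => a t * translate (-x) h t) x]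
  congr with t
  simp [translate_apply]

/-! ### Estimates for products, convolutions and time-frequency shifts -/

theorem one_add_norm_le_mul (x y : Rn n) : 1 + ‖x‖ ≤ (1 + ‖x - y‖) * (1 + ‖y‖) := by
  have h := norm_add_le (x - y) y
  rw [sub_add_cancel] at h
  nlinarith [norm_nonneg (x - y), norm_nonneg y]

theorem iteratedFDeriv_translate (x : Rn n) (φ : 𝓢(Rn n, ℂ)) (i : ℕ) (t : Rn n) :
    iteratedFDeriv ℝ i (translate x φ) t = iteratedFDeriv ℝ i φ (t - x) := by
  have : (translate x φ : Rn n → ℂ) = fun t => φ (t - x) := rfl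
  rw [this, iteratedFDeriv_comp_sub]

theorem schwartzNorm_translate_le (m : ℕ) (x : Rn n) (φ : 𝓢(Rn n, ℂ)) :
    schwartzNorm m (translate x φ) ≤ 2 ^ m * (1 + ‖x‖) ^ m * schwartzNorm m φ := by
  refine schwartzNorm_le (by positivity) fun k hk i hi t => ?_
  rw [iteratedFDeriv_translate]
  have h1 : ‖t‖ ^ k ≤ (1 + ‖t - x‖) ^ k * (1 + ‖x‖) ^ m := by
    calc ‖t‖ ^ k ≤ (1 + ‖t‖) ^ k := by gcongr; simp
      _ ≤ ((1 + ‖t - x‖) * (1 + ‖x‖)) ^ k := by gcongr; exact one_add_norm_le_mul t x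
      _ = (1 + ‖t - x‖) ^ k * (1 + ‖x‖) ^ k := mul_pow _ _ _
      _ ≤ _ := by gcongr; simp
  calc _ ≤ (1 + ‖t - x‖) ^ k * (1 + ‖x‖) ^ m * ‖iteratedFDeriv ℝ i φ (t - x)‖ := by gcongr
    _ = (1 + ‖x‖) ^ m * ((1 + ‖t - x‖) ^ k * ‖iteratedFDeriv ℝ i φ (t - x)‖) := by ring
    _ ≤ (1 + ‖x‖) ^ m * (2 ^ m * schwartzNorm m φ) := by
        exact mul_le_mul_of_nonneg_left (one_add_pow_mul_le_schwartzNorm hk hi φ _) (by positivity)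
    _ = _ := by ring

theorem exists_schwartzNorm_fourier_le (m : ℕ) : ∃ (m' : ℕ) (C : ℝ), 0 ≤ C ∧
    ∀ φ : 𝓢(Rn n, ℂ), schwartzNorm m (𝓕 φ) ≤ C * schwartzNorm m' φ :=
  exists_schwartzNorm_clm_le (fourierCLM ℂ 𝓢(Rn n, ℂ)) m

theorem exists_schwartzNorm_le_fourier (m : ℕ) : ∃ (m' : ℕ) (C : ℝ), 0 ≤ C ∧
    ∀ φ : 𝓢(Rn n, ℂ), schwartzNorm m φ ≤ C * schwartzNorm m' (𝓕 φ) := by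
  obtain ⟨m', C, hC, h⟩ := exists_schwartzNorm_clm_le (fourierInvCLM ℂ 𝓢(Rn n, ℂ)) m
  refine ⟨m', C, hC, fun φ => ?_⟩
  have := h (𝓕 φ)
  rwa [fourierInvCLM_apply, fourierInv_fourier_eq] at this

/-- Modulations have polynomially bounded norms, since the Fourier transform turns them into
translations. -/
theorem exists_schwartzNorm_modulate_le (m : ℕ) : ∃ (m' K : ℕ) (C : ℝ), 0 ≤ C ∧
    ∀ (ξ : Rn n) (φ : 𝓢(Rn n, ℂ)),
      schwartzNorm m (modulate ξ φ) ≤ C * (1 + ‖ξ‖) ^ K * schwartzNorm m' φ := by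
  obtain ⟨m₁, C₁, hC₁, h₁⟩ := exists_schwartzNorm_le_fourier (n := n) m
  obtain ⟨m₂, C₂, hC₂, h₂⟩ := exists_schwartzNorm_fourier_le (n := n) m₁
  refine ⟨m₂, m₁, C₁ * (2 ^ m₁ * C₂), by positivity, fun ξ φ => (h₁ _).trans ?_⟩
  rw [fourier_modulate]
  calc _ ≤ C₁ * (2 ^ m₁ * (1 + ‖ξ‖) ^ m₁ * schwartzNorm m₁ (𝓕 φ)) := by
        gcongr
        exact schwartzNorm_translate_le _ _ _
    _ ≤ C₁ * (2 ^ m₁ * (1 + ‖ξ‖) ^ m₁ * (C₂ * schwartzNorm m₂ φ)) := by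
        gcongr
        exact h₂ φ
    _ = _ := by ring

/-- The product of a Schwartz function with a translate of another one decays rapidly in the
translation parameter, since `1 + |x| ≤ (1 + |t|) (1 + |t - x|)`. -/
theorem exists_schwartzNorm_mulS_translate_le (m N : ℕ) : ∃ (m' : ℕ) (C : ℝ), 0 ≤ C ∧
    ∀ (x : Rn n) (a b : 𝓢(Rn n, ℂ)), (1 + ‖x‖) ^ N * schwartzNorm m (mulS (translate x a) b)
      ≤ C * schwartzNorm m' a * schwartzNorm m' b := by
  let C₀ : ℝ := 2 ^ (m + N) * 2 ^ (m + N)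
  let C : ℝ := ∑ i ∈ Finset.range (m + 1), ∑ j ∈ Finset.range (i + 1), (i.choose j : ℝ) * C₀
  refine ⟨m + N, C, Finset.sum_nonneg fun i _ => Finset.sum_nonneg fun j _ => by positivity,
    fun x a b => ?_⟩
  have hx : (0 : ℝ) < (1 + ‖x‖) ^ N := by positivity
  have hC : 0 ≤ C := Finset.sum_nonneg fun i _ => Finset.sum_nonneg fun j _ => by positivity
  rw [mul_comm, ← le_div_iff₀ hx]
  refine schwartzNorm_le (by positivity) fun k hk i hi t => ?_
  rw [le_div_iff₀ hx]
  have hL := norm_iteratedFDeriv_mul_le (𝕜 := ℝ) (n := i) (translate x a).smooth'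
    b.smooth' t (mod_cast le_top)
  have hterm : ∀ j ∈ Finset.range (i + 1), ‖t‖ ^ k * ((i.choose j : ℝ) *
      ‖iteratedFDeriv ℝ j (translate x a) t‖ * ‖iteratedFDeriv ℝ (i - j) b t‖) * (1 + ‖x‖) ^ N
      ≤ (i.choose j : ℝ) * C₀ * (schwartzNorm (m + N) a * schwartzNorm (m + N) b) := by
    intro j hj
    have hji : j ≤ i := Nat.lt_succ_iff.1 (Finset.mem_range.1 hj)
    rw [iteratedFDeriv_translate]
    have h1 : (1 + ‖x‖) ^ N ≤ (1 + ‖t - x‖) ^ N * (1 + ‖t‖) ^ N := by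
      rw [← mul_pow]
      gcongr
      have := one_add_norm_le_mul x t
      rwa [norm_sub_rev] at this
    have h2 : ‖t‖ ^ k ≤ (1 + ‖t‖) ^ k := by gcongr; simp
    have h3 := one_add_pow_mul_le_schwartzNorm (m := m + N) (k := N) (i := j) (by lia) (by lia) a
      (t - x)
    have h4 := one_add_pow_mul_le_schwartzNorm (m := m + N) (k := k + N) (i := i - j) (by lia)
      (by lia) b t
    calc _ ≤ (1 + ‖t‖) ^ k * ((i.choose j : ℝ) * ‖iteratedFDeriv ℝ j a (t - x)‖ *
          ‖iteratedFDeriv ℝ (i - j) b t‖) * ((1 + ‖t - x‖) ^ N * (1 + ‖t‖) ^ N) := by gcongr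
      _ = (i.choose j : ℝ) * (((1 + ‖t - x‖) ^ N * ‖iteratedFDeriv ℝ j a (t - x)‖) *
          ((1 + ‖t‖) ^ (k + N) * ‖iteratedFDeriv ℝ (i - j) b t‖)) := by ring
      _ ≤ (i.choose j : ℝ) * ((2 ^ (m + N) * schwartzNorm (m + N) a) *
          (2 ^ (m + N) * schwartzNorm (m + N) b)) := by gcongr
      _ = _ := by simp only [C₀]; ring
  calc ‖t‖ ^ k * ‖iteratedFDeriv ℝ i (mulS (translate x a) b) t‖ * (1 + ‖x‖) ^ N
      ≤ ‖t‖ ^ k * (∑ j ∈ Finset.range (i + 1), (i.choose j : ℝ) *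
        ‖iteratedFDeriv ℝ j (translate x a) t‖ * ‖iteratedFDeriv ℝ (i - j) b t‖) *
          (1 + ‖x‖) ^ N := by
        gcongr
        exact hL
    _ ≤ ∑ j ∈ Finset.range (i + 1), (i.choose j : ℝ) * C₀ *
          (schwartzNorm (m + N) a * schwartzNorm (m + N) b) := by
        rw [Finset.mul_sum, Finset.sum_mul]
        exact Finset.sum_le_sum hterm
    _ = (∑ j ∈ Finset.range (i + 1), (i.choose j : ℝ) * C₀) *
          (schwartzNorm (m + N) a * schwartzNorm (m + N) b) := (Finset.sum_mul _ _ _).symm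
    _ ≤ C * (schwartzNorm (m + N) a * schwartzNorm (m + N) b) := by
        refine mul_le_mul_of_nonneg_right ?_ (by positivity)
        exact Finset.single_le_sum (f := fun i => ∑ j ∈ Finset.range (i + 1),
          (i.choose j : ℝ) * C₀) (fun i _ => Finset.sum_nonneg fun j _ => by positivity)
          (Finset.mem_range.2 (by lia))
    _ = _ := by ring

/-- The convolution of a modulated Schwartz function with another one decays rapidly in the
frequency parameter: on the Fourier side it is the product with a translate. -/
theorem exists_schwartzNorm_convS_modulate_le (m N : ℕ) : ∃ (m' : ℕ) (C : ℝ), 0 ≤ C ∧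
    ∀ (ξ : Rn n) (a b : 𝓢(Rn n, ℂ)), (1 + ‖ξ‖) ^ N * schwartzNorm m (convS (modulate ξ a) b)
      ≤ C * schwartzNorm m' a * schwartzNorm m' b := by
  obtain ⟨m₁, C₁, hC₁, h₁⟩ := exists_schwartzNorm_le_fourier (n := n) m
  obtain ⟨m₂, C₂, hC₂, h₂⟩ := exists_schwartzNorm_mulS_translate_le (n := n) m₁ N
  obtain ⟨m₃, C₃, hC₃, h₃⟩ := exists_schwartzNorm_fourier_le (n := n) m₂
  refine ⟨m₃, C₁ * (C₂ * C₃ * C₃), by positivity, fun ξ a b => ?_⟩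
  calc _ ≤ (1 + ‖ξ‖) ^ N * (C₁ * schwartzNorm m₁ (𝓕 (convS (modulate ξ a) b))) := by
        gcongr
        exact h₁ _
    _ = C₁ * ((1 + ‖ξ‖) ^ N * schwartzNorm m₁ (mulS (translate ξ (𝓕 a)) (𝓕 b))) := by
        rw [fourier_convS, fourier_modulate]
        ring
    _ ≤ C₁ * (C₂ * schwartzNorm m₂ (𝓕 a) * schwartzNorm m₂ (𝓕 b)) := by
        exact mul_le_mul_of_nonneg_left (h₂ _ _ _) hC₁
    _ ≤ C₁ * (C₂ * (C₃ * schwartzNorm m₃ a) * (C₃ * schwartzNorm m₃ b)) := by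
        gcongr
        exacts [h₃ a, h₃ b]
    _ = _ := by ring

/-- The pairing of a time-frequency shift of a Schwartz function with another one decays rapidly
in both parameters. -/
theorem exists_pairing_timeFreqShift_le (N : ℕ) : ∃ (m : ℕ) (C : ℝ), 0 ≤ C ∧
    ∀ (x ξ : Rn n) (a h : 𝓢(Rn n, ℂ)),
      (1 + ‖x‖) ^ N * (1 + ‖ξ‖) ^ N * ‖schwartzToDist (timeFreqShift x ξ a) h‖
        ≤ C * schwartzNorm m a * schwartzNorm m h := by
  obtain ⟨m₁, C₁, hC₁, h₁⟩ := exists_schwartzNorm_fourier_le (n := n) N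
  obtain ⟨m₂, C₂, hC₂, h₂⟩ := exists_schwartzNorm_mulS_translate_le (n := n) m₁ N
  refine ⟨m₂, 2 ^ N * (C₁ * C₂), by positivity, fun x ξ a h => ?_⟩
  have e : schwartzToDist (timeFreqShift x ξ a) h = 𝓕 (mulS (translate x a) h) (-ξ) := by
    rw [schwartzToDist_apply, fourier_schwartz_apply]
    congr with t
    rw [neg_neg, mulS_apply, timeFreqShift, modulate_apply, mul_assoc]
  rw [e]
  calc _ = (1 + ‖x‖) ^ N * ((1 + ‖-ξ‖) ^ N * ‖𝓕 (mulS (translate x a) h) (-ξ)‖) := by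
        rw [norm_neg]
        ring
    _ ≤ (1 + ‖x‖) ^ N * (2 ^ N * (C₁ * schwartzNorm m₁ (mulS (translate x a) h))) := by
        refine mul_le_mul_of_nonneg_left ((one_add_pow_mul_norm_le N _ _).trans ?_) (by positivity)
        exact mul_le_mul_of_nonneg_left (h₁ _) (by positivity)
    _ = 2 ^ N * (C₁ * ((1 + ‖x‖) ^ N * schwartzNorm m₁ (mulS (translate x a) h))) := by ring
    _ ≤ 2 ^ N * (C₁ * (C₂ * schwartzNorm m₂ a * schwartzNorm m₂ h)) := by
        exact mul_le_mul_of_nonneg_left (mul_le_mul_of_nonneg_left (h₂ _ _ _) hC₁) (by positivity)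
    _ = _ := by ring

/-! ### Summation over lattices and periodization -/

theorem summable_lattice_inv_pow {V : Type*} [NormedAddCommGroup V] [NormedSpace ℝ V]
    [FiniteDimensional ℝ V] (Λ : Submodule ℤ V) [DiscreteTopology Λ] {N : ℕ}
    (hN : Module.finrank ℤ Λ < N) : Summable fun l : Λ => ((1 + ‖(l : V)‖) ^ N)⁻¹ := by
  refine Summable.of_norm_bounded_eventually (ZLattice.summable_norm_pow_inv Λ N hN) ?_
  refine (Set.finite_singleton (0 : Λ)).subset fun l hl => ?_
  by_contra hl0
  have hpos : 0 < ‖l‖ := norm_pos_iff.2 hl0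
  refine hl ?_
  change ‖((1 + ‖(l : V)‖) ^ N)⁻¹‖ ≤ ‖l‖⁻¹ ^ N
  rw [Real.norm_of_nonneg (by positivity), inv_pow]
  have : ‖(l : V)‖ = ‖l‖ := rfl
  rw [this]
  gcongr
  simp

theorem summable_zlattice_inv_pow (Λ : Submodule ℤ (Rn n)) [DiscreteTopology Λ] [IsZLattice ℝ Λ]
    {N : ℕ} (hN : n < N) : Summable fun l : Λ => ((1 + ‖(l : Rn n)‖) ^ N)⁻¹ :=
  summable_lattice_inv_pow Λ (by rwa [ZLattice.rank ℝ Λ, finrank_euclideanSpace_fin])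

/-- The integer vector `k` as a point of `ℝⁿ`. -/
def intVec (k : Fin n → ℤ) : Fin n → ℝ := fun i => k i

theorem summable_intVec_inv_pow {N : ℕ} (hN : n < N) :
    Summable fun k : Fin n → ℤ => ((1 + ‖intVec k‖) ^ N)⁻¹ := by
  let b := Pi.basisFun ℝ (Fin n)
  let b' := b.restrictScalars ℤ
  have h := summable_lattice_inv_pow (Submodule.span ℤ (Set.range b)) (N := N)
    (by rwa [Module.finrank_eq_card_basis b', Fintype.card_fin])
  refine (h.comp_injective b'.equivFun.symm.injective).congr fun k => ?_
  have : ((b'.equivFun.symm k : Submodule.span ℤ (Set.range b)) : Fin n → ℝ) = intVec k := by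
    rw [Module.Basis.equivFun_symm_apply]
    funext i
    simp [b', b, intVec, Pi.single_apply]
  simp only [Function.comp, this]

theorem one_add_norm_le_mul' {V : Type*} [SeminormedAddCommGroup V] (x y : V) :
    1 + ‖y‖ ≤ (1 + ‖x‖) * (1 + ‖x + y‖) := by
  have h := norm_sub_le (x + y) x
  rw [add_sub_cancel_left] at h
  nlinarith [norm_nonneg (x + y), norm_nonneg x]

/-- The canonical projection `ℝⁿ → ℝⁿ/ℤⁿ`. -/
def torusMk (x : Fin n → ℝ) : UnitAddTorus (Fin n) := fun i => (x i : UnitAddCircle)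

theorem isQuotientMap_torusMk : IsQuotientMap (torusMk (n := n)) := by
  have : IsOpenQuotientMap fun x : ℝ => (x : UnitAddCircle) :=
    QuotientAddGroup.isOpenQuotientMap_mk
  exact (IsOpenQuotientMap.piMap fun _ : Fin n => this).isQuotientMap

theorem torusMk_eq_iff {x y : Fin n → ℝ} : torusMk x = torusMk y ↔ ∃ k, y = x + intVec k := by
  constructor
  · intro h
    have h' : ∀ i, ∃ m : ℤ, y i = x i + m := fun i => by
      have := congrFun h i
      simp only [torusMk] at this
      rw [eq_comm, ← sub_eq_zero, ← AddCircle.coe_sub, AddCircle.coe_eq_zero_iff] at this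
      obtain ⟨m, hm⟩ := this
      refine ⟨m, ?_⟩
      rw [zsmul_one] at hm
      linarith
    choose k hk using h'
    exact ⟨k, funext hk⟩
  · rintro ⟨k, rfl⟩
    funext i
    simp [torusMk, intVec]

theorem mFourier_torusMk (m : Fin n → ℤ) (x : Fin n → ℝ) :
    UnitAddTorus.mFourier m (torusMk x) = Complex.exp (2 * Real.pi * Complex.I *
      (∑ i, (m i : ℝ) * x i : ℝ)) := by
  simp only [UnitAddTorus.mFourier, ContinuousMap.coe_mk, torusMk, fourier_coe_apply]
  rw [← Complex.exp_sum]
  congr 1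
  push_cast
  rw [Finset.mul_sum]
  refine Finset.sum_congr rfl fun i _ => ?_
  simp
  ring

/-- The set of representatives of `ℝⁿ/ℤⁿ` used by `UnitAddTorus` is, up to a null set, the
fundamental domain of the lattice spanned by the standard basis. -/
theorem restrict_torusCube : (volume : Measure (Fin n → ℝ)).restrict
    {x : Fin n → ℝ | ∀ i, x i ∈ Ioc ((0 : Fin n → ℝ) i) ((0 : Fin n → ℝ) i + 1)} =
    volume.restrict (ZSpan.fundamentalDomain (Pi.basisFun ℝ (Fin n))) := by
  refine Measure.restrict_congr_set ?_
  rw [ZSpan.fundamentalDomain_pi_basisFun]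
  have h1 := Measure.univ_pi_Ioc_ae_eq_Icc (μ := fun _ : Fin n => (volume : Measure ℝ))
    (f := 0) (g := 1)
  have h2 := Measure.univ_pi_Ico_ae_eq_Icc (μ := fun _ : Fin n => (volume : Measure ℝ))
    (f := 0) (g := 1)
  have h3 := h1.trans h2.symm
  have h4 : {x : Fin n → ℝ | ∀ i, x i ∈ Ioc ((0 : Fin n → ℝ) i) ((0 : Fin n → ℝ) i + 1)} =
      univ.pi fun i => Ioc ((0 : Fin n → ℝ) i) ((1 : Fin n → ℝ) i) := by
    ext x
    simp [Set.mem_pi]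
  rw [h4]
  exact h3

/-- Periodization of a rapidly decreasing function: it is a continuous function on the torus, and
its Fourier coefficients are the values at the integer vectors of the Fourier transform. -/
theorem exists_periodization {G : (Fin n → ℝ) → ℂ} (hG : Continuous G) {N : ℕ} (hN : n < N) {C : ℝ}
    (hC : ∀ x, ‖G x‖ ≤ C * ((1 + ‖x‖) ^ N)⁻¹) :
    ∃ g : C(UnitAddTorus (Fin n), ℂ),
      (∀ x, HasSum (fun k => G (x + intVec k)) (g (torusMk x))) ∧
      ∀ m, UnitAddTorus.mFourierCoeff g m =
        ∫ x, Complex.exp (-(2 * Real.pi * Complex.I * (∑ i, (m i : ℝ) * x i : ℝ))) * G x := by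
  have hC0 : 0 ≤ C := by simpa using (norm_nonneg _).trans (hC 0)
  have hS := summable_intVec_inv_pow hN
  have hb : ∀ (R : ℝ) (x : Fin n → ℝ) (k : Fin n → ℤ), ‖x‖ ≤ R →
      ‖G (x + intVec k)‖ ≤ C * (1 + R) ^ N * ((1 + ‖intVec k‖) ^ N)⁻¹ := by
    intro R x k hx
    refine (hC _).trans ?_
    rw [mul_assoc]
    refine mul_le_mul_of_nonneg_left ?_ hC0
    rw [← div_eq_mul_inv, inv_eq_one_div, div_le_div_iff₀ (by positivity) (by positivity), one_mul,
      ← mul_pow]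
    gcongr
    refine (one_add_norm_le_mul' x (intVec k)).trans ?_
    gcongr
  have hsum : ∀ x, Summable fun k => G (x + intVec k) := fun x =>
    Summable.of_norm_bounded (hS.mul_left _) fun k => hb _ x k le_rfl
  let g₀ : C(Fin n → ℝ, ℂ) := ⟨fun x => ∑' k, G (x + intVec k), by
    refine continuous_iff_continuousAt.2 fun x => ?_
    have : ContinuousOn (fun x => ∑' k, G (x + intVec k)) (Metric.ball 0 (‖x‖ + 1)) :=
      continuousOn_tsum (fun k => by fun_prop) (hS.mul_left _)
        fun k y hy => hb (‖x‖ + 1) y k (by simpa using (Metric.mem_ball.1 hy).le)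
    exact this.continuousAt (Metric.isOpen_ball.mem_nhds (by simp))⟩
  have hper : ∀ x k, g₀ (x + intVec k) = g₀ x := fun x k => by
    simp only [g₀, ContinuousMap.coe_mk]
    rw [← (Equiv.addLeft k).tsum_eq fun j => G (x + intVec j)]
    refine tsum_congr fun j => ?_
    congr 1
    funext i
    simp [intVec, add_assoc]
  have hfac : Function.FactorsThrough g₀ (torusMk (n := n)) := fun x y h => by
    obtain ⟨k, rfl⟩ := torusMk_eq_iff.1 h
    exact (hper x k).symm
  let T : C(Fin n → ℝ, UnitAddTorus (Fin n)) := ⟨torusMk, isQuotientMap_torusMk.continuous⟩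
  have hT : IsQuotientMap T := isQuotientMap_torusMk
  let g := hT.lift g₀ hfac
  have hg : ∀ x, g (torusMk x) = g₀ x := fun x =>
    DFunLike.congr_fun (hT.lift_comp g₀ hfac) x
  refine ⟨g, fun x => ?_, fun m => ?_⟩
  · rw [hg]
    exact (hsum x).hasSum
  let e : (Fin n → ℝ) → ℂ := fun x =>
    Complex.exp (-(2 * Real.pi * Complex.I * (∑ i, (m i : ℝ) * x i : ℝ)))
  have he : Continuous e := by fun_prop
  have hen : ∀ x, ‖e x‖ = 1 := fun x => by
    simp only [e]
    rw [Complex.norm_exp]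
    simp
  have hep : ∀ x k, e (x + intVec k) = e x := fun x k => by
    have h1 : ∀ x, e x = UnitAddTorus.mFourier (-m) (torusMk x) := fun x => by
      rw [mFourier_torusMk]
      simp [e]
    rw [h1, h1, (torusMk_eq_iff.2 ⟨k, rfl⟩ : torusMk x = torusMk (x + intVec k))]
  let H : (Fin n → ℝ) → ℂ := fun x => e x * G x
  have hHc : Continuous H := he.mul hG
  have hHn : ∀ x, ‖H x‖ = ‖G x‖ := fun x => by simp [H, hen]
  have hHi : Integrable H := by
    have hdim : (Module.finrank ℝ (Fin n → ℝ) : ℝ) < N := by simpa using hN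
    refine Integrable.mono' ((integrable_one_add_norm (μ := volume) hdim).const_mul C)
      hHc.aestronglyMeasurable (Eventually.of_forall fun x => ?_)
    rw [hHn, Real.rpow_neg (by positivity), Real.rpow_natCast]
    exact hC x
  let D := ZSpan.fundamentalDomain (Pi.basisFun ℝ (Fin n))
  have hDbd : ∀ x ∈ D, ‖x‖ ≤ 1 := fun x hx => by
    simp only [D, ZSpan.fundamentalDomain_pi_basisFun, Set.mem_pi, Set.mem_univ, true_imp_iff] at hx
    refine (pi_norm_le_iff_of_nonneg zero_le_one).2 fun i => ?_
    rw [Real.norm_of_nonneg (hx i).1]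
    exact (hx i).2.le
  have hDvol : volume D ≠ ⊤ := by
    simp only [D, ZSpan.fundamentalDomain_pi_basisFun]
    simp [volume_pi, Measure.pi_pi]
  have hDm : MeasurableSet D := ZSpan.fundamentalDomain_measurableSet _
  have : IsFiniteMeasure (volume.restrict D) := ⟨by simpa using hDvol.lt_top⟩
  let b' := (Pi.basisFun ℝ (Fin n)).restrictScalars ℤ
  have hb' : ∀ k, ((b'.equivFun.symm k : Submodule.span ℤ (Set.range (Pi.basisFun ℝ (Fin n)))) :
      Fin n → ℝ) = intVec k := fun k => by
    rw [Module.Basis.equivFun_symm_apply]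
    funext i
    simp [b', intVec, Pi.single_apply]
  have : Countable (Submodule.span ℤ (Set.range (Pi.basisFun ℝ (Fin n)))).toAddSubgroup :=
    b'.equivFun.toEquiv.countable_iff.2 inferInstance
  have h1 : ∫ x, H x = ∑' k, ∫ x in D, H (x + intVec k) := by
    rw [(ZSpan.isAddFundamentalDomain' (Pi.basisFun ℝ (Fin n)) volume).integral_eq_tsum'' H hHi]
    refine (b'.equivFun.symm.toEquiv.tsum_eq fun l : Submodule.span ℤ
      (Set.range (Pi.basisFun ℝ (Fin n))) => ∫ x in D, H (l +ᵥ x)).symm.trans ?_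
    refine tsum_congr fun k => ?_
    congr with x
    have : (b'.equivFun.symm.toEquiv k) +ᵥ x = intVec k + x := by
      rw [← hb' k]
      rfl
    rw [this, add_comm]
  have hbint : ∀ k, ∫ x in D, ‖H (x + intVec k)‖
      ≤ (C * (1 + 1) ^ N * ((1 + ‖intVec k‖) ^ N)⁻¹) * volume.real D := fun k => by
    have := setIntegral_mono_on (μ := volume) (s := D) (f := fun x => ‖H (x + intVec k)‖)
      (g := fun _ => C * (1 + 1) ^ N * ((1 + ‖intVec k‖) ^ N)⁻¹)
      ((hHi.comp_add_right (intVec k)).norm.integrableOn) (integrable_const _) hDm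
      fun x hx => by rw [hHn]; exact hb 1 x k (hDbd x hx)
    refine this.trans (le_of_eq ?_)
    rw [setIntegral_const, smul_eq_mul, mul_comm]
  have h2 := hasSum_integral_of_summable_integral_norm (μ := volume.restrict D)
    (F := fun k x => H (x + intVec k)) (fun k => (hHi.comp_add_right (intVec k)).integrableOn)
    (Summable.of_nonneg_of_le (fun k => integral_nonneg fun _ => norm_nonneg _) hbint
      ((hS.mul_left _).mul_right _))
  rw [h1, h2.tsum_eq, UnitAddTorus.mFourierCoeff_eq_integral _ _ 0, restrict_torusCube]
  congr with x
  have h3 : UnitAddTorus.mFourier (-m) (fun i => (x i : UnitAddCircle)) = e x := by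
    change UnitAddTorus.mFourier (-m) (torusMk x) = e x
    rw [mFourier_torusMk]
    simp [e]
  rw [h3, smul_eq_mul]
  change e x * g (torusMk x) = _
  rw [hg]
  simp only [g₀, ContinuousMap.coe_mk, H, hep]
  rw [tsum_mul_left]

/-! ### Poisson's formula for general lattices -/

/-- The linear isomorphism `x ↦ ∑ᵢ xᵢ bᵢ`. It maps `ℤⁿ` onto the lattice spanned by `b`. -/
def basisMap (b : Module.Basis (Fin n) ℝ (Rn n)) : (Fin n → ℝ) ≃L[ℝ] Rn n := b.equivFunL.symm

/-- The element with integer coordinates `m` with respect to the basis dual to `b`, see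
`inner_dualVec`. These elements form the lattice dual to the one spanned by `b`. -/
def dualVec (b : Module.Basis (Fin n) ℝ (Rn n)) (m : Fin n → ℤ) : Rn n :=
  (InnerProductSpace.toDual ℝ (Rn n)).symm
    (∑ i, (m i : ℝ) • (ContinuousLinearMap.proj (R := ℝ) (φ := fun _ : Fin n => ℝ) i).comp
      ((basisMap b).symm : Rn n →L[ℝ] (Fin n → ℝ)))

theorem inner_dualVec (b : Module.Basis (Fin n) ℝ (Rn n)) (m : Fin n → ℤ) (x : Fin n → ℝ) :
    inner ℝ (dualVec b m) (basisMap b x) = ∑ i, (m i : ℝ) * x i := by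
  rw [dualVec, InnerProductSpace.toDual_symm_apply, sum_apply]
  simp

theorem summable_inv_pow_of_le {V : Type*} [SeminormedAddCommGroup V] {v : (Fin n → ℤ) → V} {c : ℝ}
    (hc : ∀ k, ‖intVec k‖ ≤ c * ‖v k‖) {N : ℕ} (hN : n < N) :
    Summable fun k => ((1 + ‖v k‖) ^ N)⁻¹ := by
  refine Summable.of_nonneg_of_le (fun _ => by positivity) (fun k => ?_)
    ((summable_intVec_inv_pow hN).mul_left ((max c 1) ^ N))
  rw [← div_eq_mul_inv, inv_eq_one_div, div_le_div_iff₀ (by positivity) (by positivity), one_mul,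
    ← mul_pow]
  gcongr
  have h1 : c * ‖v k‖ ≤ max c 1 * ‖v k‖ := by gcongr; exact le_max_left _ _
  have h2 := le_max_right c 1
  linarith [hc k]

theorem summable_basisMap_inv_pow (b : Module.Basis (Fin n) ℝ (Rn n)) {N : ℕ} (hN : n < N) :
    Summable fun k => ((1 + ‖basisMap b (intVec k)‖) ^ N)⁻¹ := by
  refine summable_inv_pow_of_le
    (c := ‖((basisMap b).symm : Rn n →L[ℝ] (Fin n → ℝ))‖) (fun k => ?_) hN
  simpa using ((basisMap b).symm : Rn n →L[ℝ] (Fin n → ℝ)).le_opNorm (basisMap b (intVec k))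

theorem summable_dualVec_inv_pow (b : Module.Basis (Fin n) ℝ (Rn n)) {N : ℕ} (hN : n < N) :
    Summable fun m => ((1 + ‖dualVec b m‖) ^ N)⁻¹ := by
  classical
  refine summable_inv_pow_of_le
    (c := ∑ i, ‖basisMap b (Pi.single i 1)‖) (fun m => ?_) hN
  refine (pi_norm_le_iff_of_nonneg (by positivity)).2 fun i => ?_
  have h := inner_dualVec b m (Pi.single i 1)
  have h' : inner ℝ (dualVec b m) (basisMap b (Pi.single i 1)) = (m i : ℝ) := by
    rw [h]
    simp [Pi.single_apply]
  change ‖(m i : ℝ)‖ ≤ _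
  rw [← h']
  refine (norm_inner_le_norm _ _).trans ?_
  rw [mul_comm]
  gcongr
  exact Finset.single_le_sum (f := fun i => ‖basisMap b (Pi.single i 1)‖)
    (fun _ _ => norm_nonneg _) (Finset.mem_univ i)

theorem exists_integral_basisMap (b : Module.Basis (Fin n) ℝ (Rn n)) :
    ∃ κ : ℝ, 0 < κ ∧ ∀ F : Rn n → ℂ, ∫ x, F (basisMap b x) = κ • ∫ s, F s := by
  let ν : Measure (Rn n) := (volume : Measure (Fin n → ℝ)).map (basisMap b)
  have : ν.IsAddHaarMeasure := (basisMap b).isAddHaarMeasure_map volume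
  have h := Measure.isAddLeftInvariant_eq_smul ν (volume : Measure (Rn n))
  refine ⟨ν.addHaarScalarFactor volume, ?_, fun F => ?_⟩
  · exact_mod_cast Measure.addHaarScalarFactor_pos_of_isAddHaarMeasure ν volume
  · have h1 : ∫ x, F (basisMap b x) = ∫ s, F s ∂ν :=
      ((basisMap b).toHomeomorph.measurableEmbedding.integral_map F).symm
    have h2 := congrArg (fun μ : Measure (Rn n) => ∫ s, F s ∂μ) h
    simp only [integral_smul_nnreal_measure] at h2
    rw [h1, h2]
    rfl

/-- The density of the lattice spanned by `b`, that is, the reciprocal of its covolume. -/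
def density (b : Module.Basis (Fin n) ℝ (Rn n)) : ℝ := (exists_integral_basisMap b).choose

theorem density_pos (b : Module.Basis (Fin n) ℝ (Rn n)) : 0 < density b :=
  (exists_integral_basisMap b).choose_spec.1

theorem integral_basisMap (b : Module.Basis (Fin n) ℝ (Rn n)) (F : Rn n → ℂ) :
    ∫ x, F (basisMap b x) = density b • ∫ s, F s :=
  (exists_integral_basisMap b).choose_spec.2 F

/-- Periodization along the lattice spanned by `b`. In the coordinates of `b` it is a continuous
function on the torus, and its Fourier coefficients are values of the Fourier transform on the dual
lattice. -/
theorem exists_periodization_basis (b : Module.Basis (Fin n) ℝ (Rn n)) {G : Rn n → ℂ}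
    (hG : Continuous G) {N : ℕ} (hN : n < N) {C : ℝ}
    (hC : ∀ x, (1 + ‖x‖) ^ N * ‖G x‖ ≤ C) :
    ∃ g : C(UnitAddTorus (Fin n), ℂ),
      (∀ x, HasSum (fun k => G (basisMap b x + basisMap b (intVec k))) (g (torusMk x))) ∧
      ∀ m, UnitAddTorus.mFourierCoeff g m = density b •
        ∫ s, Complex.exp (2 * Real.pi * Complex.I * (inner ℝ (-dualVec b m) s : ℝ)) * G s := by
  let c := max 1 ‖((basisMap b).symm : Rn n →L[ℝ] (Fin n → ℝ))‖
  have hC0 : 0 ≤ C := (by positivity : (0 : ℝ) ≤ _).trans (hC 0)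
  have hdec : ∀ x, ‖G (basisMap b x)‖ ≤ C * c ^ N * ((1 + ‖x‖) ^ N)⁻¹ := fun x => by
    have h1 : 1 + ‖x‖ ≤ c * (1 + ‖basisMap b x‖) := by
      have := ((basisMap b).symm : Rn n →L[ℝ] (Fin n → ℝ)).le_opNorm (basisMap b x)
      have h2 : ‖((basisMap b).symm : Rn n →L[ℝ] (Fin n → ℝ))‖ * ‖basisMap b x‖
        ≤ c * ‖basisMap b x‖ := by gcongr; exact le_max_right _ _
      have h3 : (1 : ℝ) ≤ c := le_max_left _ _
      simp only [ContinuousLinearEquiv.coe_coe, ContinuousLinearEquiv.symm_apply_apply] at this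
      linarith
    rw [← div_eq_mul_inv, le_div_iff₀ (by positivity)]
    calc _ ≤ ‖G (basisMap b x)‖ * (c * (1 + ‖basisMap b x‖)) ^ N := by gcongr
      _ = c ^ N * ((1 + ‖basisMap b x‖) ^ N * ‖G (basisMap b x)‖) := by rw [mul_pow]; ring
      _ ≤ c ^ N * C := by gcongr; exact hC _
      _ = _ := mul_comm _ _
  obtain ⟨g, hg, hgc⟩ := exists_periodization (hG.comp (basisMap b).continuous) hN hdec
  refine ⟨g, fun x => ?_, fun m => ?_⟩
  · simpa [map_add] using hg x
  · rw [hgc, ← integral_basisMap]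
    congr with x
    rw [inner_neg_left, inner_dualVec]
    simp

/-- Poisson's summation formula for Schwartz functions. -/
theorem tsum_basisMap_eq (b : Module.Basis (Fin n) ℝ (Rn n)) (A : 𝓢(Rn n, ℂ)) :
    ∑' k, A (basisMap b (intVec k)) = density b • ∑' m, 𝓕 A (dualVec b m) := by
  obtain ⟨g, hg, hgc⟩ := exists_periodization_basis b A.continuous n.lt_add_one
    (one_add_pow_mul_norm_le (n + 1) A)
  have hF : ∀ m, UnitAddTorus.mFourierCoeff g m = density b • 𝓕 A (dualVec b m) := fun m => by
    rw [hgc, fourier_schwartz_apply]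
  have hs : Summable (UnitAddTorus.mFourierCoeff g) := by
    rw [funext hF]
    refine Summable.const_smul _ ?_
    refine Summable.of_norm_bounded ((summable_dualVec_inv_pow b n.lt_add_one).mul_left
      (2 ^ (n + 1) * schwartzNorm (n + 1) (𝓕 A))) fun m => ?_
    rw [← div_eq_mul_inv, le_div_iff₀ (by positivity), mul_comm]
    exact one_add_pow_mul_norm_le _ _ _
  have h1 := UnitAddTorus.hasSum_mFourier_series_apply_of_summable hs (torusMk 0)
  have h2 := hg 0
  simp only [map_zero, zero_add] at h2
  rw [h2.tsum_eq, ← h1.tsum_eq, ← tsum_const_smul'']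
  refine tsum_congr fun m => ?_
  rw [hF, mFourier_torusMk]
  simp

theorem summable_translate_basisMap (b : Module.Basis (Fin n) ℝ (Rn n)) (φ η : 𝓢(Rn n, ℂ)) :
    Summable fun k => φ (basisMap b (intVec k)) • translate (basisMap b (intVec k)) η := by
  refine summable_schwartz fun m => ?_
  refine Summable.of_nonneg_of_le (fun _ => apply_nonneg _ _) (fun k => ?_)
    ((summable_basisMap_inv_pow b n.lt_add_one).mul_left
      (2 ^ (m + (n + 1)) * schwartzNorm (m + (n + 1)) φ * (2 ^ m * schwartzNorm m η)))
  set v := basisMap b (intVec k)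
  rw [← div_eq_mul_inv, le_div_iff₀ (by positivity), map_smul_eq_mul]
  calc _ ≤ ‖φ v‖ * (2 ^ m * (1 + ‖v‖) ^ m * schwartzNorm m η) * (1 + ‖v‖) ^ (n + 1) := by
        gcongr
        exact schwartzNorm_translate_le _ _ _
    _ = ((1 + ‖v‖) ^ (m + (n + 1)) * ‖φ v‖) * (2 ^ m * schwartzNorm m η) := by ring
    _ ≤ _ := mul_le_mul_of_nonneg_right (one_add_pow_mul_norm_le _ _ _) (by positivity)

theorem summable_convS_modulate_dualVec (b : Module.Basis (Fin n) ℝ (Rn n)) (φ η : 𝓢(Rn n, ℂ)) :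
    Summable fun m => convS (modulate (-dualVec b m) φ) η := by
  refine summable_schwartz fun k => ?_
  obtain ⟨k', C, hC, h⟩ := exists_schwartzNorm_convS_modulate_le (n := n) k (n + 1)
  refine Summable.of_nonneg_of_le (fun _ => apply_nonneg _ _) (fun m => ?_)
    ((summable_dualVec_inv_pow b n.lt_add_one).mul_left
      (C * schwartzNorm k' φ * schwartzNorm k' η))
  rw [← div_eq_mul_inv, le_div_iff₀ (by positivity), mul_comm]
  simpa using h (-dualVec b m) φ η

/-- Evaluation at a point as a continuous functional on `𝓢(ℝⁿ)`. -/
def evalAt (t : Rn n) : 𝓢(Rn n, ℂ) →L[ℂ] ℂ :=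
  (BoundedContinuousFunction.evalCLM ℂ t).comp (SchwartzMap.toBoundedContinuousFunctionCLM ℂ _ _)

theorem evalAt_apply (t : Rn n) (φ : 𝓢(Rn n, ℂ)) : evalAt t φ = φ t := rfl

/-- Poisson's summation formula for `𝓢(ℝⁿ)`-valued series: superposing translates of `η` over a
lattice with weights sampled from `φ` amounts to superposing the convolutions of `η` with the
modulations of `φ` by the elements of the dual lattice. -/
theorem tsum_translate_basisMap (b : Module.Basis (Fin n) ℝ (Rn n)) (φ η : 𝓢(Rn n, ℂ)) :
    ∑' k, φ (basisMap b (intVec k)) • translate (basisMap b (intVec k)) η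
      = density b • ∑' m, convS (modulate (-dualVec b m) φ) η := by
  ext t
  have h1 := (summable_translate_basisMap b φ η).hasSum.mapL (evalAt t)
  have h2 := (summable_convS_modulate_dualVec b φ η).hasSum.mapL (evalAt t)
  have h3 := tsum_basisMap_eq b (mulS φ (translate t (reflect η)))
  have h4 : ∀ k, mulS φ (translate t (reflect η)) (basisMap b (intVec k))
      = evalAt t (φ (basisMap b (intVec k)) • translate (basisMap b (intVec k)) η) := fun k => by
    simp [mulS_apply, evalAt_apply, translate_apply, reflect_apply]
  have h5 : ∀ m, 𝓕 (mulS φ (translate t (reflect η))) (dualVec b m)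
      = evalAt t (convS (modulate (-dualVec b m) φ) η) := fun m => by
    rw [evalAt_apply, fourier_schwartz_apply, convS_apply]
    congr with s
    simp [mulS_apply, translate_apply, reflect_apply, modulate_apply, mul_assoc]
  simp_rw [h4, h5] at h3
  rw [h1.tsum_eq, h2.tsum_eq] at h3
  exact h3

/-! ### Applying a tempered distribution to a convolution -/

section Interchange

attribute [local instance] instMeasureSpaceUnitAddCircle

theorem norm_sub_le_of_norm_fderiv_le {V W : Type*} [NormedAddCommGroup V] [NormedSpace ℝ V]
    [NormedAddCommGroup W] [NormedSpace ℝ W] {f : V → W} (hf : Differentiable ℝ f) {t : V} {R K : ℝ}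
    (h : ∀ z, ‖z‖ ≤ R → ‖fderiv ℝ f (t - z)‖ ≤ K) {x y : V} (hx : ‖x‖ ≤ R) (hy : ‖y‖ ≤ R) :
    ‖f (t - x) - f (t - y)‖ ≤ K * ‖x - y‖ := by
  have := (convex_closedBall t R).norm_image_sub_le_of_norm_fderiv_le (fun z _ => hf z)
    (C := K) (fun z hz => by
      have := h (t - z) (by rwa [← dist_eq_norm, dist_comm])
      rwa [sub_sub_cancel] at this)
    (x := t - y) (y := t - x) (by simpa [dist_eq_norm] using hy) (by simpa [dist_eq_norm] using hx)
  rwa [sub_sub_sub_cancel_left, norm_sub_rev y x] at this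

/-- Translation is Lipschitz continuous on bounded sets, at the cost of one derivative. -/
theorem schwartzNorm_translate_sub_le (m : ℕ) (η : 𝓢(Rn n, ℂ)) {R : ℝ} {x y : Rn n}
    (hx : ‖x‖ ≤ R) (hy : ‖y‖ ≤ R) :
    schwartzNorm m (translate x η - translate y η)
      ≤ 2 ^ (m + 1) * schwartzNorm (m + 1) η * (1 + R) ^ m * ‖x - y‖ := by
  have hR : 0 ≤ R := (norm_nonneg x).trans hx
  refine schwartzNorm_le (by positivity) fun k hk i hi t => ?_
  have e1 : iteratedFDeriv ℝ i (translate x η - translate y η : 𝓢(Rn n, ℂ)) t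
      = iteratedFDeriv ℝ i η (t - x) - iteratedFDeriv ℝ i η (t - y) := by
    rw [← iteratedFDeriv_translate, ← iteratedFDeriv_translate]
    exact iteratedFDeriv_sub_apply ((translate x η).contDiffAt i) ((translate y η).contDiffAt i)
  have hd : Differentiable ℝ (iteratedFDeriv ℝ i η) :=
    (η.smooth ⊤).differentiable_iteratedFDeriv (mod_cast ENat.natCast_lt_top i)
  have ht : (0 : ℝ) < (1 + ‖t‖) ^ k := by positivity
  have hbd : ∀ z, ‖z‖ ≤ R → ‖fderiv ℝ (iteratedFDeriv ℝ i η) (t - z)‖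
      ≤ 2 ^ (m + 1) * schwartzNorm (m + 1) η * (1 + R) ^ m / (1 + ‖t‖) ^ k := by
    intro z hz
    rw [norm_fderiv_iteratedFDeriv, le_div_iff₀ ht]
    have h2 : (1 + ‖t‖) ^ k ≤ (1 + ‖t - z‖) ^ k * (1 + R) ^ m := by
      calc (1 + ‖t‖) ^ k ≤ ((1 + ‖t - z‖) * (1 + ‖z‖)) ^ k := by
            gcongr; exact one_add_norm_le_mul t z
        _ = (1 + ‖t - z‖) ^ k * (1 + ‖z‖) ^ k := mul_pow _ _ _
        _ ≤ (1 + ‖t - z‖) ^ k * (1 + R) ^ k := by gcongr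
        _ ≤ _ := by gcongr; linarith
    calc _ ≤ ‖iteratedFDeriv ℝ (i + 1) η (t - z)‖ * ((1 + ‖t - z‖) ^ k * (1 + R) ^ m) := by gcongr
      _ = (1 + ‖t - z‖) ^ k * ‖iteratedFDeriv ℝ (i + 1) η (t - z)‖ * (1 + R) ^ m := by ring
      _ ≤ _ := by
        refine mul_le_mul_of_nonneg_right ?_ (by positivity)
        exact one_add_pow_mul_le_schwartzNorm (by lia) (by lia) η _
  have := norm_sub_le_of_norm_fderiv_le hd hbd hx hy
  rw [div_mul_eq_mul_div, le_div_iff₀ ht, mul_comm] at this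
  rw [e1]
  refine le_trans ?_ this
  gcongr
  simp

theorem continuous_translate (η : 𝓢(Rn n, ℂ)) : Continuous fun x : Rn n => translate x η := by
  refine continuous_iff_continuousAt.2 fun y => tendsto_of_schwartzNorm fun m => ?_
  let C := 2 ^ (m + 1) * schwartzNorm (m + 1) η * (1 + (‖y‖ + 1)) ^ m
  have h0 : Tendsto (fun x => C * ‖x - y‖) (𝓝 y) (𝓝 0) := by
    have : Continuous fun x => C * ‖x - y‖ := by fun_prop
    simpa using this.tendsto y
  refine squeeze_zero' (Eventually.of_forall fun _ => apply_nonneg _ _) ?_ h0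
  filter_upwards [Metric.ball_mem_nhds y one_pos] with x hx
  refine schwartzNorm_translate_sub_le m η ?_ (by linarith)
  have h1 : ‖x - y‖ < 1 := by rwa [← dist_eq_norm]
  have h2 := norm_add_le (x - y) y
  rw [sub_add_cancel] at h2
  linarith

theorem exists_norm_translate_le (u : TempDist n) (η : 𝓢(Rn n, ℂ)) :
    ∃ (m : ℕ) (C : ℝ), 0 ≤ C ∧ ∀ x, ‖u (translate x η)‖ ≤ C * (1 + ‖x‖) ^ m := by
  obtain ⟨m, C, hC, h⟩ := exists_clm_le_schwartzNorm u
  refine ⟨m, C * (2 ^ m * schwartzNorm m η), by positivity, fun x => (h _).trans ?_⟩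
  calc _ ≤ C * (2 ^ m * (1 + ‖x‖) ^ m * schwartzNorm m η) :=
        mul_le_mul_of_nonneg_left (schwartzNorm_translate_le _ _ _) hC
    _ = _ := by ring

/-- A Schwartz function times a continuous function of polynomial growth decays rapidly. -/
theorem exists_decay_of_growth (φ : 𝓢(Rn n, ℂ)) {G : Rn n → ℂ} {m : ℕ} {C : ℝ} (hC : 0 ≤ C)
    (hG : ∀ x, ‖G x‖ ≤ C * (1 + ‖x‖) ^ m) (N : ℕ) (x : Rn n) :
    (1 + ‖x‖) ^ N * ‖φ x * G x‖ ≤ 2 ^ (N + m) * schwartzNorm (N + m) φ * C := by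
  rw [norm_mul]
  calc _ ≤ (1 + ‖x‖) ^ N * (‖φ x‖ * (C * (1 + ‖x‖) ^ m)) := by gcongr; exact hG x
    _ = ((1 + ‖x‖) ^ (N + m) * ‖φ x‖) * C := by ring
    _ ≤ _ := mul_le_mul_of_nonneg_right (one_add_pow_mul_norm_le _ _ _) hC

theorem mFourierCoeff_eq_of_hasSum {g : C(UnitAddTorus (Fin n), ℂ)} {c : (Fin n → ℤ) → ℂ}
    (h : HasSum (fun m => c m • UnitAddTorus.mFourier m) g) (m : Fin n → ℤ) :
    UnitAddTorus.mFourierCoeff g m = c m := by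
  classical
  have : IsProbabilityMeasure (volume : Measure UnitAddCircle) :=
    inferInstanceAs (IsProbabilityMeasure AddCircle.haarAddCircle)
  let B := UnitAddTorus.mFourierBasis (d := Fin n)
  have h1 := h.mapL (ContinuousMap.toLp (E := ℂ) 2 volume ℂ)
  have h2 := h1.mapL (innerSL ℂ (B m))
  have h3 := orthonormal_iff_ite.1 B.orthonormal m
  have h4 : HasSum (fun j => if j = m then c m else 0) (UnitAddTorus.mFourierCoeff g m) := by
    rw [← UnitAddTorus.mFourierCoeff_toLp, ← UnitAddTorus.mFourierBasis_repr,
      HilbertBasis.repr_apply_apply]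
    refine h2.congr_fun fun j => ?_
    have h5 : ContinuousMap.toLp (E := ℂ) 2 volume ℂ (UnitAddTorus.mFourier j) = B j := by
      rw [UnitAddTorus.coe_mFourierBasis]
    rw [map_smul, map_smul, h5, innerSL_apply_apply, h3]
    by_cases hj : j = m
    · simp [hj]
    · simp [hj, Ne.symm hj]
  exact h4.unique (hasSum_ite_eq m (c m))

/-- A tempered distribution can be applied under the integral sign of a convolution
`φ * η = ∫ φ(x) T_x η dx`. The `ℤⁿ`-periodization of the integrand is a Fourier series whose
coefficients are given by `tsum_translate_basisMap`; its coefficient of frequency `0` is at the same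
time the integral and `⟨u, φ * η⟩`. -/
theorem dist_convS (u : TempDist n) (φ η : 𝓢(Rn n, ℂ)) :
    u (convS φ η) = ∫ x, φ x * u (translate x η) := by
  let b := (EuclideanSpace.basisFun (Fin n) ℝ).toBasis
  obtain ⟨m, C, hC, h⟩ := exists_norm_translate_le u η
  obtain ⟨g, hg, hgc⟩ := exists_periodization_basis b
    (φ.continuous.mul (u.continuous.comp (continuous_translate η))) n.lt_add_one
    (exists_decay_of_growth φ hC h _)
  let c : (Fin n → ℤ) → ℂ := fun m => density b • u (convS (modulate (-dualVec b m) φ) η)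
  have hc : Summable c := ((summable_convS_modulate_dualVec b φ η).mapL u).const_smul _
  have hsum : Summable fun m => c m • UnitAddTorus.mFourier m := by
    refine Summable.of_norm ?_
    simp_rw [norm_smul, UnitAddTorus.mFourier_norm, mul_one]
    exact hc.norm
  have hval : ∀ y, HasSum (fun m => c m • UnitAddTorus.mFourier m (torusMk y)) (g (torusMk y)) := by
    intro y
    set z := basisMap b y
    have h1 := (summable_translate_basisMap b (translate (-z) φ) (translate z η)).hasSum.mapL u
    rw [tsum_translate_basisMap, ContinuousLinearMap.map_smul_of_tower] at h1
    have h2 := (((summable_convS_modulate_dualVec b (translate (-z) φ) (translate z η)).hasSum.mapL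
      u).const_smul (density b))
    have h3 := (hg y).unique (h1.congr_fun fun k => ?_)
    · rw [h3]
      refine h2.congr_fun fun m => ?_
      have e1 : modulate (-dualVec b m) (translate (-z) φ)
          = UnitAddTorus.mFourier m (torusMk y) • translate (-z) (modulate (-dualVec b m) φ) := by
        rw [modulate_translate, inner_neg_neg, inner_dualVec, mFourier_torusMk]
      have e2 : convS (translate (-z) (modulate (-dualVec b m) φ)) (translate z η)
          = convS (modulate (-dualVec b m) φ) η := by
        rw [← translate_convS, convS_comm, ← translate_convS, translate_translate, add_neg_cancel,
          convS_comm]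
        ext t
        simp [translate_apply]
      rw [e1, convS_comm, ← convCLM_apply, map_smul, convCLM_apply, convS_comm, e2, map_smul]
      simp only [c, smul_eq_mul, Complex.real_smul]
      ring
    · rw [map_smul, translate_translate, translate_apply, sub_neg_eq_add, add_comm z]
      rfl
  have hgs : HasSum (fun m => c m • UnitAddTorus.mFourier m) g := by
    have : (∑' m, c m • UnitAddTorus.mFourier m) = g := by
      ext t
      obtain ⟨y, rfl⟩ := isQuotientMap_torusMk.surjective t
      refine HasSum.unique ?_ (hval y)
      exact hsum.hasSum.mapL (ContinuousMap.evalCLM ℂ (torusMk y))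
    rw [← this]
    exact hsum.hasSum
  have h0 := mFourierCoeff_eq_of_hasSum hgs 0
  rw [hgc] at h0
  have hd : dualVec b 0 = 0 := by simp [dualVec]
  have hm : modulate (0 : Rn n) φ = φ := by
    ext t
    simp [modulate_apply]
  simp only [c, hd, neg_zero, hm, inner_zero_left, Complex.ofReal_zero, mul_zero, Complex.exp_zero,
    one_mul] at h0
  exact (smul_right_injective ℂ (density_pos b).ne' h0).symm

end Interchange

/-! ### Convolution of a tempered distribution with a Schwartz function -/

/-- The convolution `f * φ` of a tempered distribution and a Schwartz function as a tempered
distribution, `⟨f * φ, h⟩ = ⟨f, φ̌ * h⟩`. -/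
def convDist (f : TempDist n) (φ : 𝓢(Rn n, ℂ)) : TempDist n := f.comp (convCLM (reflect φ))

theorem convDist_apply (f : TempDist n) (φ h : 𝓢(Rn n, ℂ)) :
    convDist f φ h = f (convS (reflect φ) h) := rfl

theorem convDist_apply_eq_integral (f : TempDist n) (φ h : 𝓢(Rn n, ℂ)) :
    convDist f φ h = ∫ x, conv f φ x * h x := by
  rw [convDist_apply, convS_comm, dist_convS]
  congr with x
  exact mul_comm _ _

theorem continuous_conv (f : TempDist n) (φ : 𝓢(Rn n, ℂ)) : Continuous (conv f φ) :=
  f.continuous.comp (continuous_translate _)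

theorem convDist_isGivenBy (f : TempDist n) (φ : 𝓢(Rn n, ℂ)) :
    IsGivenBy (convDist f φ) (conv f φ) :=
  ⟨(continuous_conv f φ).locallyIntegrable, fun h _ => convDist_apply_eq_integral f φ h⟩

theorem convDist_schwartzToDist (a φ : 𝓢(Rn n, ℂ)) :
    convDist (schwartzToDist a) φ = schwartzToDist (convS a φ) := by
  ext h
  exact schwartzToDist_convS a φ h

theorem convDist_modulateDist (ξ : Rn n) (f : TempDist n) (φ : 𝓢(Rn n, ℂ)) :
    convDist (modulateDist ξ f) φ = modulateDist ξ (convDist f (modulate (-ξ) φ)) := by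
  ext h
  change f (modulate ξ (convS (reflect φ) h)) = f (convS (reflect (modulate (-ξ) φ)) (modulate ξ h))
  rw [reflect_modulate, neg_neg, modulate_convS]

/-! ### Operators on TMIBs and DTMIBs -/

section Spaces

variable {E : Type*} [NormedAddCommGroup E] [NormedSpace ℂ E]

/-- The operators that the argument uses on a TMIB or DTMIB `E`: modulations and translations of
polynomially bounded norm, and convolutions with Schwartz functions. -/
structure HasOperators (J : DistInclusion n E) : Prop where
  modulate : ∃ (K : ℕ) (C : ℝ), 0 ≤ C ∧ ∀ ξ : Rn n, ∃ A : E →L[ℂ] E,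
    ‖A‖ ≤ C * (1 + ‖ξ‖) ^ K ∧ ∀ e, J.toCLM (A e) = modulateDist ξ (J.toCLM e)
  translate : ∃ (K : ℕ) (C : ℝ), 0 ≤ C ∧ ∀ x : Rn n, ∃ A : E →L[ℂ] E,
    ‖A‖ ≤ C * (1 + ‖x‖) ^ K ∧ ∀ e, J.toCLM (A e) = translateDist x (J.toCLM e)
  conv : ∃ (m : ℕ) (C : ℝ), 0 ≤ C ∧ ∀ φ : 𝓢(Rn n, ℂ), ∃ A : E →L[ℂ] E,
    ‖A‖ ≤ C * schwartzNorm m φ ∧ ∀ e, J.toCLM (A e) = convDist (J.toCLM e) φ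

theorem exists_clm_of_forall_exists (J : DistInclusion n E) (T : 𝓢(Rn n, ℂ) →L[ℂ] 𝓢(Rn n, ℂ))
    {C : ℝ} (hC : 0 ≤ C) (h : ∀ e, ∃ e', J.toCLM e' = (J.toCLM e).comp T ∧ ‖e'‖ ≤ C * ‖e‖) :
    ∃ A : E →L[ℂ] E, ‖A‖ ≤ C ∧ ∀ e, J.toCLM (A e) = (J.toCLM e).comp T := by
  choose A hA hb using h
  let L : E →ₗ[ℂ] E :=
    { toFun := A
      map_add' := fun x y => J.injective (by simp only [map_add, hA]; rfl)
      map_smul' := fun a x => J.injective (by simp only [map_smul, hA]; rfl) }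
  exact ⟨L.mkContinuous C hb, L.mkContinuous_norm_le hC hb, hA⟩

theorem rpow_le_pow_ceil {r τ : ℝ} (hr : 0 ≤ r) : (1 + r) ^ τ ≤ (1 + r) ^ ⌈τ⌉₊ := by
  rw [← Real.rpow_natCast]
  exact Real.rpow_le_rpow_of_exponent_le (by linarith) (Nat.le_ceil τ)

/-- On a TMIB, convolution with a Schwartz function is bounded: for `η ∈ 𝓢(ℝⁿ)` and a functional `ℓ`
on `E` one has `⟨ℓ, η * φ⟩ = ∫ φ(x) ⟨ℓ, T_x η⟩ dx`, and `𝓢(ℝⁿ)` is dense in `E`. -/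
theorem IsTMIB.hasOperators [CompleteSpace E] {J : DistInclusion n E} (h : IsTMIB J) :
    HasOperators J := by
  obtain ⟨τ₀, C₀, -, hC₀, hT⟩ := h.translate_bound
  obtain ⟨τ₁, C₁, -, hC₁, hM⟩ := h.modulate_bound
  have hT' : ∀ (x : Rn n) (e e' : E), J.toCLM e' = translateDist x (J.toCLM e) →
      ‖e'‖ ≤ C₀ * (1 + ‖x‖) ^ ⌈τ₀⌉₊ * ‖e‖ := fun x e e' he => (hT x e e' he).trans (by
    gcongr
    exact rpow_le_pow_ceil (norm_nonneg x))
  refine ⟨⟨⌈τ₁⌉₊, C₁, hC₁.le, fun ξ => ?_⟩, ⟨⌈τ₀⌉₊, C₀, hC₀.le, fun x => ?_⟩, ?_⟩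
  · refine exists_clm_of_forall_exists J (TMIB.modulate ξ) (by positivity) fun e => ?_
    obtain ⟨e', he'⟩ := h.modulate_mem ξ e
    refine ⟨e', he', (hM ξ e e' he').trans ?_⟩
    gcongr
    exact rpow_le_pow_ceil (norm_nonneg ξ)
  · refine exists_clm_of_forall_exists J (TMIB.translate (-x)) (by positivity) fun e => ?_
    obtain ⟨e', he'⟩ := h.translate_mem x e
    exact ⟨e', he', hT' x e e' he'⟩
  · obtain ⟨j, hj, hJj⟩ := h.dense_inclusion
    let M := n + 1 + ⌈τ₀⌉₊
    let I : ℝ := ∫ x : Rn n, (1 + ‖x‖) ^ (-((n + 1 : ℕ) : ℝ))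
    have hI : 0 ≤ I := integral_nonneg fun x => by positivity
    have hdim : (Module.finrank ℝ (Rn n) : ℝ) < (n + 1 : ℕ) := by simp
    have hint := integrable_one_add_norm (μ := (volume : Measure (Rn n))) hdim
    have key : ∀ φ η : 𝓢(Rn n, ℂ),
        ‖j (convS φ η)‖ ≤ 2 ^ M * C₀ * I * schwartzNorm M φ * ‖j η‖ := by
      intro φ η
      refine NormedSpace.norm_le_dual_bound ℂ _ (by positivity) fun ℓ => ?_
      let u : TempDist n := ℓ.comp j
      change ‖u (convS φ η)‖ ≤ _
      rw [dist_convS]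
      have hb : ∀ x, ‖φ x * u (TMIB.translate x η)‖
          ≤ 2 ^ M * C₀ * schwartzNorm M φ * ‖j η‖ * ‖ℓ‖ * (1 + ‖x‖) ^ (-((n + 1 : ℕ) : ℝ)) := by
        intro x
        have h1 : ‖u (TMIB.translate x η)‖ ≤ ‖ℓ‖ * (C₀ * (1 + ‖x‖) ^ ⌈τ₀⌉₊ * ‖j η‖) := by
          refine (ℓ.le_opNorm _).trans ?_
          gcongr
          refine hT' x _ _ ?_
          exact (hJj _).trans (by rw [hJj, translateDist_schwartzToDist])
        rw [Real.rpow_neg (by positivity), Real.rpow_natCast, ← div_eq_mul_inv,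
          le_div_iff₀ (by positivity), norm_mul]
        calc _ ≤ ‖φ x‖ * (‖ℓ‖ * (C₀ * (1 + ‖x‖) ^ ⌈τ₀⌉₊ * ‖j η‖)) * (1 + ‖x‖) ^ (n + 1) := by
              gcongr
          _ = ((1 + ‖x‖) ^ M * ‖φ x‖) * (C₀ * ‖j η‖ * ‖ℓ‖) := by
              simp only [M]
              ring
          _ ≤ (2 ^ M * schwartzNorm M φ) * (C₀ * ‖j η‖ * ‖ℓ‖) :=
              mul_le_mul_of_nonneg_right (one_add_pow_mul_norm_le _ _ _) (by positivity)
          _ = _ := by ring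
      refine (norm_integral_le_of_norm_le (hint.const_mul _) (Eventually.of_forall hb)).trans ?_
      rw [integral_const_mul]
      exact le_of_eq (by simp only [I]; ring)
    refine ⟨M, 2 ^ M * C₀ * I, by positivity, fun φ => ?_⟩
    let g : 𝓢(Rn n, ℂ) →ₗ[ℂ] E := (j.comp (convCLM φ)).toLinearMap
    have hg : ∀ η, ‖g η‖ ≤ 2 ^ M * C₀ * I * schwartzNorm M φ * ‖j η‖ := key φ
    let A : E →L[ℂ] E := g.extendOfNorm j.toLinearMap
    refine ⟨A, ContinuousLinearMap.opNorm_le_bound _ (by positivity) fun e =>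
      LinearMap.norm_extendOfNorm_apply_le hj _ hg e, fun e => ?_⟩
    have hc : Continuous fun e => convDist (J.toCLM e) φ :=
      ((ContinuousLinearMap.precomp ℂ (convCLM (reflect φ))).comp J.toCLM).continuous
    refine congrFun (hj.equalizer (J.toCLM.continuous.comp A.continuous) hc (funext fun η => ?_)) e
    have hA : A (j η) = j (convS φ η) := LinearMap.extendOfNorm_eq hj ⟨_, hg⟩ η
    simp only [Function.comp, hA, hJj, convDist_schwartzToDist, convS_comm]

/-- On a DTMIB the operators are the adjoints of operators of the same kind on the predual. -/
theorem IsDTMIB.hasOperators {J : DistInclusion n E} (h : IsDTMIB J) : HasOperators J := by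
  obtain ⟨F, _, _, _, K, Φ, hK, hΦ⟩ := h
  obtain ⟨j, -, hKj⟩ := hK.dense_inclusion
  have hJ : ∀ e φ, J.toCLM e φ = Φ e (j φ) := fun e φ => hΦ e φ (j φ) (hKj φ)
  obtain ⟨⟨K₁, C₁, hC₁, h₁⟩, ⟨K₀, C₀, hC₀, h₀⟩, ⟨m, C₂, hC₂, h₂⟩⟩ := hK.hasOperators
  let c : ℝ := ‖(Φ.symm : StrongDual ℂ F →L[ℂ] E)‖ * ‖(Φ : E →L[ℂ] StrongDual ℂ F)‖
  have hc : 0 ≤ c := by positivity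
  have dual : ∀ (T T' : 𝓢(Rn n, ℂ) →L[ℂ] 𝓢(Rn n, ℂ)) (A : F →L[ℂ] F) (C : ℝ), ‖A‖ ≤ C →
      (∀ v, K.toCLM (A v) = (K.toCLM v).comp T') →
      (∀ a, (schwartzToDist a).comp T' = schwartzToDist (T a)) →
      ∃ B : E →L[ℂ] E, ‖B‖ ≤ c * C ∧ ∀ e, J.toCLM (B e) = (J.toCLM e).comp T := by
    intro T T' A C hA hAT hTT
    have hAj : ∀ a, A (j a) = j (T a) := fun a => K.injective (by rw [hAT, hKj, hKj, hTT])
    have hC : 0 ≤ C := (norm_nonneg A).trans hA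
    refine exists_clm_of_forall_exists J T (by positivity) fun e =>
      ⟨Φ.symm ((Φ e).comp A), ?_, ?_⟩
    · ext a
      rw [hJ, Φ.apply_symm_apply]
      change Φ e (A (j a)) = J.toCLM e (T a)
      rw [hAj, hJ]
    · calc _ ≤ ‖(Φ.symm : StrongDual ℂ F →L[ℂ] E)‖ * ‖(Φ e).comp A‖ :=
            (Φ.symm : StrongDual ℂ F →L[ℂ] E).le_opNorm _
        _ ≤ ‖(Φ.symm : StrongDual ℂ F →L[ℂ] E)‖ *
            ((‖(Φ : E →L[ℂ] StrongDual ℂ F)‖ * ‖e‖) * C) := by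
            gcongr
            refine (ContinuousLinearMap.opNorm_comp_le _ _).trans ?_
            gcongr
            exact (Φ : E →L[ℂ] StrongDual ℂ F).le_opNorm e
        _ = _ := by simp only [c]; ring
  refine ⟨⟨K₁, c * C₁, by positivity, fun ξ => ?_⟩, ⟨K₀, c * C₀, by positivity, fun x => ?_⟩, ?_⟩
  · obtain ⟨A, hA, hA'⟩ := h₁ ξ
    rw [mul_assoc]
    exact dual (TMIB.modulate ξ) (TMIB.modulate ξ) A _ hA hA'
      fun a => modulateDist_schwartzToDist ξ a
  · obtain ⟨A, hA, hA'⟩ := h₀ (-x)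
    rw [norm_neg] at hA
    rw [mul_assoc]
    exact dual (TMIB.translate (-x)) (TMIB.translate (- -x)) A _ hA hA'
      fun a => translateDist_schwartzToDist (-x) a
  · obtain ⟨m', C₃, hC₃, h₃⟩ := exists_schwartzNorm_clm_le (reflect (n := n)) m
    refine ⟨m', c * (C₂ * C₃), by positivity, fun φ => ?_⟩
    obtain ⟨A, hA, hA'⟩ := h₂ (reflect φ)
    have hA2 : ‖A‖ ≤ C₂ * (C₃ * schwartzNorm m' φ) :=
      hA.trans (mul_le_mul_of_nonneg_left (h₃ φ) hC₂)
    have := dual (convCLM (reflect φ)) (convCLM (reflect (reflect φ))) A _ hA2 hA' fun a => by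
      rw [convCLM_apply, convS_comm]
      exact convDist_schwartzToDist a (reflect φ)
    rw [show c * (C₂ * C₃) * schwartzNorm m' φ = c * (C₂ * (C₃ * schwartzNorm m' φ)) by ring]
    exact this

end Spaces

variable {E : Type*} [NormedAddCommGroup E] [NormedSpace ℂ E] {J : DistInclusion n E}

/-! ### Continuity of `φ ↦ f * φ` for `f ∈ 𝓓'_E` -/

namespace DistSpace

theorem toCLM_convE (f : DistSpace J) (φ : 𝓢(Rn n, ℂ)) :
    J.toCLM (convE f φ) = convDist f.toDist φ :=
  (convE_spec f φ).unique (convDist_isGivenBy _ _)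

theorem convE_eq (f : DistSpace J) (φ : 𝓢(Rn n, ℂ)) {e : E}
    (h : J.toCLM e = convDist f.toDist φ) : convE f φ = e :=
  J.injective ((toCLM_convE f φ).trans h.symm)

/-- The element of `𝓓'_E` defined by a distribution whose convolutions with Schwartz functions
belong to `E`. -/
def ofDist (f : TempDist n) (hf : ∀ φ, ∃ e, J.toCLM e = convDist f φ) : DistSpace J :=
  Subtype.mk (p := (· ∈ distSubmodule J)) f fun φ => by
    obtain ⟨e, he⟩ := hf φ
    exact ⟨e, he ▸ convDist_isGivenBy f φ⟩

theorem toDist_injective : Function.Injective (toDist (J := J)) :=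
  fun _ _ h => Subtype.ext (p := (· ∈ distSubmodule J)) h

theorem convE_add_left (f g : DistSpace J) (φ : 𝓢(Rn n, ℂ)) :
    convE (f + g) φ = convE f φ + convE g φ :=
  convE_eq _ _ (by rw [map_add, toCLM_convE, toCLM_convE]; rfl)

theorem convE_smul_left (a : ℂ) (f : DistSpace J) (φ : 𝓢(Rn n, ℂ)) :
    convE (a • f) φ = a • convE f φ :=
  convE_eq _ _ (by rw [map_smul, toCLM_convE]; rfl)

/-- The linear map `φ ↦ f * φ` from `𝓢(ℝⁿ)` to `E`. -/
def convELin (f : DistSpace J) : 𝓢(Rn n, ℂ) →ₗ[ℂ] E where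
  toFun := convE f
  map_add' φ η := convE_eq _ _ (by
    rw [map_add, toCLM_convE, toCLM_convE]
    ext h
    simp only [_root_.add_apply, convDist_apply]
    rw [← map_add, convS_comm, convS_comm _ h, convS_comm _ h]
    simp only [← convCLM_apply, map_add])
  map_smul' a φ := convE_eq _ _ (by
    rw [map_smul, toCLM_convE]
    ext h
    simp only [_root_.smul_apply, convDist_apply, RingHom.id_apply]
    rw [← map_smul, convS_comm, convS_comm _ h]
    simp only [← convCLM_apply, map_smul])

theorem convELin_apply (f : DistSpace J) (φ : 𝓢(Rn n, ℂ)) : convELin f φ = convE f φ := rfl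

end DistSpace

open DistSpace

theorem summable_schwartzNorm_smul {w : ℕ → 𝓢(Rn n, ℂ)}
    (hw : ∀ m, ∃ C, ∀ i, schwartzNorm m (w i) ≤ C) (a : lp (fun _ : ℕ => ℂ) 1) (m : ℕ) :
    Summable fun i => schwartzNorm m (a i • w i) := by
  obtain ⟨C, hC⟩ := hw m
  have ha : Summable fun i => ‖a i‖ := by
    simpa using (memℓp_gen_iff (p := 1) (by simp)).1 a.2
  refine Summable.of_nonneg_of_le (fun _ => apply_nonneg _ _) (fun i => ?_) (ha.mul_right C)
  rw [map_smul_eq_mul]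
  exact mul_le_mul_of_nonneg_left (hC i) (norm_nonneg _)

theorem schwartzNorm_tsum_smul_le {w : ℕ → 𝓢(Rn n, ℂ)}
    (hw : ∀ m, ∃ C, ∀ i, schwartzNorm m (w i) ≤ C) (m : ℕ) :
    ∃ C, ∀ a : lp (fun _ : ℕ => ℂ) 1, schwartzNorm m (∑' i, a i • w i) ≤ ‖a‖ * C := by
  obtain ⟨C, hC⟩ := hw m
  refine ⟨C, fun a => ?_⟩
  have ha : Summable fun i => ‖a i‖ := by
    simpa using (memℓp_gen_iff (p := 1) (by simp)).1 a.2
  refine (schwartzNorm_tsum_le (summable_schwartzNorm_smul hw a) m).trans ?_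
  have hn : ‖a‖ = ∑' i, ‖a i‖ := by
    simpa using lp.norm_eq_tsum_rpow (p := 1) (by simp) a
  rw [hn, ← tsum_mul_right]
  refine (summable_schwartzNorm_smul hw a m).tsum_le_tsum (fun i => ?_) (ha.mul_right C)
  rw [map_smul_eq_mul]
  exact mul_le_mul_of_nonneg_left (hC i) (norm_nonneg _)

/-- For a bounded sequence `w` in `𝓢(ℝⁿ)` the sequence `f * wᵢ` is bounded in `E`, by the closed
graph theorem for the map `a ↦ f * ∑ᵢ aᵢ wᵢ` from the Banach space `ℓ¹` to `E`. -/
theorem exists_norm_convE_le_of_bounded [CompleteSpace E] (f : DistSpace J) {w : ℕ → 𝓢(Rn n, ℂ)}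
    (hw : ∀ m, ∃ C, ∀ i, schwartzNorm m (w i) ≤ C) : ∃ C, ∀ i, ‖convE f (w i)‖ ≤ C := by
  have hs : ∀ a : lp (fun _ : ℕ => ℂ) 1, Summable fun i => a i • w i := fun a =>
    summable_schwartz (summable_schwartzNorm_smul hw a)
  let S : lp (fun _ : ℕ => ℂ) 1 →ₗ[ℂ] 𝓢(Rn n, ℂ) :=
    { toFun := fun a => ∑' i, a i • w i
      map_add' := fun a b => by
        rw [← (hs a).tsum_add (hs b)]
        exact tsum_congr fun i => add_smul _ _ _
      map_smul' := fun c a => by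
        rw [RingHom.id_apply, ← (hs a).tsum_const_smul c]
        exact tsum_congr fun i => mul_smul c (a i) (w i) }
  let T : lp (fun _ : ℕ => ℂ) 1 →ₗ[ℂ] E := (convELin f).comp S
  have hT : Continuous T := by
    refine T.continuous_of_seq_closed_graph fun u a y hu hy => ?_
    have hS : Tendsto (fun k => S (u k)) atTop (𝓝 (S a)) := by
      refine tendsto_of_schwartzNorm fun m => ?_
      obtain ⟨C, hC⟩ := schwartzNorm_tsum_smul_le hw m
      have h0 : Tendsto (fun k => ‖u k - a‖ * C) atTop (𝓝 0) := by
        simpa using (tendsto_iff_norm_sub_tendsto_zero.1 hu).mul_const C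
      refine squeeze_zero (fun _ => apply_nonneg _ _) (fun k => ?_) h0
      rw [← map_sub]
      exact hC (u k - a)
    -- `J` separates points, and the pairings with a test function `h` converge on both sides
    refine J.injective ?_
    ext h
    have h1 : Tendsto (fun k => J.toCLM (T (u k)) h) atTop (𝓝 (J.toCLM y h)) :=
      ((continuous_eval_const (F := TempDist n) h).comp J.toCLM.continuous).tendsto y |>.comp hy
    have h2 : ∀ φ, J.toCLM (convE f φ) h = f.toDist (convCLM h (reflect φ)) := fun φ => by
      rw [toCLM_convE, convDist_apply, convS_comm, convCLM_apply]
    have h3 : Tendsto (fun k => J.toCLM (T (u k)) h) atTop (𝓝 (J.toCLM (T a) h)) := by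
      change Tendsto (fun k => J.toCLM (convE f (S (u k))) h) atTop (𝓝 (J.toCLM (convE f (S a)) h))
      simp only [h2]
      exact ((f.toDist.continuous.comp ((convCLM h).continuous.comp reflect.continuous)).tendsto
        _).comp hS
    exact tendsto_nhds_unique h1 h3
  let T' : lp (fun _ : ℕ => ℂ) 1 →L[ℂ] E := ⟨T, hT⟩
  refine ⟨‖T'‖, fun i => ?_⟩
  have h1 : T' (lp.single 1 i 1) = convE f (w i) := by
    change convE f (∑' j, (lp.single 1 i (1 : ℂ) : lp (fun _ : ℕ => ℂ) 1) j • w j) = _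
    rw [tsum_eq_single i fun j hj => by rw [lp.single_apply_ne _ _ _ hj, zero_smul],
      lp.single_apply_self, one_smul]
  have h2 := T'.le_opNorm (lp.single 1 i 1)
  rwa [h1, lp.norm_single (by simp), norm_one, mul_one] at h2

/-- For `f ∈ 𝓓'_E` the map `φ ↦ f * φ` is continuous from `𝓢(ℝⁿ)` to `E`: it maps bounded sets to
bounded sets, and `𝓢(ℝⁿ)` is metrizable. -/
theorem exists_norm_convE_le [CompleteSpace E] (f : DistSpace J) :
    ∃ (m : ℕ) (C : ℝ), 0 ≤ C ∧ ∀ φ, ‖convE f φ‖ ≤ C * schwartzNorm m φ := by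
  have hcont : Continuous (convELin f) := by
    refine (convELin f).continuous_of_locally_bounded (𝕜 := ℂ) (𝕜' := ℂ) fun B hB => ?_
    rw [NormedSpace.isVonNBounded_iff, isBounded_iff_forall_norm_le]
    by_contra! hne
    have : ∀ i : ℕ, ∃ φ ∈ B, (i : ℝ) < ‖convE f φ‖ := fun i => by
      obtain ⟨_, ⟨φ, hφ, rfl⟩, h⟩ := hne i
      exact ⟨φ, hφ, h⟩
    choose w hwB hw using this
    obtain ⟨C, hC⟩ := exists_norm_convE_le_of_bounded f (w := w) fun m => by
      obtain ⟨C, hC⟩ := isVonNBounded_iff_schwartzNorm.1 hB m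
      exact ⟨C, fun i => hC _ (hwB i)⟩
    obtain ⟨i, hi⟩ := exists_nat_gt C
    linarith [hw i, hC i]
  exact exists_clm_le_schwartzNorm (⟨convELin f, hcont⟩ : 𝓢(Rn n, ℂ) →L[ℂ] E)

/-! ### The sampling operator -/

/-- A lattice is the image of `ℤⁿ` under `basisMap b` for some basis `b`. -/
theorem exists_basis_equiv (Λ : Submodule ℤ (Rn n)) [DiscreteTopology Λ] [IsZLattice ℝ Λ] :
    ∃ (b : Module.Basis (Fin n) ℝ (Rn n)) (e : (Fin n → ℤ) ≃ Λ),
      ∀ k, (e k : Rn n) = basisMap b (intVec k) := by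
  have h1 : Module.Finite ℤ Λ := ZLattice.module_finite ℝ Λ
  have h2 : Module.Free ℤ Λ := ZLattice.module_free ℝ Λ
  let b₀ : Module.Basis (Fin n) ℤ Λ := Module.finBasisOfFinrankEq ℤ Λ
    (by rw [ZLattice.rank ℝ Λ, finrank_euclideanSpace_fin])
  refine ⟨b₀.ofZLatticeBasis ℝ Λ, b₀.equivFun.symm.toEquiv, fun k => ?_⟩
  change ((b₀.equivFun.symm k : Λ) : Rn n) = (b₀.ofZLatticeBasis ℝ Λ).equivFun.symm (intVec k)
  rw [Module.Basis.equivFun_symm_apply, Module.Basis.equivFun_symm_apply]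
  simp only [Submodule.coe_sum, Submodule.coe_smul, Module.Basis.ofZLatticeBasis_apply, intVec]
  exact Finset.sum_congr rfl fun i _ => (Int.cast_smul_eq_zsmul ℝ (k i) _).symm

/-- The operator `M_ξ` on `E`. -/
def HasOperators.modOp (hJ : HasOperators J) (ξ : Rn n) : E →L[ℂ] E :=
  (hJ.modulate.choose_spec.choose_spec.2 ξ).choose

theorem HasOperators.toCLM_modOp (hJ : HasOperators J) (ξ : Rn n) (e : E) :
    J.toCLM (hJ.modOp ξ e) = modulateDist ξ (J.toCLM e) :=
  (hJ.modulate.choose_spec.choose_spec.2 ξ).choose_spec.2 e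

theorem HasOperators.exists_norm_modOp_le (hJ : HasOperators J) :
    ∃ (K : ℕ) (C : ℝ), 0 ≤ C ∧ ∀ ξ e, ‖hJ.modOp ξ e‖ ≤ C * (1 + ‖ξ‖) ^ K * ‖e‖ :=
  ⟨hJ.modulate.choose, hJ.modulate.choose_spec.choose, hJ.modulate.choose_spec.choose_spec.1,
    fun ξ e => ((hJ.modOp ξ).le_opNorm e).trans (mul_le_mul_of_nonneg_right
      (hJ.modulate.choose_spec.choose_spec.2 ξ).choose_spec.1 (norm_nonneg e))⟩

/-- The evaluation `u ↦ ⟨u, h⟩` on `𝓢'(ℝⁿ)`. -/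
def evalDist (h : 𝓢(Rn n, ℂ)) : TempDist n →L[ℂ] ℂ :=
  ⟨⟨⟨fun u => u h, fun _ _ => rfl⟩, fun _ _ => rfl⟩, continuous_eval_const (F := TempDist n) h⟩

/-- The terms of the series defining `sampling`. -/
def samplingTerm (hJ : HasOperators J) (b : Module.Basis (Fin n) ℝ (Rn n)) (f : DistSpace J)
    (a η : 𝓢(Rn n, ℂ)) (m : Fin n → ℤ) : E :=
  hJ.modOp (-dualVec b m) (convE f (convS (modulate (dualVec b m) η) a))

/-- For `f ∈ 𝓓'_E`, this is the distribution `∑_λ (f * a)(λ) T_λ η`, where `λ` runs through the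
lattice spanned by `b`, as an element of `E` (see `hasSum_sampling`). It is defined by the
absolutely convergent series that Poisson's summation formula gives. -/
def sampling (hJ : HasOperators J) (b : Module.Basis (Fin n) ℝ (Rn n)) (f : DistSpace J)
    (a η : 𝓢(Rn n, ℂ)) : E := density b • ∑' m, samplingTerm hJ b f a η m

theorem toCLM_samplingTerm (hJ : HasOperators J) (b : Module.Basis (Fin n) ℝ (Rn n))
    (f : DistSpace J) (a η h : 𝓢(Rn n, ℂ)) (m : Fin n → ℤ) :
    J.toCLM (samplingTerm hJ b f a η m) h
      = f.toDist (convS (modulate (-dualVec b m) (convS (reflect η) h)) (reflect a)) := by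
  rw [samplingTerm, hJ.toCLM_modOp, toCLM_convE]
  change f.toDist (convS (reflect _) (modulate (-dualVec b m) h)) = _
  rw [reflect_convS, reflect_modulate, modulate_convS, convS_assoc, convS_assoc,
    convS_comm (reflect a)]

/-- If `‖f * (M_μ η * a)‖` decays sufficiently fast for `μ` in the dual lattice, then the sampling
series converges absolutely. -/
theorem exists_norm_sampling_le (hJ : HasOperators J) (b : Module.Basis (Fin n) ℝ (Rn n)) :
    ∃ (K : ℕ) (C : ℝ), 0 ≤ C ∧ ∀ (f : DistSpace J) (a η : 𝓢(Rn n, ℂ)) (M : ℝ),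
      (∀ m, (1 + ‖dualVec b m‖) ^ K * ‖convE f (convS (modulate (dualVec b m) η) a)‖ ≤ M) →
      (Summable fun m => ‖samplingTerm hJ b f a η m‖) ∧ ‖sampling hJ b f a η‖ ≤ C * M := by
  obtain ⟨K, C, hC, h⟩ := hJ.exists_norm_modOp_le
  -- `n + 1` powers for the summation over the dual lattice, `K` for the norms of the modulations
  have hS := summable_dualVec_inv_pow b n.lt_add_one
  refine ⟨K + (n + 1), density b * (C * ∑' m, ((1 + ‖dualVec b m‖) ^ (n + 1))⁻¹), ?_, ?_⟩
  · have := (density_pos b).le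
    have : 0 ≤ ∑' m, ((1 + ‖dualVec b m‖) ^ (n + 1))⁻¹ := tsum_nonneg fun m => by positivity
    positivity
  intro f a η M hM
  have hb : ∀ m, ‖samplingTerm hJ b f a η m‖ ≤ C * M * ((1 + ‖dualVec b m‖) ^ (n + 1))⁻¹ := by
    intro m
    refine (h _ _).trans ?_
    rw [norm_neg, ← div_eq_mul_inv, le_div_iff₀ (by positivity)]
    calc _ = C * ((1 + ‖dualVec b m‖) ^ (K + (n + 1)) *
          ‖convE f (convS (modulate (dualVec b m) η) a)‖) := by ring
      _ ≤ C * M := by gcongr; exact hM m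
  have hs : Summable fun m => ‖samplingTerm hJ b f a η m‖ :=
    Summable.of_nonneg_of_le (fun _ => norm_nonneg _) hb (hS.mul_left _)
  refine ⟨hs, ?_⟩
  rw [sampling, norm_smul, Real.norm_of_nonneg (density_pos b).le, mul_assoc]
  refine mul_le_mul_of_nonneg_left ?_ (density_pos b).le
  refine (norm_tsum_le_tsum_norm hs).trans
    ((hs.tsum_le_tsum hb (hS.mul_left _)).trans (le_of_eq ?_))
  rw [tsum_mul_left]
  ring

theorem summable_norm_samplingTerm [CompleteSpace E] (hJ : HasOperators J)
    (b : Module.Basis (Fin n) ℝ (Rn n)) (f : DistSpace J) (a η : 𝓢(Rn n, ℂ)) :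
    Summable fun m => ‖samplingTerm hJ b f a η m‖ := by
  obtain ⟨K, C, hC, h⟩ := exists_norm_sampling_le hJ b
  obtain ⟨m₁, C₁, hC₁, h₁⟩ := exists_norm_convE_le f
  obtain ⟨m₂, C₂, hC₂, h₂⟩ := exists_schwartzNorm_convS_modulate_le (n := n) m₁ K
  refine (h f a η (C₁ * (C₂ * schwartzNorm m₂ η * schwartzNorm m₂ a)) fun m => ?_).1
  calc _ ≤ (1 + ‖dualVec b m‖) ^ K *
        (C₁ * schwartzNorm m₁ (convS (modulate (dualVec b m) η) a)) := by gcongr; exact h₁ _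
    _ = C₁ * ((1 + ‖dualVec b m‖) ^ K *
        schwartzNorm m₁ (convS (modulate (dualVec b m) η) a)) := by ring
    _ ≤ _ := mul_le_mul_of_nonneg_left (h₂ _ _ _) hC₁

theorem schwartzToDist_translate (x : Rn n) (η h : 𝓢(Rn n, ℂ)) :
    schwartzToDist (translate x η) h = convS (reflect η) h x := by
  rw [schwartzToDist_apply, convS_comm, convS_apply]
  congr with t
  rw [translate_apply, reflect_apply, neg_sub, mul_comm]

/-- The series `∑_λ (f * a)(λ) T_λ η` converges weakly to `sampling hJ b f a η`: pairing it with `h`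
gives `f`, applied to the left-hand side of `tsum_translate_basisMap` for the functions `η̌ * h` and
`ǎ`, and the terms on the right-hand side of that identity are the terms of the sampling series. -/
theorem hasSum_sampling [CompleteSpace E] (hJ : HasOperators J)
    (b : Module.Basis (Fin n) ℝ (Rn n)) (f : DistSpace J) (a η h : 𝓢(Rn n, ℂ)) :
    HasSum (fun k => conv f.toDist a (basisMap b (intVec k)) *
      schwartzToDist (translate (basisMap b (intVec k)) η) h)
      (J.toCLM (sampling hJ b f a η) h) := by
  have h1 := (summable_translate_basisMap b (convS (reflect η) h) (reflect a)).hasSum.mapL f.toDist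
  rw [tsum_translate_basisMap, ContinuousLinearMap.map_smul_of_tower] at h1
  have h2 := (summable_convS_modulate_dualVec b (convS (reflect η) h) (reflect a)).hasSum.mapL
    f.toDist
  have h3 := (summable_norm_samplingTerm hJ b f a η).of_norm.hasSum.mapL J.toCLM
  have h4 : HasSum (fun m => J.toCLM (samplingTerm hJ b f a η m) h)
      (J.toCLM (∑' m, samplingTerm hJ b f a η m) h) := h3.mapL (evalDist h)
  simp_rw [toCLM_samplingTerm] at h4
  rw [h2.unique h4] at h1
  rw [sampling, ContinuousLinearMap.map_smul_of_tower]
  refine h1.congr_fun fun k => ?_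
  rw [map_smul, smul_eq_mul, schwartzToDist_translate, mul_comm]
  rfl

section Coefficients

variable {Λ : Submodule ℤ (Rn n)}

/-! ### Synthesis with the window of the discrete space -/

theorem finite_lattice_norm_le (Λ : Submodule ℤ (Rn n)) [DiscreteTopology Λ] [IsZLattice ℝ Λ]
    (R : ℝ) : {l : Λ | ‖(l : Rn n)‖ ≤ R}.Finite := by
  rcases lt_or_ge R 0 with hR | hR
  · convert Set.finite_empty
    ext l
    simpa using hR.trans_le (norm_nonneg _)
  have h := (summable_zlattice_inv_pow Λ n.lt_add_one).tendsto_cofinite_zero.eventually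
    (gt_mem_nhds (show (0 : ℝ) < ((1 + R) ^ (n + 1))⁻¹ by positivity))
  refine (Filter.eventually_cofinite.1 h).subset fun l hl => not_lt.2 ?_
  have hl' : ‖(l : Rn n)‖ ≤ R := hl
  gcongr

namespace DiscreteWindow

/-- The window `χ` as a Schwartz function. -/
def schwartz (W : DiscreteWindow Λ) : 𝓢(Rn n, ℂ) :=
  W.χ.hasCompactSupport.toSchwartzMap W.χ.contDiff

theorem exists_norm_sub_le (W : DiscreteWindow Λ) :
    ∃ R, ∀ (l : Λ) (t : Rn n), W.χ (t - l) ≠ 0 → ‖(l : Rn n)‖ ≤ ‖t‖ + R := by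
  obtain ⟨R, hR⟩ := isBounded_iff_forall_norm_le.1 W.bounded
  refine ⟨R, fun l t h => ?_⟩
  have h1 := hR _ (W.χ.tsupport_subset (subset_tsupport _ h))
  have h2 : (l : Rn n) = t - (t - l) := by simp
  rw [h2]
  exact (norm_sub_le _ _).trans (by gcongr)

end DiscreteWindow

theorem continuous_synthFun [DiscreteTopology Λ] [IsZLattice ℝ Λ] (W : DiscreteWindow Λ)
    (c : Λ → ℂ) : Continuous (synthFun W c) := by
  refine continuous_finsum (fun l => ?_) fun t => ?_
  · exact continuous_const.mul (W.χ.contDiff.continuous.comp (continuous_id.sub continuous_const))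
  · obtain ⟨R, hR⟩ := W.exists_norm_sub_le
    refine ⟨Metric.ball t 1, Metric.ball_mem_nhds t one_pos,
      (finite_lattice_norm_le Λ (‖t‖ + 1 + R)).subset ?_⟩
    rintro l ⟨s, hs, hst⟩
    have h1 := hR l s (right_ne_zero_of_mul hs)
    have h2 : ‖s - t‖ < 1 := mem_ball_iff_norm.1 hst
    have h3 := norm_le_norm_add_norm_sub' s t
    change ‖(l : Rn n)‖ ≤ _
    linarith

/-- The distribution `∑_λ c_λ T_λ χ` is given by the function `S_χ(c)`. -/
theorem isGivenBy_synthFun [DiscreteTopology Λ] [IsZLattice ℝ Λ] (W : DiscreteWindow Λ)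
    {c : Λ → ℂ} {u : TempDist n}
    (h : ∀ φ, HasSum (fun l : Λ => c l * schwartzToDist (translate l W.schwartz) φ) (u φ)) :
    IsGivenBy u (synthFun W c) := by
  refine ⟨(continuous_synthFun W c).locallyIntegrable, fun φ hφ => ?_⟩
  obtain ⟨R, hR⟩ := W.exists_norm_sub_le
  obtain ⟨R', hR'⟩ := isBounded_iff_forall_norm_le.1 hφ.isCompact.isBounded
  let F := (finite_lattice_norm_le Λ (R' + R)).toFinset
  have hzero : ∀ l ∉ F, ∀ t, W.χ (t - l) * φ t = 0 := by
    intro l hl t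
    by_contra hne
    refine hl ((Set.Finite.mem_toFinset _).2 ((hR l t (left_ne_zero_of_mul hne)).trans ?_))
    have := hR' t (subset_tsupport _ (right_ne_zero_of_mul hne))
    gcongr
  have hterm : ∀ l : Λ, c l * schwartzToDist (translate l W.schwartz) φ
      = ∫ t, c l * (W.χ (t - l) * φ t) := fun l => by
    rw [integral_const_mul, schwartzToDist_apply]
    rfl
  have h1 : u φ = ∑ l ∈ F, c l * schwartzToDist (translate l W.schwartz) φ := by
    refine (h φ).unique (hasSum_sum_of_ne_finset_zero fun l hl => ?_)
    rw [hterm]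
    simp [hzero l hl]
  rw [h1]
  simp_rw [hterm]
  rw [← integral_finsetSum]
  · congr with t
    rw [synthFun, finsum_mul' _ _ (W.subsingleton c t).finite]
    rw [finsum_eq_sum_of_support_subset (s := F)]
    · simp_rw [mul_assoc]
    · intro l hl
      by_contra hlF
      refine hl ?_
      change c l * W.χ (t - l) * φ t = 0
      rw [mul_assoc, hzero l (fun h => hlF h) t, mul_zero]
  · intro l _
    refine Integrable.const_mul ?_ _
    refine Continuous.integrable_of_hasCompactSupport ?_ hφ.mul_left
    exact (W.χ.contDiff.continuous.comp (continuous_id.sub continuous_const)).mul φ.continuous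

/-! ### The coefficients of the Gabor expansion -/

/-- The modulation `M_ξ f` of `f ∈ 𝓓'_E`. -/
def HasOperators.modDist (hJ : HasOperators J) (ξ : Rn n) (f : DistSpace J) : DistSpace J :=
  ofDist (modulateDist ξ f.toDist) fun φ =>
    ⟨hJ.modOp ξ (convE f (TMIB.modulate (-ξ) φ)), by
      rw [hJ.toCLM_modOp, toCLM_convE, convDist_modulateDist]⟩

theorem HasOperators.convE_modDist (hJ : HasOperators J) (ξ : Rn n) (f : DistSpace J)
    (φ : 𝓢(Rn n, ℂ)) : convE (hJ.modDist ξ f) φ = hJ.modOp ξ (convE f (TMIB.modulate (-ξ) φ)) :=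
  convE_eq _ _ (by
    rw [hJ.toCLM_modOp, toCLM_convE, ← convDist_modulateDist]
    rfl)

theorem stft_eq_conv (hJ : HasOperators J) (ψ : 𝓢(Rn n, ℂ)) (f : DistSpace J) (x ξ : Rn n) :
    stft ψ f.toDist x ξ = conv (hJ.modDist (-ξ) f).toDist (reflect (conjugate ψ)) x := by
  rw [conv, reflect_reflect]
  rfl

/-- For `f ∈ 𝓓'_E` and fixed frequency `ξ`, the coefficients `V_ψ f(λ, ξ)`, `λ ∈ Λ`, belong to
`E_d(Λ)`, and their norm is controlled by convolutions of `f` with a family of test functions. -/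
theorem exists_coeff_norm_le [CompleteSpace E] [DiscreteTopology Λ] [IsZLattice ℝ Λ]
    (hJ : HasOperators J) (W : DiscreteWindow Λ) (ψ : 𝓢(Rn n, ℂ)) :
    ∃ (K : ℕ) (C : ℝ) (μ : (Fin n → ℤ) → Rn n) (a : 𝓢(Rn n, ℂ)), 0 ≤ C ∧
      ∀ (f : DistSpace J) (ξ : Rn n), ∃ c : DiscreteSpace J W,
        (∀ l : Λ, c l = stft ψ f.toDist l ξ) ∧
        ∀ M, (∀ m, (1 + ‖μ m‖) ^ K *
          ‖convE f (modulate ξ (convS (modulate (μ m) W.schwartz) a))‖ ≤ M) →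
          ‖c‖ ≤ C * (1 + ‖ξ‖) ^ K * M := by
  obtain ⟨b, e, he⟩ := exists_basis_equiv Λ
  obtain ⟨K₁, C₁, hC₁, h₁⟩ := exists_norm_sampling_le hJ b
  obtain ⟨K₂, C₂, hC₂, h₂⟩ := hJ.exists_norm_modOp_le
  refine ⟨K₁ + K₂, C₁ * C₂, dualVec b, reflect (conjugate ψ), by positivity, fun f ξ => ?_⟩
  let v := sampling hJ b (hJ.modDist (-ξ) f) (reflect (conjugate ψ)) W.schwartz
  have hv : IsGivenBy (J.toCLM v) (synthFun W fun l : Λ => stft ψ f.toDist l ξ) := by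
    refine isGivenBy_synthFun W fun φ => ?_
    rw [← e.hasSum_iff]
    refine (hasSum_sampling hJ b _ _ _ φ).congr_fun fun k => ?_
    rw [Function.comp, he, stft_eq_conv hJ]
  let c : DiscreteSpace J W :=
    Subtype.mk (p := (· ∈ discreteSubmodule J W)) (fun l : Λ => stft ψ f.toDist l ξ) ⟨v, hv⟩
  refine ⟨c, fun _ => rfl, fun M hM => ?_⟩
  have hc : DiscreteSpace.synth J W c = v :=
    DiscreteSpace.eq_of_isGivenBy (DiscreteSpace.synth_spec c) hv
  rw [DiscreteSpace.norm_eq, hc]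
  have hM0 : 0 ≤ M := le_trans (by positivity) (hM 0)
  have h3 := (h₁ (hJ.modDist (-ξ) f) (reflect (conjugate ψ)) W.schwartz
    (C₂ * (1 + ‖ξ‖) ^ K₂ * M) fun m => ?_).2
  · refine h3.trans ?_
    rw [pow_add]
    have h4 : (1 : ℝ) ≤ (1 + ‖ξ‖) ^ K₁ := one_le_pow₀ (by simp)
    calc C₁ * (C₂ * (1 + ‖ξ‖) ^ K₂ * M) = C₁ * C₂ * (1 * (1 + ‖ξ‖) ^ K₂) * M := by ring
      _ ≤ _ := by gcongr
  · rw [hJ.convE_modDist, neg_neg]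
    refine (mul_le_mul_of_nonneg_left (h₂ _ _) (by positivity)).trans ?_
    rw [norm_neg]
    calc _ = C₂ * (1 + ‖ξ‖) ^ K₂ * ((1 + ‖dualVec b m‖) ^ K₁ * ‖convE f (modulate ξ
          (convS (modulate (dualVec b m) W.schwartz) (reflect (conjugate ψ))))‖) := by ring
      _ ≤ _ := by
        refine mul_le_mul_of_nonneg_left (le_trans ?_ (hM m)) (by positivity)
        gcongr
        · simp
        · exact Nat.le_add_right _ _

/-- The test functions `M_ξ(M_μ χ * a)` have Schwartz seminorms that decay rapidly in `μ` and grow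
polynomially in `ξ`. -/
theorem exists_schwartzNorm_modulate_convS_modulate_le (m N : ℕ) (χ a : 𝓢(Rn n, ℂ)) :
    ∃ (K : ℕ) (C : ℝ), 0 ≤ C ∧ ∀ ξ μ : Rn n,
      (1 + ‖μ‖) ^ N * schwartzNorm m (modulate ξ (convS (modulate μ χ) a))
        ≤ C * (1 + ‖ξ‖) ^ K := by
  obtain ⟨m₁, K, C₁, hC₁, h₁⟩ := exists_schwartzNorm_modulate_le (n := n) m
  obtain ⟨m₂, C₂, hC₂, h₂⟩ := exists_schwartzNorm_convS_modulate_le (n := n) m₁ N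
  have h0 : 0 ≤ schwartzNorm m₂ χ * schwartzNorm m₂ a :=
    mul_nonneg (apply_nonneg _ _) (apply_nonneg _ _)
  refine ⟨K, C₁ * (C₂ * (schwartzNorm m₂ χ * schwartzNorm m₂ a)), by positivity, fun ξ μ => ?_⟩
  calc _ ≤ (1 + ‖μ‖) ^ N * (C₁ * (1 + ‖ξ‖) ^ K * schwartzNorm m₁ (convS (modulate μ χ) a)) :=
        mul_le_mul_of_nonneg_left (h₁ _ _) (by positivity)
    _ = C₁ * (1 + ‖ξ‖) ^ K * ((1 + ‖μ‖) ^ N * schwartzNorm m₁ (convS (modulate μ χ) a)) := by ring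
    _ ≤ C₁ * (1 + ‖ξ‖) ^ K * (C₂ * schwartzNorm m₂ χ * schwartzNorm m₂ a) :=
        mul_le_mul_of_nonneg_left (h₂ _ _ _) (by positivity)
    _ = _ := by ring

end Coefficients

/-! ### The space `s'(Λ; X)` -/

section Sequences

variable {Λ : Submodule ℤ (Rn n)} {X : Type*} [NormedAddCommGroup X] [NormedSpace ℂ X]

theorem WeightedLinf.norm_apply_le {N : ℕ} (x : WeightedLinf Λ X N) (l : Λ) :
    ‖SlowSeq.ofStep Λ X N x l‖ ≤ ‖x‖ * (1 + ‖(l : Rn n)‖) ^ N := by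
  have h := lp.norm_apply_le_norm (by simp) (WeightedLinf.toLinf Λ X N x) l
  have h1 : ‖WeightedLinf.toLinf Λ X N x l‖
      = ((1 + ‖(l : Rn n)‖) ^ N)⁻¹ * ‖SlowSeq.ofStep Λ X N x l‖ := by
    change ‖(((1 + ‖(l : Rn n)‖) ^ N : ℝ) : ℂ)⁻¹ • SlowSeq.ofStep Λ X N x l‖ = _
    rw [norm_smul, norm_inv, Complex.norm_real, Real.norm_of_nonneg (by positivity)]
  rw [h1, inv_mul_le_iff₀ (by positivity), mul_comm] at h
  exact h

theorem exists_ofStep_eq {N : ℕ} (x : Λ → X) {C : ℝ} (hC : 0 ≤ C)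
    (h : ∀ l : Λ, ‖x l‖ ≤ C * (1 + ‖(l : Rn n)‖) ^ N) :
    ∃ y : WeightedLinf Λ X N, (∀ l, SlowSeq.ofStep Λ X N y l = x l) ∧ ‖y‖ ≤ C := by
  have hb : ∀ l, ‖weighted Λ X N x l‖ ≤ C := fun l => by
    change ‖(((1 + ‖(l : Rn n)‖) ^ N : ℝ) : ℂ)⁻¹ • x l‖ ≤ C
    rw [norm_smul, norm_inv, Complex.norm_real, Real.norm_of_nonneg (by positivity),
      inv_mul_le_iff₀ (by positivity), mul_comm]
    exact h l
  have hx : x ∈ weightedSubmodule Λ X N := memℓp_infty_iff.2 ⟨C, by rintro _ ⟨l, rfl⟩; exact hb l⟩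
  exact ⟨Subtype.mk (p := (· ∈ weightedSubmodule Λ X N)) x hx, fun _ => rfl,
    lp.norm_le_of_forall_le hC hb⟩

namespace SlowSeq

theorem ext {x y : SlowSeq Λ X} (h : ∀ l, x l = y l) : x = y :=
  Subtype.ext (p := (· ∈ slowSubmodule Λ X)) (funext h)

theorem add_apply (x y : SlowSeq Λ X) (l : Λ) : (x + y) l = x l + y l := rfl

theorem exists_eq_ofStep (x : SlowSeq Λ X) : ∃ N y, x = ofStep Λ X N y := by
  obtain ⟨N, hN⟩ := Subtype.property (p := (· ∈ slowSubmodule Λ X)) x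
  exact ⟨N, Subtype.mk (p := (· ∈ weightedSubmodule Λ X N)) x.toFun hN, rfl⟩

/-- The inclusion of the `N`-th step as a linear map. -/
def ofStepLin (N : ℕ) : WeightedLinf Λ X N →ₗ[ℂ] SlowSeq Λ X where
  toFun := ofStep Λ X N
  map_add' _ _ := rfl
  map_smul' _ _ := rfl

theorem continuous_ofStep (N : ℕ) : Continuous (ofStep Λ X N) :=
  continuous_sInf_rng.2 fun _ ht => ht.1 N

instance : IsTopologicalAddGroup (SlowSeq Λ X) := topologicalAddGroup_sInf fun _ ht => ht.2.1

instance : ContinuousSMul ℂ (SlowSeq Λ X) := continuousSMul_sInf fun _ ht => ht.2.2.1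

instance : ContinuousSMul ℝ (SlowSeq Λ X) :=
  ⟨(Complex.continuous_ofReal.comp continuous_fst).smul continuous_snd⟩

instance : LocallyConvexSpace ℝ (SlowSeq Λ X) := LocallyConvexSpace.sInf fun _ ht => ht.2.2.2

/-- The universal property of the locally convex inductive limit, for maps to normed spaces. -/
theorem continuous_of_bound {Y : Type*} [NormedAddCommGroup Y] [NormedSpace ℂ Y]
    (T : SlowSeq Λ X →ₗ[ℂ] Y) (hT : ∀ N, ∃ C, ∀ x, ‖T (ofStep Λ X N x)‖ ≤ C * ‖x‖) :
    Continuous T := by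
  rw [continuous_iff_le_induced]
  refine sInf_le ⟨fun N => ?_, topologicalAddGroup_induced T, continuousSMul_induced T,
    LocallyConvexSpace.induced (T.restrictScalars ℝ)⟩
  obtain ⟨C, hC⟩ := hT N
  rw [continuous_induced_rng]
  exact ((T.comp (ofStepLin N)).mkContinuous C hC).continuous

/-- The family with the entry `x` at `l` and `0` elsewhere. -/
theorem exists_single (l : Λ) (x : X) : ∃ y : SlowSeq Λ X, y.toFun = Pi.single l x ∧
    ∀ N, ∃ z : WeightedLinf Λ X N, y = ofStep Λ X N z ∧
      ‖z‖ ≤ ‖x‖ * ((1 + ‖(l : Rn n)‖) ^ N)⁻¹ := by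
  have h : ∀ N, ∃ z : WeightedLinf Λ X N,
      (∀ m, SlowSeq.ofStep Λ X N z m = (Pi.single l x : Λ → X) m) ∧
      ‖z‖ ≤ ‖x‖ * ((1 + ‖(l : Rn n)‖) ^ N)⁻¹ := fun N => by
    refine exists_ofStep_eq _ (by positivity) fun m => ?_
    rcases eq_or_ne m l with rfl | hm
    · rw [Pi.single_eq_same, inv_mul_cancel_right₀ (by positivity)]
    · rw [Pi.single_eq_of_ne hm, norm_zero]
      positivity
  obtain ⟨z₀, hz₀, -⟩ := h 0
  refine ⟨ofStep Λ X 0 z₀, funext hz₀, fun N => ?_⟩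
  obtain ⟨z, hz, hn⟩ := h N
  exact ⟨z, ext fun m => (hz₀ m).trans (hz m).symm, hn⟩

/-- A continuous seminorm on `s'(Λ; X)` is dominated by a weighted `ℓ¹`-norm with a rapidly
decreasing weight `v`. The weight bounds the seminorm on families supported at one point, and the
truncations of an element of one step converge to it in the next step. -/
theorem exists_seminorm_le [DiscreteTopology Λ] [IsZLattice ℝ Λ] (p : Seminorm ℝ (SlowSeq Λ X))
    (hp : Continuous p) : ∃ (v : Λ → ℝ) (S : ℝ), 0 ≤ S ∧ (∀ l, 0 ≤ v l) ∧
      (∀ N, ∃ C, ∀ l : Λ, (1 + ‖(l : Rn n)‖) ^ N * v l ≤ C) ∧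
      ∀ (x : SlowSeq Λ X) (M : ℝ), (∀ l : Λ, (1 + ‖(l : Rn n)‖) ^ (n + 1) * (v l * ‖x l‖) ≤ M) →
        p x ≤ S * M := by
  have h : ∀ N, ∃ C, 0 < C ∧ ∀ x : WeightedLinf Λ X N, p (ofStep Λ X N x) ≤ C * ‖x‖ := fun N =>
    (p.comp ((ofStepLin N).restrictScalars ℝ)).bound_of_continuous_normedSpace
      (hp.comp (continuous_ofStep N))
  choose C hC0 hC using h
  let v : Λ → ℝ := fun l => ⨅ N, C N * ((1 + ‖(l : Rn n)‖) ^ N)⁻¹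
  have hterm : ∀ (l : Λ) N, 0 ≤ C N * ((1 + ‖(l : Rn n)‖) ^ N)⁻¹ := fun l N => by
    have := (hC0 N).le
    positivity
  have hbdd : ∀ l : Λ, BddBelow (range fun N => C N * ((1 + ‖(l : Rn n)‖) ^ N)⁻¹) := fun l =>
    ⟨0, by rintro _ ⟨N, rfl⟩; exact hterm l N⟩
  have hv : ∀ l, 0 ≤ v l := fun l => le_ciInf (hterm l)
  have hsingle : ∀ (y : SlowSeq Λ X) l x, y.toFun = Pi.single l x → p y ≤ v l * ‖x‖ := by
    intro y l x hy
    rw [Real.iInf_mul_of_nonneg (norm_nonneg x)]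
    refine le_ciInf fun N => ?_
    obtain ⟨y', hy', hz⟩ := exists_single l x
    obtain ⟨z, hyz, hzn⟩ := hz N
    rw [show y = y' from ext fun m => by rw [hy, hy'], hyz]
    refine (hC N z).trans ?_
    calc _ ≤ C N * (‖x‖ * ((1 + ‖(l : Rn n)‖) ^ N)⁻¹) :=
          mul_le_mul_of_nonneg_left hzn (hC0 N).le
      _ = _ := by ring
  have hsum := summable_zlattice_inv_pow Λ n.lt_add_one
  refine ⟨v, ∑' l : Λ, ((1 + ‖(l : Rn n)‖) ^ (n + 1))⁻¹, tsum_nonneg fun l => by positivity, hv,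
    fun N => ⟨C N, fun l => ?_⟩, fun x M hM => ?_⟩
  · rw [mul_comm, ← le_div_iff₀ (by positivity), div_eq_mul_inv]
    exact ciInf_le (hbdd l) N
  obtain ⟨N, y, rfl⟩ := exists_eq_ofStep x
  set x := ofStep Λ X N y
  have hM' : ∀ l : Λ, v l * ‖x l‖ ≤ ((1 + ‖(l : Rn n)‖) ^ (n + 1))⁻¹ * M := fun l => by
    rw [← div_eq_inv_mul, le_div_iff₀ (by positivity), mul_comm]
    exact hM l
  have hM0 : 0 ≤ M := le_trans (mul_nonneg (by positivity)
    (mul_nonneg (hv 0) (norm_nonneg _))) (hM 0)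
  have hR : ∀ R : ℕ, p x ≤ (∑' l : Λ, ((1 + ‖(l : Rn n)‖) ^ (n + 1))⁻¹) * M +
      C (N + 1) * ‖y‖ * ((R : ℝ) + 1)⁻¹ := by
    intro R
    let F := (finite_lattice_norm_le Λ R).toFinset
    choose s hs _ using fun l : Λ => exists_single l (x l)
    obtain ⟨z, hz, hzn⟩ := exists_ofStep_eq (N := N + 1)
      (fun l : Λ => if l ∈ F then 0 else x l) (C := ‖y‖ * ((R : ℝ) + 1)⁻¹) (by positivity)
      fun l => by
        split_ifs with hl
        · rw [norm_zero]
          positivity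
        · have hl' : (R : ℝ) < ‖(l : Rn n)‖ := by
            refine not_le.1 fun h => hl ((Set.Finite.mem_toFinset _).2 h)
          refine (y.norm_apply_le l).trans ?_
          rw [pow_succ, mul_assoc]
          refine mul_le_mul_of_nonneg_left ?_ (norm_nonneg _)
          rw [← div_eq_inv_mul, le_div_iff₀ (by positivity)]
          refine mul_le_mul_of_nonneg_left (by linarith) (by positivity)
    have hx : x = ∑ l ∈ F, s l + ofStep Λ X (N + 1) z := by
      refine ext fun m => ?_
      have h1 : (∑ l ∈ F, s l : SlowSeq Λ X) m = ∑ l ∈ F, (s l) m :=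
        map_sum (⟨⟨fun w : SlowSeq Λ X => w m, rfl⟩, fun _ _ => rfl⟩ : SlowSeq Λ X →+ X) s F
      rw [add_apply, h1, hz]
      simp_rw [hs, Finset.sum_pi_single]
      split_ifs <;> simp
    calc p x ≤ ∑ l ∈ F, p (s l) + p (ofStep Λ X (N + 1) z) := by
          rw [hx]
          refine (map_add_le_add p _ _).trans ?_
          gcongr
          exact Finset.le_sum_of_subadditive p (map_zero p).le (map_add_le_add p) F s
      _ ≤ ∑ l ∈ F, ((1 + ‖(l : Rn n)‖) ^ (n + 1))⁻¹ * M +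
          C (N + 1) * (‖y‖ * ((R : ℝ) + 1)⁻¹) := by
          refine add_le_add (Finset.sum_le_sum fun l _ => (hsingle _ l _ (hs l)).trans (hM' l)) ?_
          exact (hC _ z).trans (mul_le_mul_of_nonneg_left hzn (hC0 _).le)
      _ ≤ _ := by
          rw [← Finset.sum_mul, mul_assoc]
          gcongr
          exact hsum.sum_le_tsum F fun l _ => by positivity
  have hlim : Tendsto (fun R : ℕ => (∑' l : Λ, ((1 + ‖(l : Rn n)‖) ^ (n + 1))⁻¹) * M +
      C (N + 1) * ‖y‖ * ((R : ℝ) + 1)⁻¹) atTop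
      (𝓝 ((∑' l : Λ, ((1 + ‖(l : Rn n)‖) ^ (n + 1))⁻¹) * M + C (N + 1) * ‖y‖ * 0)) := by
    refine Tendsto.const_add _ (Tendsto.const_mul _ ?_)
    simpa using tendsto_one_div_add_atTop_nhds_zero_nat (𝕜 := ℝ)
  simpa using ge_of_tendsto' hlim hR

/-- A linear map to `s'(Λ; X)` is continuous if it is so for all continuous seminorms. -/
theorem continuous_of_seminorm {Y : Type*} [AddCommGroup Y] [Module ℂ Y] [TopologicalSpace Y]
    [IsTopologicalAddGroup Y] (T : Y →ₗ[ℂ] SlowSeq Λ X)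
    (hT : ∀ p : Seminorm ℝ (SlowSeq Λ X), Continuous p → ∀ ε > 0, ∀ᶠ y in 𝓝 0, p (T y) < ε) :
    Continuous T := by
  refine (with_gaugeSeminormFamily (𝕜 := ℝ) (E := SlowSeq Λ X)).continuous_of_continuous_comp
    (T.restrictScalars ℝ) fun i => ?_
  let p := gaugeSeminormFamily ℝ (SlowSeq Λ X) i
  have hp : Continuous p := with_gaugeSeminormFamily.continuous_seminorm i
  refine Seminorm.continuous_of_continuousAt_zero (𝕝 := ℝ) ?_
  rw [ContinuousAt, map_zero, Metric.tendsto_nhds]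
  intro ε hε
  filter_upwards [hT p hp ε hε] with y hy
  rw [Real.dist_0_eq_abs, abs_of_nonneg (apply_nonneg _ _)]
  exact hy

end SlowSeq

end Sequences

/-! ### The topology of `𝓓'_E` -/

namespace DistSpace

/-- The additive map `f ↦ (φ ↦ f * φ)` that induces the topology of `𝓓'_E`. -/
def toUniformOnFun :
    DistSpace J →+ UniformOnFun 𝓢(Rn n, ℂ) E {B | Bornology.IsVonNBounded ℂ B} where
  toFun f := UniformOnFun.ofFun _ (convE f)
  map_zero' := congrArg (UniformOnFun.ofFun _) (funext fun φ => by
    simpa using convE_smul_left (0 : ℂ) (0 : DistSpace J) φ)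
  map_add' f g := congrArg (UniformOnFun.ofFun _) (funext fun φ => convE_add_left f g φ)

instance : IsTopologicalAddGroup (DistSpace J) := topologicalAddGroup_induced toUniformOnFun

theorem convE_zero_left (φ : 𝓢(Rn n, ℂ)) : convE (0 : DistSpace J) φ = 0 := by
  simpa using convE_smul_left (0 : ℂ) (0 : DistSpace J) φ

theorem tendsto_zero_iff {ι : Type*} {l : Filter ι} {F : ι → DistSpace J} :
    Tendsto F l (𝓝 0) ↔ ∀ B : Set 𝓢(Rn n, ℂ), Bornology.IsVonNBounded ℂ B → ∀ ε > 0,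
      ∀ᶠ i in l, ∀ φ ∈ B, ‖convE (F i) φ‖ < ε := by
  rw [nhds_induced, tendsto_comap_iff, UniformOnFun.tendsto_iff_tendstoUniformlyOn]
  refine forall₂_congr fun B _ => ?_
  rw [Metric.tendstoUniformlyOn_iff]
  refine forall₂_congr fun ε _ => ?_
  refine eventually_congr (Eventually.of_forall fun i => forall₂_congr fun φ _ => ?_)
  change dist (convE 0 φ) (convE (F i) φ) < ε ↔ _
  rw [convE_zero_left, dist_zero_left]

end DistSpace

/-! ### The analysis operator -/

section Analysis

variable {Λ₀ Λ₁ : Submodule ℤ (Rn n)} [DiscreteTopology Λ₀] [IsZLattice ℝ Λ₀]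

/-- For `f ∈ 𝓓'_E`, the norms in `E_d(Λ₀)` of the coefficients `(V_ψ f(λ₀, λ₁))_{λ₀}` grow at most
polynomially in `λ₁`. -/
theorem exists_slowSeq_stft [CompleteSpace E] (hJ : HasOperators J) (W : DiscreteWindow Λ₀)
    (ψ : 𝓢(Rn n, ℂ)) (f : DistSpace J) : ∃ x : SlowSeq Λ₁ (DiscreteSpace J W),
      ∀ (l₁ : Λ₁) (l₀ : Λ₀), x l₁ l₀ = stft ψ f.toDist l₀ l₁ := by
  obtain ⟨K, C, μ, a, hC, h⟩ := exists_coeff_norm_le hJ W ψ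
  obtain ⟨m, C₁, hC₁, h₁⟩ := exists_norm_convE_le f
  obtain ⟨K₂, C₂, hC₂, h₂⟩ := exists_schwartzNorm_modulate_convS_modulate_le m K W.schwartz a
  choose c hc hb using h f
  obtain ⟨y, hy, -⟩ := exists_ofStep_eq (N := K + K₂) (fun l₁ : Λ₁ => c l₁)
    (C := C * (C₁ * C₂)) (by positivity) fun l₁ => by
      refine (hb l₁ (C₁ * (C₂ * (1 + ‖(l₁ : Rn n)‖) ^ K₂)) fun k => ?_).trans (le_of_eq (by ring))
      refine (mul_le_mul_of_nonneg_left (h₁ _) (by positivity)).trans ?_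
      rw [mul_left_comm]
      exact mul_le_mul_of_nonneg_left (h₂ _ _) hC₁
  exact ⟨SlowSeq.ofStep _ _ _ y, fun l₁ l₀ => by rw [hy, hc]⟩

/-- The Gabor coefficient operator `C_ψ`. A continuous seminorm of `C_ψ f` is bounded by a series
`∑ v(λ₁) ‖(V_ψ f(λ₀, λ₁))_{λ₀}‖` with a rapidly decreasing weight `v`. By Poisson's summation
formula this is bounded by the supremum of `‖f * φ‖` over the set of test functions
`v(λ₁) (1 + |λ₁|)^(n + 1 + K) (1 + |μ|)^K M_{λ₁}(M_μ χ * a)`, which is bounded in `𝓢(ℝⁿ)`. -/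
theorem exists_analysis_operator [CompleteSpace E] [DiscreteTopology Λ₁] [IsZLattice ℝ Λ₁]
    (hJ : HasOperators J) (W : DiscreteWindow Λ₀) (ψ : 𝓢(Rn n, ℂ)) :
    ∃ C : DistSpace J →L[ℂ] SlowSeq Λ₁ (DiscreteSpace J W),
      ∀ (f : DistSpace J) (l₁ : Λ₁) (l₀ : Λ₀), C f l₁ l₀ = stft ψ f.toDist l₀ l₁ := by
  choose T hT using exists_slowSeq_stft (Λ₁ := Λ₁) hJ W ψ
  have hext : ∀ x y : SlowSeq Λ₁ (DiscreteSpace J W), (∀ l₁ l₀, x l₁ l₀ = y l₁ l₀) → x = y :=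
    fun x y h => SlowSeq.ext fun l₁ =>
      Subtype.ext (p := (· ∈ discreteSubmodule J W)) (funext fun l₀ => h l₁ l₀)
  let L : DistSpace J →ₗ[ℂ] SlowSeq Λ₁ (DiscreteSpace J W) :=
    { toFun := T
      map_add' := fun f g => hext _ _ fun l₁ l₀ => by
        change _ = T f l₁ l₀ + T g l₁ l₀
        rw [hT, hT, hT]
        rfl
      map_smul' := fun a f => hext _ _ fun l₁ l₀ => by
        change _ = a * T f l₁ l₀
        rw [hT, hT]
        rfl }
  refine ⟨⟨L, SlowSeq.continuous_of_seminorm L fun p hp ε hε => ?_⟩, hT⟩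
  obtain ⟨K, C, μ, a, hC, h⟩ := exists_coeff_norm_le hJ W ψ
  obtain ⟨v, S, hS, hv, hvN, hpv⟩ := SlowSeq.exists_seminorm_le p hp
  let φ : Λ₁ → (Fin n → ℤ) → 𝓢(Rn n, ℂ) := fun l k =>
    modulate l (convS (modulate (μ k) W.schwartz) a)
  let w : Λ₁ → (Fin n → ℤ) → ℝ := fun l k =>
    v l * (1 + ‖(l : Rn n)‖) ^ (n + 1 + K) * (1 + ‖μ k‖) ^ K
  have hw : ∀ l k, 0 ≤ w l k := fun l k => by have := hv l; positivity
  let B : Set 𝓢(Rn n, ℂ) := range fun q : Λ₁ × (Fin n → ℤ) => (w q.1 q.2 : ℂ) • φ q.1 q.2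
  have hB : Bornology.IsVonNBounded ℂ B := by
    refine isVonNBounded_iff_schwartzNorm.2 fun m => ?_
    obtain ⟨K₂, C₂, hC₂, h₂⟩ := exists_schwartzNorm_modulate_convS_modulate_le m K W.schwartz a
    obtain ⟨C₃, hC₃⟩ := hvN (n + 1 + K + K₂)
    refine ⟨C₂ * C₃, ?_⟩
    rintro _ ⟨⟨l, k⟩, rfl⟩
    rw [map_smul_eq_mul, Complex.norm_real, Real.norm_of_nonneg (hw l k)]
    calc w l k * schwartzNorm m (φ l k)
        = v l * (1 + ‖(l : Rn n)‖) ^ (n + 1 + K) *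
          ((1 + ‖μ k‖) ^ K * schwartzNorm m (φ l k)) := by simp only [w]; ring
      _ ≤ v l * (1 + ‖(l : Rn n)‖) ^ (n + 1 + K) * (C₂ * (1 + ‖(l : Rn n)‖) ^ K₂) :=
          mul_le_mul_of_nonneg_left (h₂ _ _) (by have := hv l; positivity)
      _ = C₂ * ((1 + ‖(l : Rn n)‖) ^ (n + 1 + K + K₂) * v l) := by ring
      _ ≤ C₂ * C₃ := mul_le_mul_of_nonneg_left (hC₃ l) hC₂
  let δ : ℝ := ε / (S * C + 1)
  have hδ : 0 < δ := by positivity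
  filter_upwards [tendsto_zero_iff.1 tendsto_id B hB δ hδ] with f hf
  have hM : p (L f) ≤ S * (C * δ) := by
    refine hpv _ _ fun l => ?_
    obtain ⟨c, hc, hb⟩ := h f l
    have hcl : L f l = c :=
      Subtype.ext (p := (· ∈ discreteSubmodule J W))
        (funext fun l₀ => (hT f l l₀).trans (hc l₀).symm)
    rw [hcl]
    rcases (hv l).eq_or_lt with h0 | h0
    · rw [← h0]
      simp only [zero_mul, mul_zero]
      positivity
    -- dividing by `v(l) (1 + |l|)^(n + 1 + K)` puts the bound on `B` in the form needed
    have := hb (δ / (v l * (1 + ‖(l : Rn n)‖) ^ (n + 1 + K))) fun k => by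
      rw [le_div_iff₀ (by positivity)]
      have h3 := (hf _ ⟨(l, k), rfl⟩).le
      rw [← convELin_apply, map_smul, norm_smul, Complex.norm_real, Real.norm_of_nonneg (hw l k)]
        at h3
      refine le_trans (le_of_eq ?_) h3
      simp only [w, φ, convELin_apply, id]
      ring
    calc _ ≤ (1 + ‖(l : Rn n)‖) ^ (n + 1) * (v l * (C * (1 + ‖(l : Rn n)‖) ^ K *
          (δ / (v l * (1 + ‖(l : Rn n)‖) ^ (n + 1 + K))))) := by gcongr
      _ = C * δ := by
        rw [pow_add _ (n + 1) K]
        field_simp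
  refine hM.trans_lt ?_
  rw [← mul_assoc, mul_div_assoc', div_lt_iff₀ (by positivity)]
  nlinarith [mul_nonneg hS hC]

end Analysis

/-! ### Coefficients and synthesis in the discrete space -/

section Discrete

variable {Λ : Submodule ℤ (Rn n)}

/-- A test function `θ` such that `c_λ = ⟨S_χ(c), T_λ θ⟩`, namely `θ = χ̄ / ∫ |χ|²`. -/
theorem exists_dual_window (W : DiscreteWindow Λ) : ∃ θ : 𝓢(Rn n, ℂ),
    ∀ (c : DiscreteSpace J W) (l : Λ),
      J.toCLM (DiscreteSpace.synth J W c) (translate l θ) = c l := by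
  let θ₀ : 𝓢(Rn n, ℂ) := conjugate W.schwartz
  have hsupp : HasCompactSupport θ₀ :=
    W.χ.hasCompactSupport.comp_left (g := starRingEnd ℂ) (map_zero _)
  obtain ⟨t₀, ht₀⟩ : ∃ t, W.χ t ≠ 0 := by
    by_contra hne
    push Not at hne
    exact W.ne_zero (by ext t; simpa using hne t)
  let I : ℝ := ∫ t, ‖W.χ t‖ ^ 2
  have hI : 0 < I := by
    refine Continuous.integral_pos_of_hasCompactSupport_nonneg_nonzero (x := t₀)
      (W.χ.contDiff.continuous.norm.pow 2) ?_ (fun t => by positivity) (by simpa using ht₀)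
    exact W.χ.hasCompactSupport.comp_left (g := fun z : ℂ => ‖z‖ ^ 2) (by simp)
  refine ⟨(I : ℂ)⁻¹ • θ₀, fun c l => ?_⟩
  have hc : HasCompactSupport (translate (l : Rn n) θ₀) :=
    hsupp.comp_homeomorph (Homeomorph.subRight (l : Rn n))
  have hpt : ∀ t, synthFun W c t * translate (l : Rn n) θ₀ t
      = c l * ((‖W.χ (t - l)‖ ^ 2 : ℝ) : ℂ) := by
    intro t
    change synthFun W c t * starRingEnd ℂ (W.χ (t - l)) = _
    rcases eq_or_ne (W.χ (t - l)) 0 with h0 | h0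
    · simp [h0]
    · rw [synthFun_eq W c l (W.mem_of_ne h0), mul_assoc, Complex.mul_conj,
        Complex.normSq_eq_norm_sq]
  rw [map_smul, map_smul, (DiscreteSpace.synth_spec c).2 _ hc]
  simp_rw [hpt]
  rw [integral_const_mul, integral_complex_ofReal,
    integral_sub_right_eq_self (fun t => ‖W.χ t‖ ^ 2) (l : Rn n), smul_eq_mul]
  have : (I : ℂ) ≠ 0 := by exact_mod_cast hI.ne'
  change (I : ℂ)⁻¹ * (c l * (I : ℂ)) = c l
  field_simp

/-- The coefficients of `c ∈ E_d(Λ)` grow at most polynomially, because `c_λ = ⟨T_{-λ} S_χ(c), θ⟩`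
and the translations of `E` have polynomially bounded norms. -/
theorem exists_norm_coeff_le (hJ : HasOperators J) (W : DiscreteWindow Λ) :
    ∃ (K : ℕ) (C : ℝ), 0 ≤ C ∧ ∀ (c : DiscreteSpace J W) (l : Λ),
      ‖c l‖ ≤ C * (1 + ‖(l : Rn n)‖) ^ K * ‖c‖ := by
  obtain ⟨θ, hθ⟩ := exists_dual_window (J := J) W
  obtain ⟨K, C, hC, h⟩ := hJ.translate
  let L : E →L[ℂ] ℂ := (evalDist θ).comp J.toCLM
  refine ⟨K, ‖L‖ * C, by positivity, fun c l => ?_⟩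
  obtain ⟨A, hA, hA'⟩ := h (-l)
  have h1 : c l = L (A (DiscreteSpace.synth J W c)) := by
    change c l = J.toCLM (A (DiscreteSpace.synth J W c)) θ
    rw [hA', ← hθ c l]
    change _ = J.toCLM (DiscreteSpace.synth J W c) (translate (- -(l : Rn n)) θ)
    rw [neg_neg]
  rw [norm_neg] at hA
  rw [h1, DiscreteSpace.norm_eq]
  calc _ ≤ ‖L‖ * (‖A‖ * ‖DiscreteSpace.synth J W c‖) :=
        (L.le_opNorm _).trans (mul_le_mul_of_nonneg_left (A.le_opNorm _) (norm_nonneg _))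
    _ ≤ ‖L‖ * ((C * (1 + ‖(l : Rn n)‖) ^ K) * ‖DiscreteSpace.synth J W c‖) := by gcongr
    _ = _ := by ring

/-- For every `η ∈ 𝓢(ℝⁿ)` the map `c ↦ ∑_λ c_λ T_λ η` is bounded from `E_d(Λ)` to `E`, since
`c_λ = (S_χ(c) * θ̌)(λ)` with the test function `θ` of `exists_dual_window`. -/
theorem exists_synthesis [CompleteSpace E] [DiscreteTopology Λ] [IsZLattice ℝ Λ]
    (hJ : HasOperators J) (W : DiscreteWindow Λ) :
    ∃ (m : ℕ) (C : ℝ), 0 ≤ C ∧ ∀ (c : DiscreteSpace J W) (η : 𝓢(Rn n, ℂ)), ∃ e : E,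
      ‖e‖ ≤ C * schwartzNorm m η * ‖c‖ ∧
      ∀ h, HasSum (fun l : Λ => c l * schwartzToDist (translate l η) h) (J.toCLM e h) := by
  obtain ⟨θ, hθ⟩ := exists_dual_window (J := J) W
  obtain ⟨b, e, he⟩ := exists_basis_equiv Λ
  obtain ⟨K, C, hC, h⟩ := exists_norm_sampling_le hJ b
  obtain ⟨m₁, C₁, hC₁, h₁⟩ := hJ.conv
  obtain ⟨m₂, C₂, hC₂, h₂⟩ := exists_schwartzNorm_convS_modulate_le (n := n) m₁ K
  have hp : 0 ≤ schwartzNorm m₂ (reflect θ) := apply_nonneg _ _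
  refine ⟨m₂, C * (C₁ * C₂ * schwartzNorm m₂ (reflect θ)), by positivity, fun c η => ?_⟩
  choose A hA hA' using h₁
  let v := DiscreteSpace.synth J W c
  let f : DistSpace J := ofDist (J.toCLM v) fun φ => ⟨A φ v, hA' φ v⟩
  have hf : ∀ φ, ‖convE f φ‖ ≤ C₁ * schwartzNorm m₁ φ * ‖v‖ := fun φ => by
    rw [convE_eq f φ (hA' φ v)]
    exact ((A φ).le_opNorm v).trans (mul_le_mul_of_nonneg_right (hA φ) (norm_nonneg _))
  refine ⟨sampling hJ b f (reflect θ) η, ?_, fun g => ?_⟩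
  · refine (h f (reflect θ) η (C₁ * C₂ * schwartzNorm m₂ (reflect θ) * schwartzNorm m₂ η * ‖c‖)
      fun k => ?_).2.trans (le_of_eq (by ring))
    calc _ ≤ (1 + ‖dualVec b k‖) ^ K * (C₁ * schwartzNorm m₁ _ * ‖v‖) :=
          mul_le_mul_of_nonneg_left (hf _) (by positivity)
      _ = C₁ * ‖v‖ * ((1 + ‖dualVec b k‖) ^ K *
          schwartzNorm m₁ (convS (modulate (dualVec b k) η) (reflect θ))) := by ring
      _ ≤ C₁ * ‖v‖ * (C₂ * schwartzNorm m₂ η * schwartzNorm m₂ (reflect θ)) :=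
          mul_le_mul_of_nonneg_left (h₂ _ _ _) (by positivity)
      _ = _ := by
          rw [DiscreteSpace.norm_eq]
          ring
  · rw [← e.hasSum_iff]
    refine (hasSum_sampling hJ b f (reflect θ) η g).congr_fun fun k => ?_
    rw [Function.comp, ← hθ c (e k), he, conv, reflect_reflect]
    rfl

end Discrete

/-! ### The synthesis operator -/

/-- A series of tempered distributions that is dominated by a continuous seminorm converges in the
strong dual. -/
theorem exists_hasSum_tempDist {ι : Type*} {u : ι → TempDist n} {w : ι → ℝ} (hw : Summable w)
    (m : ℕ) (h : ∀ i φ, ‖u i φ‖ ≤ w i * schwartzNorm m φ) : ∃ v : TempDist n, HasSum u v := by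
  have hs : ∀ φ, Summable fun i => u i φ := fun φ =>
    (hw.mul_right (schwartzNorm m φ)).of_norm_bounded (h · φ)
  let v₀ : 𝓢(Rn n, ℂ) →ₗ[ℂ] ℂ :=
    { toFun := fun φ => ∑' i, u i φ
      map_add' := fun φ η => by
        simp only [map_add]
        exact (hs φ).tsum_add (hs η)
      map_smul' := fun a φ => by
        simp only [map_smul, RingHom.id_apply]
        exact (hs φ).tsum_const_smul a }
  have hv : Continuous v₀ := by
    refine continuous_of_continuousAt_zero v₀ ?_
    rw [ContinuousAt, map_zero]
    have h0 : Tendsto (fun φ => (∑' i, w i) * schwartzNorm (n := n) m φ) (𝓝 0) (𝓝 0) := by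
      have := (continuous_schwartzNorm (n := n) m).tendsto 0
      rw [map_zero] at this
      simpa using this.const_mul (∑' i, w i)
    refine squeeze_zero_norm (fun φ => ?_) h0
    rw [← tsum_mul_right]
    exact tsum_of_norm_bounded (hw.mul_right (schwartzNorm m φ)).hasSum (h · φ)
  refine ⟨⟨v₀, hv⟩, ?_⟩
  refine (UniformConvergenceCLM.tendsto_iff_tendstoUniformlyOn (RingHom.id ℂ) ℂ _).2 fun B hB => ?_
  obtain ⟨C, hC⟩ := isVonNBounded_iff_schwartzNorm.1 hB m
  have hb : ∀ i, ∀ φ ∈ B, ‖u i φ‖ ≤ ‖w i‖ * C := fun i φ hφ => (h i φ).trans (by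
    refine mul_le_mul (le_abs_self _) (hC φ hφ) (apply_nonneg _ _) (norm_nonneg _))
  have := tendstoUniformlyOn_tsum (hw.norm.mul_right C) hb
  refine this.congr (Eventually.of_forall fun F φ _ => ?_)
  exact (map_sum (evalDist φ) u F).symm

theorem modulate_translate_convS (x ξ : Rn n) (ψ φ : 𝓢(Rn n, ℂ)) :
    modulate ξ (translate x (convS ψ (modulate (-ξ) φ))) = convS (timeFreqShift x ξ ψ) φ := by
  rw [convS_comm, translate_convS, convS_comm, modulate_convS, modulate_modulate_neg]
  rfl

theorem hasSum_modOp {Λ₀ : Submodule ℤ (Rn n)} (hJ : HasOperators J) {c : Λ₀ → ℂ} {ξ : Rn n}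
    {ψ φ : 𝓢(Rn n, ℂ)} {e : E}
    (he : ∀ h, HasSum (fun k : Λ₀ =>
      c k * schwartzToDist (translate k (convS ψ (modulate (-ξ) φ))) h) (J.toCLM e h))
    (h : 𝓢(Rn n, ℂ)) : HasSum (fun k : Λ₀ =>
      c k * schwartzToDist (timeFreqShift (k : Rn n) ξ ψ) (convS (reflect φ) h))
      (J.toCLM (hJ.modOp ξ e) h) := by
  have h1 : J.toCLM (hJ.modOp ξ e) h = J.toCLM e (modulate ξ h) := by
    rw [hJ.toCLM_modOp]
    rfl
  rw [h1]
  refine (he (modulate ξ h)).congr_fun fun k => ?_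
  rw [schwartzToDist_convS, ← modulate_translate_convS, schwartzToDist_modulate]

section Synthesis

variable {Λ₀ Λ₁ : Submodule ℤ (Rn n)} [DiscreteTopology Λ₀] [IsZLattice ℝ Λ₀]
  [DiscreteTopology Λ₁] [IsZLattice ℝ Λ₁]

/-- The series defining `D_ψ x` converges in `𝓢'(ℝⁿ)`. -/
theorem exists_hasSum_timeFreqShift (hJ : HasOperators J) (W : DiscreteWindow Λ₀)
    (ψ : 𝓢(Rn n, ℂ)) (x : SlowSeq Λ₁ (DiscreteSpace J W)) : ∃ u : TempDist n,
      HasSum (fun l : Λ₀ × Λ₁ => x l.2 l.1 •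
        schwartzToDist (timeFreqShift (l.1 : Rn n) l.2 ψ)) u := by
  obtain ⟨N, y, rfl⟩ := SlowSeq.exists_eq_ofStep x
  obtain ⟨K, C, hC, h⟩ := exists_norm_coeff_le hJ W
  obtain ⟨m, C₁, hC₁, h₁⟩ := exists_pairing_timeFreqShift_le (n := n) (K + N + (n + 1))
  have hS := ((summable_zlattice_inv_pow Λ₀ n.lt_add_one).mul_of_nonneg
    (summable_zlattice_inv_pow Λ₁ n.lt_add_one) (fun l => by positivity)
    (fun l => by positivity)).mul_left (C * ‖y‖ * (C₁ * schwartzNorm m ψ))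
  refine exists_hasSum_tempDist hS m fun l φ => ?_
  set x₀ : ℝ := 1 + ‖(l.1 : Rn n)‖ with hx₀
  set x₁ : ℝ := 1 + ‖(l.2 : Rn n)‖ with hx₁
  have h0 : 1 ≤ x₀ := by simp [hx₀]
  have h1 : 1 ≤ x₁ := by simp [hx₁]
  have hc : ‖SlowSeq.ofStep Λ₁ (DiscreteSpace J W) N y l.2 l.1‖
      ≤ C * ‖y‖ * (x₀ ^ (K + N) * x₁ ^ (K + N)) := by
    refine (h _ l.1).trans ?_
    calc _ ≤ C * x₀ ^ K * (‖y‖ * x₁ ^ N) :=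
          mul_le_mul_of_nonneg_left (y.norm_apply_le l.2) (by positivity)
      _ = C * ‖y‖ * (x₀ ^ K * x₁ ^ N) := by ring
      _ ≤ _ := by
          gcongr
          · exact Nat.le_add_right _ _
          · exact Nat.le_add_left _ _
  rw [_root_.smul_apply, norm_smul]
  refine (mul_le_mul_of_nonneg_right hc (norm_nonneg _)).trans ?_
  calc _ = C * ‖y‖ * ((x₀ ^ (n + 1))⁻¹ * (x₁ ^ (n + 1))⁻¹) * (x₀ ^ (K + N + (n + 1)) *
        x₁ ^ (K + N + (n + 1)) * ‖schwartzToDist (timeFreqShift (l.1 : Rn n) l.2 ψ) φ‖) := by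
        rw [pow_add _ (K + N) (n + 1), pow_add _ (K + N) (n + 1)]
        field_simp
    _ ≤ C * ‖y‖ * ((x₀ ^ (n + 1))⁻¹ * (x₁ ^ (n + 1))⁻¹) *
        (C₁ * schwartzNorm m ψ * schwartzNorm m φ) :=
        mul_le_mul_of_nonneg_left (h₁ _ _ _ _) (by positivity)
    _ = _ := by ring

/-- Convolutions of `D_ψ x` with Schwartz functions belong to `E`, with a bound: since
`(M_ξ T_λ ψ) * φ = M_ξ T_λ (ψ * M_{-ξ} φ)`, one has
`D_ψ x * φ = ∑_ξ M_ξ ∑_λ x_{λ, ξ} T_λ (ψ * M_{-ξ} φ)`, and `ψ * M_{-ξ} φ` decays rapidly in `ξ`. -/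
theorem exists_norm_convDist_le [CompleteSpace E] (hJ : HasOperators J) (W : DiscreteWindow Λ₀)
    (ψ : 𝓢(Rn n, ℂ)) (N : ℕ) : ∃ (m : ℕ) (C : ℝ), 0 ≤ C ∧
      ∀ (y : WeightedLinf Λ₁ (DiscreteSpace J W) N) (u : TempDist n),
        HasSum (fun l : Λ₀ × Λ₁ => SlowSeq.ofStep _ _ N y l.2 l.1 •
          schwartzToDist (timeFreqShift (l.1 : Rn n) l.2 ψ)) u →
        ∀ φ, ∃ e : E, J.toCLM e = convDist u φ ∧ ‖e‖ ≤ C * schwartzNorm m φ * ‖y‖ := by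
  obtain ⟨m₁, C₁, hC₁, h₁⟩ := exists_synthesis hJ W
  obtain ⟨K, C₂, hC₂, h₂⟩ := hJ.exists_norm_modOp_le
  obtain ⟨m, C₃, hC₃, h₃⟩ := exists_schwartzNorm_convS_modulate_le (n := n) m₁ (K + N + (n + 1))
  have hS := summable_zlattice_inv_pow Λ₁ n.lt_add_one
  have hS0 : 0 ≤ ∑' l : Λ₁, ((1 + ‖(l : Rn n)‖) ^ (n + 1))⁻¹ := tsum_nonneg fun l => by positivity
  have hψ : 0 ≤ schwartzNorm m ψ := apply_nonneg _ _
  refine ⟨m, C₂ * C₁ * (C₃ * schwartzNorm m ψ) * ∑' l : Λ₁, ((1 + ‖(l : Rn n)‖) ^ (n + 1))⁻¹,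
    by positivity, fun y u hu φ => ?_⟩
  set x := SlowSeq.ofStep Λ₁ (DiscreteSpace J W) N y
  choose e he hes using fun l : Λ₁ => h₁ (x l) (convS ψ (modulate (-(l : Rn n)) φ))
  have hb : ∀ l : Λ₁, ‖hJ.modOp l (e l)‖ ≤ C₂ * C₁ * (C₃ * schwartzNorm m ψ) *
      schwartzNorm m φ * ‖y‖ * ((1 + ‖(l : Rn n)‖) ^ (n + 1))⁻¹ := by
    intro l
    set r : ℝ := 1 + ‖(l : Rn n)‖ with hr
    have h4 := h₃ (-l) φ ψ
    rw [norm_neg, convS_comm] at h4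
    have hr0 : 0 < r := by positivity
    have h5 : 0 ≤ schwartzNorm m₁ (convS ψ (modulate (-(l : Rn n)) φ)) := apply_nonneg _ _
    calc _ ≤ C₂ * r ^ K * (C₁ * schwartzNorm m₁ (convS ψ (modulate (-(l : Rn n)) φ)) *
            (‖y‖ * r ^ N)) := by
          refine (h₂ _ _).trans (mul_le_mul_of_nonneg_left ((he l).trans ?_) (by positivity))
          exact mul_le_mul_of_nonneg_left (y.norm_apply_le l) (by positivity)
      _ = C₂ * C₁ * ‖y‖ * (r ^ (n + 1))⁻¹ *
          (r ^ (K + N + (n + 1)) * schwartzNorm m₁ (convS ψ (modulate (-(l : Rn n)) φ))) := by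
          rw [pow_add r (K + N) (n + 1), pow_add r K N]
          field_simp
      _ ≤ C₂ * C₁ * ‖y‖ * (r ^ (n + 1))⁻¹ * (C₃ * schwartzNorm m φ * schwartzNorm m ψ) :=
          mul_le_mul_of_nonneg_left h4 (by positivity)
      _ = _ := by ring
  have hs : Summable fun l : Λ₁ => hJ.modOp l (e l) := (hS.mul_left _).of_norm_bounded hb
  refine ⟨∑' l : Λ₁, hJ.modOp l (e l), ?_, ?_⟩
  · ext h
    have h1 : HasSum (fun l : Λ₁ => J.toCLM (hJ.modOp l (e l)) h)
        (J.toCLM (∑' l : Λ₁, hJ.modOp l (e l)) h) :=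
      (hs.hasSum.mapL J.toCLM).mapL (evalDist h)
    have h2 : HasSum (fun q : Λ₁ × Λ₀ => x q.1 q.2 *
        schwartzToDist (timeFreqShift (q.2 : Rn n) q.1 ψ) (convS (reflect φ) h))
        (u (convS (reflect φ) h)) :=
      (Equiv.prodComm Λ₁ Λ₀).hasSum_iff.2 (hu.mapL (evalDist (convS (reflect φ) h)))
    have h3 : ∀ l : Λ₁, HasSum (fun k : Λ₀ => x l k *
        schwartzToDist (timeFreqShift (k : Rn n) l ψ) (convS (reflect φ) h))
        (J.toCLM (hJ.modOp l (e l)) h) :=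
      fun l => hasSum_modOp hJ (hes l) h
    exact h1.unique (h2.prod_fiberwise h3)
  · refine (tsum_of_norm_bounded (hS.mul_left _).hasSum hb).trans (le_of_eq ?_)
    rw [tsum_mul_left]
    ring

/-- The Gabor synthesis operator `D_ψ`. By the universal property of the inductive limit it suffices
to bound `D_ψ x * φ`, for `φ` in a bounded set, on every step. -/
theorem exists_synthesis_operator [CompleteSpace E] (hJ : HasOperators J) (W : DiscreteWindow Λ₀)
    (ψ : 𝓢(Rn n, ℂ)) : ∃ D : SlowSeq Λ₁ (DiscreteSpace J W) →L[ℂ] DistSpace J,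
      ∀ c : SlowSeq Λ₁ (DiscreteSpace J W),
        HasSum (fun l : Λ₀ × Λ₁ => c l.2 l.1 •
          schwartzToDist (timeFreqShift (l.1 : Rn n) l.2 ψ)) (D c).toDist := by
  have hex : ∀ x : SlowSeq Λ₁ (DiscreteSpace J W), ∃ f : DistSpace J,
      HasSum (fun l : Λ₀ × Λ₁ => x l.2 l.1 •
        schwartzToDist (timeFreqShift (l.1 : Rn n) l.2 ψ)) f.toDist := by
    intro x
    obtain ⟨u, hu⟩ := exists_hasSum_timeFreqShift hJ W ψ x
    obtain ⟨N, y, rfl⟩ := SlowSeq.exists_eq_ofStep x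
    obtain ⟨m, C, hC, h⟩ := exists_norm_convDist_le (Λ₁ := Λ₁) hJ W ψ N
    exact ⟨ofDist u fun φ => (h y u hu φ).imp fun e he => he.1, hu⟩
  choose T hT using hex
  let D : SlowSeq Λ₁ (DiscreteSpace J W) →ₗ[ℂ] DistSpace J :=
    { toFun := T
      map_add' := fun x y => by
        refine toDist_injective ((hT (x + y)).unique ?_)
        refine ((hT x).add (hT y)).congr_fun fun l => ?_
        exact add_smul (x l.2 l.1) (y l.2 l.1)
          (schwartzToDist (timeFreqShift (l.1 : Rn n) l.2 ψ))
      map_smul' := fun a x => by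
        refine toDist_injective ((hT (a • x)).unique ?_)
        refine HasSum.congr_fun (HasSum.const_smul a (hT x)) fun l => ?_
        exact mul_smul a (x l.2 l.1) (schwartzToDist (timeFreqShift (l.1 : Rn n) l.2 ψ)) }
  have hbound : ∀ N, ∃ (m : ℕ) (C : ℝ), 0 ≤ C ∧
      ∀ (y : WeightedLinf Λ₁ (DiscreteSpace J W) N) φ,
        ‖convE (D (SlowSeq.ofStep _ _ N y)) φ‖ ≤ C * schwartzNorm m φ * ‖y‖ := by
    intro N
    obtain ⟨m, C, hC, h⟩ := exists_norm_convDist_le (Λ₁ := Λ₁) hJ W ψ N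
    refine ⟨m, C, hC, fun y φ => ?_⟩
    obtain ⟨e, he, hn⟩ := h y _ (hT _) φ
    exact (convE_eq (D (SlowSeq.ofStep _ _ N y)) φ he).symm ▸ hn
  refine ⟨⟨D, continuous_of_continuousAt_zero D ?_⟩, hT⟩
  rw [ContinuousAt, map_zero, tendsto_zero_iff]
  intro B hB ε hε
  have hB' : ∀ N, ∃ C, 0 ≤ C ∧ ∀ (y : WeightedLinf Λ₁ (DiscreteSpace J W) N), ∀ φ ∈ B,
      ‖convE (D (SlowSeq.ofStep _ _ N y)) φ‖ ≤ C * ‖y‖ := by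
    intro N
    obtain ⟨m, C, hC, h⟩ := hbound N
    obtain ⟨C', hC'⟩ := isVonNBounded_iff_schwartzNorm.1 hB m
    refine ⟨C * |C'|, by positivity, fun y φ hφ => (h y φ).trans ?_⟩
    have := (hC' φ hφ).trans (le_abs_self C')
    gcongr
  -- restricted to `B`, the convolutions with `D_ψ x` form an element of `ℓ^∞(B; E)`
  have hmem : ∀ x, Memℓp (fun φ : B => convE (D x) φ) ⊤ := by
    intro x
    obtain ⟨N, y, rfl⟩ := SlowSeq.exists_eq_ofStep x
    obtain ⟨C, -, h⟩ := hB' N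
    exact memℓp_infty_iff.2 ⟨C * ‖y‖, by rintro _ ⟨φ, rfl⟩; exact h y φ φ.2⟩
  let L : SlowSeq Λ₁ (DiscreteSpace J W) →ₗ[ℂ] lp (fun _ : B => E) ⊤ :=
    { toFun := fun x => ⟨fun φ : B => convE (D x) φ, hmem x⟩
      map_add' := fun x y => Subtype.ext (funext fun φ => by
        change convE (D (x + y)) φ = convE (D x) φ + convE (D y) φ
        rw [map_add, convE_add_left])
      map_smul' := fun a x => Subtype.ext (funext fun φ => by
        change convE (D (a • x)) φ = a • convE (D x) φ
        rw [map_smul, convE_smul_left]) }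
  have hL : Continuous L := SlowSeq.continuous_of_bound L fun N => by
    obtain ⟨C, hC, h⟩ := hB' N
    exact ⟨C, fun y => lp.norm_le_of_forall_le (by positivity) fun φ => h y φ φ.2⟩
  have h0 := hL.tendsto 0
  rw [map_zero] at h0
  filter_upwards [h0.norm.eventually (gt_mem_nhds (by simpa using hε))] with x hx φ hφ
  exact (lp.norm_apply_le_norm (by simp) (L x) ⟨φ, hφ⟩).trans_lt hx

end Synthesis

end TMIB

end

theorem proposition5p2 {n : ℕ} {E : Type*} [NormedAddCommGroup E] [NormedSpace ℂ E]
    [CompleteSpace E] (J : TMIB.DistInclusion n E)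
    (hE : TMIB.IsTMIB J ∨ TMIB.IsDTMIB J)
    (Λ₀ Λ₁ : Submodule ℤ (TMIB.Rn n)) [DiscreteTopology Λ₀] [IsZLattice ℝ Λ₀]
    [DiscreteTopology Λ₁] [IsZLattice ℝ Λ₁]
    (W : TMIB.DiscreteWindow Λ₀) (ψ : 𝓢(TMIB.Rn n, ℂ)) :
    (∃ C : TMIB.DistSpace J →L[ℂ] TMIB.SlowSeq Λ₁ (TMIB.DiscreteSpace J W),
      ∀ (f : TMIB.DistSpace J) (l₁ : Λ₁) (l₀ : Λ₀), C f l₁ l₀ = TMIB.stft ψ f.toDist l₀ l₁) ∧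
    (∃ D : TMIB.SlowSeq Λ₁ (TMIB.DiscreteSpace J W) →L[ℂ] TMIB.DistSpace J,
      ∀ c : TMIB.SlowSeq Λ₁ (TMIB.DiscreteSpace J W),
        HasSum (fun l : Λ₀ × Λ₁ =>
          c l.2 l.1 • TMIB.schwartzToDist (TMIB.timeFreqShift (l.1 : TMIB.Rn n) l.2 ψ))
          (D c).toDist) := by
  have hJ : TMIB.HasOperators J := hE.elim TMIB.IsTMIB.hasOperators TMIB.IsDTMIB.hasOperators
  exact ⟨TMIB.exists_analysis_operator hJ W ψ, TMIB.exists_synthesis_operator hJ W ψ⟩
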